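/- **Setting.** Let $B$ be a complete Hausdorff topological field of characteristic $0$, let $G$ be a compact topological group acting continuously on $B$ by field automorphisms, let $F=B^G$, and let $K\subset F$ be a subfield with $[F:K]<\infty$. Every $B$-vector space carries the inductive limit topology of its finite-dimensional subspaces (with their product topology). For a $K$-algebra $R$ (always commutative), $G$ acts on $B\otimes_K R$ through $B$. Let $U=\mathrm{Spec}\,\mathcal A$ be a pro-unipotent affine group scheme over $B$ with a continuous semilinear action of $G$ on $\mathcal A$ by Hopf algebra automorphisms. Then $G$ acts on the groups $U(B\otimes_K R)$ by $u\mapsto g u g^{-1}$. For $X$ affine of finite type over $B$, $X(B\otimes_K R)$ has the topology induced by a closed embedding in an affine space. Let $U^1=U$, $U^{i+1}=[U,U^i]$ be the descending central series and $U_n=U/U^{n+1}$ ($n\ge 0$). Assume that each $U_n$ is of finite type over $B$, and give $U(B\otimes_K R)=\varprojlim_n U_n(B\otimes_K R)$ the limit topology. For $M=U$, $U_n$ or $U^i/U^{i+1}$ let $H^1(G,M)$ be the functor $R\mapsto H^1(G,M(B\otimes_K R))$ (continuous cohomology) from $K$-algebras to sets, and likewise $H^j(G,U^i/U^{i+1})$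 for all $j\ge 0$. **Proposition 2.** Suppose that $H^j(G,(U^i/U^{i+1})(B))$ is a finite-dimensional $F$-vector space for all $i\ge1$, $j\ge0$, and that $H^0(G,U^i/U^{i+1})(K)=(U^i/U^{i+1})(B)^G$ is trivial for all $i\ge 1$. Then: 1. For each $n$, the functor $H^1(G,U_n)$ is represented by an affine $K$-scheme of finite type $\mathrm{Spec}\,\mathcal O_n$. 2. The functor $H^1(G,U)$ is represented by the affine pro-algebraic variety $\mathrm{Spec}(\varinjlim_n\mathcal O_n)=\varprojlim_n\mathrm{Spec}\,\mathcal O_n$. Here the transition maps and the projections are those induced by $U_{n+1}\to U_n$ and $U\to U_n$. 3. For each $n$ there is a natural connecting map $\delta_n:H^1(G,U_n)\to H^2(G,U^{n+1}/U^{n+2})$. Every continuous cocycle $c$ with values in $U_n(B\otimes_K R)$ lifts to a continuous map $l:G\to U_{n+1}(B\otimes_K R)$, and for each such lift $\delta_n[c]$ is the class of $(g,h)\mapsto l(gh)\,(g\,l(h))^{-1}\,l(g)^{-1}$. Its kernel $I(G,U_n)=\delta_n^{-1}(0)$ is a closed subscheme of $H^1(G,U_n)$, the functor $H^1(G,U^{n+1}/U^{n+2})$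 is represented by an affine space $\mathbb A^d_K$ with $d$ finite, and there is an isomorphism of functors $$H^1(G,U^{n+1}/U^{n+2})\times I(G,U_n)\;\simeq\;H^1(G,U_{n+1})$$ that is compatible with the projection $H^1(G,U_{n+1})\to H^1(G,U_n)$ and with the translation action of $H^1(G,U^{n+1}/U^{n+2})$. -/

import Mathlib

open scoped TensorProduct Topology
open CategoryTheory
open Coalgebra Bialgebra HopfAlgebra

universe u

namespace UnipCoh

/-- A Hopf subalgebra `C` of a commutative Hopf algebra `A` over a field `B`: a subalgebra with
`Δ(C) ⊆ C ⊗ C` and `S(C) ⊆ C`. For `U = Spec A`, the Hopf subalgebras of `A` are the coordinate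
rings of the quotient groups `U / N` of `U`, `N` a closed normal subgroup. -/
structure HopfSubalgebra (B A : Type u) [Field B] [CommRing A] [HopfAlgebra B A]
    extends Subalgebra B A where
  comul_mem : ∀ a ∈ toSubalgebra,
    comul (R := B) a ∈ (Algebra.TensorProduct.map toSubalgebra.val toSubalgebra.val).range
  antipode_mem : ∀ a ∈ toSubalgebra, antipode B a ∈ toSubalgebra

namespace HopfSubalgebra

variable {B A : Type u} [Field B] [CommRing A] [HopfAlgebra B A] (C : HopfSubalgebra B A)

theorem tensor_injective (S : Subalgebra B A) :
    Function.Injective (Algebra.TensorProduct.map S.val S.val) :=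
  TensorProduct.map_injective_of_flat_flat S.val.toLinearMap S.val.toLinearMap
    Subtype.val_injective Subtype.val_injective

/-- The restricted comultiplication. -/
noncomputable def comulHom : C.toSubalgebra →ₐ[B] C.toSubalgebra ⊗[B] C.toSubalgebra :=
  (AlgEquiv.ofInjective _ (tensor_injective C.toSubalgebra)).symm.toAlgHom.comp
    (((comulAlgHom B A).comp C.toSubalgebra.val).codRestrict _
      fun a => C.comul_mem a a.2)

theorem map_comulHom (a : C.toSubalgebra) :
    Algebra.TensorProduct.map C.toSubalgebra.val C.toSubalgebra.val (C.comulHom a) =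
      comul (R := B) (a : A) := by
  have := AlgEquiv.ofInjective_apply _ (tensor_injective C.toSubalgebra) (C.comulHom a)
  rw [← this]
  exact congrArg Subtype.val (AlgEquiv.apply_symm_apply _ _)

/-- A Hopf subalgebra of a commutative Hopf algebra over a field is a Hopf algebra. -/
noncomputable instance instBialgebra : Bialgebra B C.toSubalgebra :=
  Bialgebra.ofAlgHom C.comulHom ((counitAlgHom B A).comp C.toSubalgebra.val)
    (by
      have hinj : Function.Injective (Algebra.TensorProduct.map C.toSubalgebra.val
          (Algebra.TensorProduct.map C.toSubalgebra.val C.toSubalgebra.val)) :=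
        TensorProduct.map_injective_of_flat_flat C.toSubalgebra.val.toLinearMap
          (Algebra.TensorProduct.map C.toSubalgebra.val C.toSubalgebra.val).toLinearMap
          Subtype.val_injective (tensor_injective _)
      ext a
      apply hinj
      have h1 : ∀ t : C.toSubalgebra ⊗[B] C.toSubalgebra,
          Algebra.TensorProduct.map C.toSubalgebra.val
            (Algebra.TensorProduct.map C.toSubalgebra.val C.toSubalgebra.val)
            (Algebra.TensorProduct.assoc B B B C.toSubalgebra C.toSubalgebra C.toSubalgebra
              (Algebra.TensorProduct.map C.comulHom (.id B _) t)) =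
          TensorProduct.assoc B A A A ((comul (R := B)).rTensor A
            (Algebra.TensorProduct.map C.toSubalgebra.val C.toSubalgebra.val t)) := by
        intro t
        induction t with
        | zero => simp
        | add x y hx hy => simp only [map_add, hx, hy]
        | tmul x y =>
          simp only [Algebra.TensorProduct.map_tmul, AlgHom.id_apply, LinearMap.rTensor_tmul,
            Subalgebra.coe_val, ← map_comulHom]
          generalize C.comulHom x = s
          induction s with
          | zero => simp
          | add x y hx hy => simp only [map_add, TensorProduct.add_tmul, hx, hy]
          | tmul p q => rfl
      have h2 : ∀ t : C.toSubalgebra ⊗[B] C.toSubalgebra,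
          Algebra.TensorProduct.map C.toSubalgebra.val
            (Algebra.TensorProduct.map C.toSubalgebra.val C.toSubalgebra.val)
              (Algebra.TensorProduct.map (.id B _) C.comulHom t) =
          (comul (R := B)).lTensor A
            (Algebra.TensorProduct.map C.toSubalgebra.val C.toSubalgebra.val t) := by
        intro t
        induction t with
        | zero => simp
        | add x y hx hy => simp only [map_add, hx, hy]
        | tmul x y =>
          simp only [Algebra.TensorProduct.map_tmul, AlgHom.id_apply, LinearMap.lTensor_tmul,
            Subalgebra.coe_val, map_comulHom]
      refine (h1 _).trans (Eq.trans ?_ (h2 _).symm)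
      exact (congrArg (fun t => TensorProduct.assoc B A A A ((comul (R := B)).rTensor A t))
        (C.map_comulHom a)).trans ((coassoc_apply (R := B) (a : A)).trans
          (congrArg ((comul (R := B)).lTensor A) (C.map_comulHom a)).symm))
    (by
      ext a
      have hinj : Function.Injective (TensorProduct.map (LinearMap.id (R := B) (M := B))
          C.toSubalgebra.val.toLinearMap) :=
        TensorProduct.map_injective_of_flat_flat _ _ Function.injective_id Subtype.val_injective
      apply hinj
      have h1 : ∀ t : C.toSubalgebra ⊗[B] C.toSubalgebra,
          TensorProduct.map (LinearMap.id (R := B) (M := B)) C.toSubalgebra.val.toLinearMap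
            (Algebra.TensorProduct.map ((counitAlgHom B A).comp C.toSubalgebra.val) (.id B _) t) =
          (counit (R := B)).rTensor A
            (Algebra.TensorProduct.map C.toSubalgebra.val C.toSubalgebra.val t) := by
        intro t
        induction t with
        | zero => simp
        | add x y hx hy => simp only [map_add, hx, hy]
        | tmul x y => rfl
      refine (h1 _).trans ?_
      exact (congrArg ((counit (R := B)).rTensor A) (C.map_comulHom a)).trans
        (rTensor_counit_comul (R := B) (a : A)))
    (by
      ext a
      have hinj : Function.Injective (TensorProduct.map C.toSubalgebra.val.toLinearMap
          (LinearMap.id (R := B) (M := B))) :=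
        TensorProduct.map_injective_of_flat_flat _ _ Subtype.val_injective Function.injective_id
      apply hinj
      have h1 : ∀ t : C.toSubalgebra ⊗[B] C.toSubalgebra,
          TensorProduct.map C.toSubalgebra.val.toLinearMap (LinearMap.id (R := B) (M := B))
            (Algebra.TensorProduct.map (.id B _) ((counitAlgHom B A).comp C.toSubalgebra.val) t) =
          (counit (R := B)).lTensor A
            (Algebra.TensorProduct.map C.toSubalgebra.val C.toSubalgebra.val t) := by
        intro t
        induction t with
        | zero => simp
        | add x y hx hy => simp only [map_add, hx, hy]
        | tmul x y => rfl
      refine (h1 _).trans ?_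
      exact (congrArg ((counit (R := B)).lTensor A) (C.map_comulHom a)).trans
        (lTensor_counit_comul (R := B) (a : A)))

/-- The restricted antipode. -/
noncomputable def antipodeHom : C.toSubalgebra →ₐ[B] C.toSubalgebra :=
  ((antipodeAlgHom B A).comp C.toSubalgebra.val).codRestrict _ fun a => C.antipode_mem a a.2

/-- The Hopf algebra structure of a Hopf subalgebra: all structure maps are restricted. -/
noncomputable instance instHopfAlgebra : HopfAlgebra B C.toSubalgebra where
  antipode := C.antipodeHom.toLinearMap
  mul_antipode_rTensor_comul := by
    ext a
    have h1 : ∀ t : C.toSubalgebra ⊗[B] C.toSubalgebra,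
        ((LinearMap.mul' B C.toSubalgebra (C.antipodeHom.toLinearMap.rTensor _ t) :
          C.toSubalgebra) : A) = LinearMap.mul' B A ((antipode B).rTensor A
            (Algebra.TensorProduct.map C.toSubalgebra.val C.toSubalgebra.val t)) := by
      intro t
      induction t with
      | zero => simp
      | add x y hx hy => simp only [map_add, Subalgebra.coe_add, hx, hy]
      | tmul x y => rfl
    refine (h1 (C.comulHom a)).trans ?_
    rw [map_comulHom, mul_antipode_rTensor_comul_apply]
    rfl
  mul_antipode_lTensor_comul := by
    ext a
    have h1 : ∀ t : C.toSubalgebra ⊗[B] C.toSubalgebra,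
        ((LinearMap.mul' B C.toSubalgebra (C.antipodeHom.toLinearMap.lTensor _ t) :
          C.toSubalgebra) : A) = LinearMap.mul' B A ((antipode B).lTensor A
            (Algebra.TensorProduct.map C.toSubalgebra.val C.toSubalgebra.val t)) := by
      intro t
      induction t with
      | zero => simp
      | add x y hx hy => simp only [map_add, Subalgebra.coe_add, hx, hy]
      | tmul x y => rfl
    refine (h1 (C.comulHom a)).trans ?_
    rw [map_comulHom, mul_antipode_lTensor_comul_apply]
    rfl

theorem coe_counit (a : C.toSubalgebra) : counit (R := B) a = counit (R := B) (a : A) := rfl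

theorem map_comul (a : C.toSubalgebra) :
    TensorProduct.map C.toSubalgebra.val.toLinearMap C.toSubalgebra.val.toLinearMap
      (comul (R := B) a) = comul (R := B) (a : A) := C.map_comulHom a

/-- The supremum of a family of Hopf subalgebras. -/
noncomputable def sSup (X : Set (HopfSubalgebra B A)) : HopfSubalgebra B A where
  toSubalgebra := ⨆ C ∈ X, C.toSubalgebra
  comul_mem := by
    set T : Subalgebra B A := ⨆ C ∈ X, C.toSubalgebra
    suffices h : T ≤ (Algebra.TensorProduct.map T.val T.val).range.comap (comulAlgHom B A) from
      fun a ha => h ha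
    refine iSup₂_le fun C hC a ha => ?_
    have hle : C.toSubalgebra ≤ T := le_iSup₂_of_le C hC le_rfl
    obtain ⟨t, ht⟩ := C.comul_mem a ha
    refine ⟨Algebra.TensorProduct.map (Subalgebra.inclusion hle) (Subalgebra.inclusion hle) t, ?_⟩
    refine Eq.trans ?_ ht
    have : (Algebra.TensorProduct.map T.val T.val).comp (Algebra.TensorProduct.map
        (Subalgebra.inclusion hle) (Subalgebra.inclusion hle)) =
        Algebra.TensorProduct.map C.toSubalgebra.val C.toSubalgebra.val := by
      rw [← Algebra.TensorProduct.map_comp]; rfl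
    exact DFunLike.congr_fun this t
  antipode_mem := by
    set T : Subalgebra B A := ⨆ C ∈ X, C.toSubalgebra
    suffices h : T ≤ T.comap (antipodeAlgHom B A) from fun a ha => h ha
    refine iSup₂_le fun C hC a ha => ?_
    exact (le_iSup₂_of_le C hC le_rfl : C.toSubalgebra ≤ T) (C.antipode_mem a ha)

end HopfSubalgebra

/-! ### Points -/

theorem conv_apply {B C S ι : Type*} [CommRing B] [CommRing C] [Bialgebra B C] [CommRing S]
    [Algebra B S] (u v : WithConv (C →ₐ[B] S)) (c : C) (r : Coalgebra.Repr B c ι) :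
    (u * v).ofConv c = ∑ i ∈ r.index, u.ofConv (r.left i) * v.ofConv (r.right i) := by
  have := AlgHom.convMul_apply u v c
  refine this.trans ?_
  rw [← r.eq, map_sum]
  simp

theorem conv_inv_mul {B C S : Type*} [CommRing B] [CommRing C] [HopfAlgebra B C] [CommRing S]
    [Algebra B S] (u : WithConv (C →ₐ[B] S)) :
    WithConv.toConv (u.ofConv.comp (antipodeAlgHom B C)) * u = 1 := by
  apply WithConv.ext
  ext c
  have r := Coalgebra.Repr.arbitrary B c
  refine (conv_apply _ u c r).trans ?_
  refine Eq.trans ?_ ((congrArg u.ofConv (sum_antipode_mul_eq_algebraMap_counit r)).trans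
    (u.ofConv.commutes _))
  rw [map_sum]
  exact Finset.sum_congr rfl fun i _ => (map_mul u.ofConv _ _).symm

/-- The points of a commutative Hopf algebra with values in a commutative algebra form a group
under convolution; the inverse is composition with the antipode. -/
noncomputable instance pointGroup {B C S : Type*} [CommRing B] [CommRing C] [HopfAlgebra B C]
    [CommRing S] [Algebra B S] : Group (WithConv (C →ₐ[B] S)) where
  inv u := .toConv (u.ofConv.comp (antipodeAlgHom B C))
  inv_mul_cancel := conv_inv_mul

section Restrict
variable {B A S : Type u} [Field B] [CommRing A] [HopfAlgebra B A] [CommRing S] [Algebra B S]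

theorem conv_eq_iff_one {C : Type*} [CommRing C] [Bialgebra B C] (u : WithConv (C →ₐ[B] S)) :
    u = 1 ↔ ∀ c, u.ofConv c = algebraMap B S (counit (R := B) c) := by
  constructor
  · rintro rfl c; rfl
  · intro h
    apply WithConv.ext
    ext c
    exact h c

/-- The comultiplication of an element of a smaller Hopf subalgebra. -/
theorem comul_inclusion {D C : HopfSubalgebra B A} (h : D.toSubalgebra ≤ C.toSubalgebra)
    (d : D.toSubalgebra) :
    comul (R := B) (Subalgebra.inclusion h d) =
      TensorProduct.map (Subalgebra.inclusion h).toLinearMap (Subalgebra.inclusion h).toLinearMap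
        (comul (R := B) d) := by
  apply HopfSubalgebra.tensor_injective C.toSubalgebra
  refine (C.map_comul _).trans (Eq.trans (D.map_comul d).symm ?_)
  generalize comul (R := B) d = t
  induction t with
  | zero => simp
  | add x y hx hy => simp only [map_add, hx, hy]
  | tmul x y => rfl

/-- Restriction of points. -/
noncomputable def restrictHom (S : Type u) [CommRing S] [Algebra B S]
    {D C : HopfSubalgebra B A} (h : D.toSubalgebra ≤ C.toSubalgebra) :
    WithConv (C.toSubalgebra →ₐ[B] S) →* WithConv (D.toSubalgebra →ₐ[B] S) where
  toFun u := .toConv (u.ofConv.comp (Subalgebra.inclusion h))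
  map_one' := rfl
  map_mul' u v := by
    apply WithConv.ext
    ext d
    refine (AlgHom.convMul_apply u v _).trans (Eq.trans ?_ (AlgHom.convMul_apply _ _ d).symm)
    refine (congrArg _ (comul_inclusion h d)).trans ?_
    generalize comul (R := B) d = t
    induction t with
    | zero => simp
    | add x y hx hy => simp only [map_add, hx, hy]
    | tmul x y => rfl

/-- Restriction of points from the full Hopf algebra. -/
noncomputable def restrictTopHom (S : Type u) [CommRing S] [Algebra B S]
    (C : HopfSubalgebra B A) :
    WithConv (A →ₐ[B] S) →* WithConv (C.toSubalgebra →ₐ[B] S) where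
  toFun u := .toConv (u.ofConv.comp C.toSubalgebra.val)
  map_one' := rfl
  map_mul' u v := by
    apply WithConv.ext
    ext d
    refine (AlgHom.convMul_apply u v _).trans (Eq.trans ?_ (AlgHom.convMul_apply _ _ d).symm)
    refine (congrArg _ (C.map_comul d).symm).trans ?_
    generalize comul (R := B) d = t
    induction t with
    | zero => simp
    | add x y hx hy => simp only [map_add, hx, hy]
    | tmul x y => rfl

end Restrict

section LowerCentral
variable {B A : Type u} [Field B] [CommRing A] [HopfAlgebra B A]

/-- Let `D ⊆ C` be Hopf subalgebras of `A`, so that `U_D = Spec D` is a quotient of `U_C = Spec C`.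
This says that `U_C` is a central extension of `U_D`: the kernel of `U_C → U_D` is central in `U_C`
(on points with values in every commutative `B`-algebra `S`). -/
def IsCentralOver (C D : HopfSubalgebra B A) : Prop :=
  ∃ h : D.toSubalgebra ≤ C.toSubalgebra,
    ∀ (S : Type u) [CommRing S] [Algebra B S] (u v : WithConv (C.toSubalgebra →ₐ[B] S)),
      restrictHom S h v = 1 → u * v = v * u

/-- The Hopf subalgebra `B ⊆ A`, the coordinate ring of the trivial quotient group. -/
def trivialHopf (B A : Type u) [Field B] [CommRing A] [HopfAlgebra B A] : HopfSubalgebra B A where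
  toSubalgebra := ⊥
  comul_mem := by
    rintro _ ⟨b, rfl⟩
    refine ⟨algebraMap B _ b, ?_⟩
    exact (AlgHom.commutes (Algebra.TensorProduct.map _ _) b).trans
      ((comulAlgHom B A).commutes b).symm
  antipode_mem := by
    rintro _ ⟨b, rfl⟩
    exact ⟨b, ((antipodeAlgHom B A).commutes b).symm⟩

/-- `level B A n` is the coordinate ring `A_n` of `U_n = U / U^{n+1}`, where `U = Spec A` and
`U = U^1 ⊇ U^2 ⊇ …`, `U^{i+1} = [U, U^i]`, is the descending central series of closed subgroups.
One has `A_0 = B`, as `U_0` is trivial. If `N = U^{n+1}` is the kernel of `U → U_n`, then `[U, N]` is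
the smallest closed normal subgroup `M` of `U` contained in `N` such that `N / M` is central in
`U / M`. So `U_{n+1} = U / [U, N]` is the largest quotient group of `U` that is a central extension
of `U_n`, and `A_{n+1}` is the largest Hopf subalgebra that is central over `A_n`
(see `level_succ_isCentralOver`). -/
noncomputable def level (B A : Type u) [Field B] [CommRing A] [HopfAlgebra B A] :
    ℕ → HopfSubalgebra B A
  | 0 => trivialHopf B A
  | n + 1 => HopfSubalgebra.sSup {C | IsCentralOver C (level B A n)}

theorem isCentralOver_self (D : HopfSubalgebra B A) : IsCentralOver D D := by
  refine ⟨le_rfl, fun S _ _ u v hv => ?_⟩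
  have : v = 1 := hv
  rw [this, mul_one, one_mul]

theorem level_le_succ (n : ℕ) : (level B A n).toSubalgebra ≤ (level B A (n + 1)).toSubalgebra :=
  le_iSup₂_of_le (f := fun (C : HopfSubalgebra B A)
    (_ : C ∈ {C | IsCentralOver C (level B A n)}) => C.toSubalgebra)
    (level B A n) (isCentralOver_self _) le_rfl

theorem level_succ_isCentralOver (n : ℕ) : IsCentralOver (level B A (n + 1)) (level B A n) := by
  refine ⟨level_le_succ n, fun S _ _ u v hv => ?_⟩
  have key : ∀ (C : HopfSubalgebra B A) (hC : IsCentralOver C (level B A n))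
      (h : C.toSubalgebra ≤ (level B A (n + 1)).toSubalgebra),
      restrictHom S h (u * v) = restrictHom S h (v * u) := by
    rintro C ⟨hD, hC⟩ h
    rw [map_mul, map_mul]
    exact hC S _ _ hv
  let E : Subalgebra B (level B A (n + 1)).toSubalgebra :=
    AlgHom.equalizer (u * v).ofConv (v * u).ofConv
  have hle : (level B A (n + 1)).toSubalgebra ≤ E.map (level B A (n + 1)).toSubalgebra.val := by
    refine iSup₂_le (f := fun (C : HopfSubalgebra B A)
      (_ : C ∈ {C | IsCentralOver C (level B A n)}) => C.toSubalgebra) fun C hC a ha => ?_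
    have h : C.toSubalgebra ≤ (level B A (n + 1)).toSubalgebra :=
      le_iSup₂_of_le (f := fun (C : HopfSubalgebra B A)
        (_ : C ∈ {C | IsCentralOver C (level B A n)}) => C.toSubalgebra) C hC le_rfl
    have hE : (⟨a, h ha⟩ : (level B A (n + 1)).toSubalgebra) ∈ E :=
      (AlgHom.mem_equalizer _ _ _).2
        (DFunLike.congr_fun (congrArg WithConv.ofConv (key C hC h)) (⟨a, ha⟩ : C.toSubalgebra))
    exact ⟨⟨a, h ha⟩, hE, rfl⟩
  apply WithConv.ext
  ext a
  obtain ⟨a', ha', hh⟩ := hle a.2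
  have : a' = a := Subtype.ext hh
  exact this ▸ ha'

end LowerCentral

section Action
variable (G B A : Type u) [Group G] [Field B] [MulSemiringAction G B]

/-- The action of `g` on a `B`-module with semilinear `G`-action, as a semilinear map. -/
def smulSemilinear [AddCommGroup A] [Module B A] [DistribMulAction G A] [SMulDistribClass G B A]
    (g : G) : A →ₛₗ[MulSemiringAction.toRingHom G B g] A where
  toFun a := g • a
  map_add' := smul_add g
  map_smul' b a := smul_distrib_smul g b a

/-- A semilinear action of `G` on the commutative Hopf algebra `A` over `B` by ring automorphisms
that commute with the comultiplication, the counit and the antipode. -/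
class EquivariantHopf [CommRing A] [HopfAlgebra B A] [MulSemiringAction G A] : Prop
    extends SMulDistribClass G B A where
  comul_smul : ∀ (g : G) (a : A), comul (R := B) (g • a) =
    TensorProduct.map (smulSemilinear G B A g) (smulSemilinear G B A g) (comul (R := B) a)
  counit_smul : ∀ (g : G) (a : A), counit (R := B) (g • a) = g • counit (R := B) a
  antipode_smul : ∀ (g : G) (a : A), antipode B (g • a) = g • antipode B a

end Action

section Stable
variable {G B A : Type u} [Group G] [Field B] [MulSemiringAction G B]
  [CommRing A] [HopfAlgebra B A] [MulSemiringAction G A] [EquivariantHopf G B A]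

theorem smul_algebraMap' (g : G) (b : B) : g • algebraMap B A b = algebraMap B A (g • b) := by
  rw [Algebra.algebraMap_eq_smul_one, smul_distrib_smul, smul_one, ← Algebra.algebraMap_eq_smul_one]

/-- The Hopf subalgebra `{a | g • a ∈ C}`. -/
def HopfSubalgebra.translate (g : G) (C : HopfSubalgebra B A) : HopfSubalgebra B A where
  carrier := {a | g • a ∈ C.toSubalgebra}
  mul_mem' {a b} ha hb := by
    change g • (a * b) ∈ C.toSubalgebra
    rw [smul_mul']; exact mul_mem ha hb
  add_mem' {a b} ha hb := by
    change g • (a + b) ∈ C.toSubalgebra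
    rw [smul_add]; exact add_mem ha hb
  algebraMap_mem' b := by
    change g • algebraMap B A b ∈ C.toSubalgebra
    rw [smul_algebraMap']; exact C.toSubalgebra.algebraMap_mem _
  comul_mem a ha := by
    obtain ⟨t, ht⟩ := C.comul_mem _ ha
    have h1 : comul (R := B) a = TensorProduct.map (smulSemilinear G B A g⁻¹)
        (smulSemilinear G B A g⁻¹) (comul (R := B) (g • a)) := by
      rw [← EquivariantHopf.comul_smul, inv_smul_smul]
    rw [h1, ← ht]
    clear ht h1
    induction t with
    | zero => simp
    | add x y hx hy => simp only [map_add]; exact add_mem hx hy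
    | tmul x y =>
      refine ⟨⟨g⁻¹ • (x : A), ?_⟩ ⊗ₜ ⟨g⁻¹ • (y : A), ?_⟩, rfl⟩
      · change g • g⁻¹ • (x : A) ∈ C.toSubalgebra
        rw [smul_inv_smul]; exact x.2
      · change g • g⁻¹ • (y : A) ∈ C.toSubalgebra
        rw [smul_inv_smul]; exact y.2
  antipode_mem a ha := by
    change g • antipode B a ∈ C.toSubalgebra
    rw [← EquivariantHopf.antipode_smul]
    exact C.antipode_mem _ ha

/-- The ring `S` with its `B`-algebra structure twisted by `g`. -/
def Twist (_ : G) (S : Type u) : Type u := S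

instance (g : G) (S : Type u) [CommRing S] : CommRing (Twist g S) := inferInstanceAs (CommRing S)

instance (g : G) (S : Type u) [CommRing S] [Algebra B S] : Algebra B (Twist g S) :=
  ((algebraMap B S).comp (MulSemiringAction.toRingHom G B g⁻¹)).toAlgebra

theorem twist_algebraMap (g : G) (S : Type u) [CommRing S] [Algebra B S] (b : B) :
    algebraMap B (Twist g S) b = (algebraMap B S (g⁻¹ • b) : S) := rfl

/-- A point of the translate, viewed as a point with values in the twist. -/
def twistPoint (g : G) {S : Type u} [CommRing S] [Algebra B S] (C : HopfSubalgebra B A)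
    (u : WithConv ((C.translate g).toSubalgebra →ₐ[B] S)) :
    WithConv (C.toSubalgebra →ₐ[B] Twist g S) :=
  .toConv
    { toFun := fun c => u.ofConv ⟨g⁻¹ • (c : A), by
        change g • g⁻¹ • (c : A) ∈ C.toSubalgebra
        rw [smul_inv_smul]; exact c.2⟩
      map_one' := by
        refine Eq.trans (congrArg u.ofConv ?_) (map_one u.ofConv)
        exact Subtype.ext (smul_one _)
      map_zero' := by
        refine Eq.trans (congrArg u.ofConv ?_) (map_zero u.ofConv)
        exact Subtype.ext (smul_zero _)
      map_mul' := fun x y => by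
        refine Eq.trans (congrArg u.ofConv ?_) (map_mul u.ofConv _ _)
        exact Subtype.ext (smul_mul' _ _ _)
      map_add' := fun x y => by
        refine Eq.trans (congrArg u.ofConv ?_) (map_add u.ofConv _ _)
        exact Subtype.ext (smul_add _ _ _)
      commutes' := fun b => by
        refine Eq.trans (congrArg u.ofConv ?_) (AlgHom.commutes u.ofConv (g⁻¹ • b))
        exact Subtype.ext (smul_algebraMap' _ _) }

theorem twistPoint_apply (g : G) {S : Type u} [CommRing S] [Algebra B S] (C : HopfSubalgebra B A)
    (u : WithConv ((C.translate g).toSubalgebra →ₐ[B] S)) (a : (C.translate g).toSubalgebra) :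
    (twistPoint g C u).ofConv ⟨g • (a : A), a.2⟩ = u.ofConv a :=
  congrArg u.ofConv (Subtype.ext (inv_smul_smul _ _))

theorem twistPoint_mul (g : G) {S : Type u} [CommRing S] [Algebra B S] (C : HopfSubalgebra B A)
    (u v : WithConv ((C.translate g).toSubalgebra →ₐ[B] S)) :
    twistPoint g C (u * v) = twistPoint g C u * twistPoint g C v := by
  apply WithConv.ext
  ext c
  let r := Coalgebra.Repr.arbitrary B c
  have hm : ∀ x : C.toSubalgebra, g⁻¹ • (x : A) ∈ (C.translate g).toSubalgebra := fun x => by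
    change g • g⁻¹ • (x : A) ∈ C.toSubalgebra
    rw [smul_inv_smul]; exact x.2
  let r' : Coalgebra.Repr B (⟨g⁻¹ • (c : A), hm c⟩ : (C.translate g).toSubalgebra) _ :=
    { index := r.index
      left := fun i => ⟨g⁻¹ • (r.left i : A), hm _⟩
      right := fun i => ⟨g⁻¹ • (r.right i : A), hm _⟩
      eq := by
        apply HopfSubalgebra.tensor_injective (C.translate g).toSubalgebra
        refine Eq.trans ?_ ((C.translate g).map_comul _).symm
        change _ = comul (R := B) (g⁻¹ • (c : A))
        rw [EquivariantHopf.comul_smul, ← C.map_comul c, ← r.eq]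
        simp only [map_sum]
        rfl }
  refine (conv_apply u v _ r').trans (Eq.trans ?_
    (conv_apply (twistPoint g C u) (twistPoint g C v) c r).symm)
  rfl

theorem twistPoint_injective (g : G) {S : Type u} [CommRing S] [Algebra B S]
    (C : HopfSubalgebra B A) :
    Function.Injective (twistPoint (S := S) g C) := by
  intro u v h
  apply WithConv.ext
  ext a
  rw [← twistPoint_apply g C u, ← twistPoint_apply g C v, h]

theorem IsCentralOver.translate {C D : HopfSubalgebra B A} (hC : IsCentralOver C D)
    (hD : ∀ (g : G), ∀ a ∈ D.toSubalgebra, g • a ∈ D.toSubalgebra) (g : G) :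
    IsCentralOver (C.translate g) D := by
  obtain ⟨h, hC⟩ := hC
  refine ⟨fun d hd => h (hD g d hd), fun S _ _ u v hv => ?_⟩
  apply twistPoint_injective g C
  rw [twistPoint_mul, twistPoint_mul]
  apply hC
  rw [conv_eq_iff_one] at hv ⊢
  intro d
  have := hv ⟨g⁻¹ • (d : A), hD _ _ d.2⟩
  refine Eq.trans this ?_
  rw [twist_algebraMap]
  refine congrArg (algebraMap B S) ?_
  exact EquivariantHopf.counit_smul g⁻¹ (d : A)

/-- The descending central series is stable under the action of `G`. -/
theorem smul_mem_level (n : ℕ) (g : G) : ∀ a ∈ (level B A n).toSubalgebra,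
    g • a ∈ (level B A n).toSubalgebra := by
  induction n generalizing g with
  | zero =>
    rintro _ ⟨b, rfl⟩
    exact ⟨g • b, (smul_algebraMap' g b).symm⟩
  | succ n ih =>
    suffices h : (level B A (n + 1)).toSubalgebra ≤
        ((level B A (n + 1)).translate g).toSubalgebra from fun a ha => h ha
    refine iSup₂_le (f := fun (C : HopfSubalgebra B A)
      (_ : C ∈ {C | IsCentralOver C (level B A n)}) => C.toSubalgebra) fun C hC a ha => ?_
    have hC' : IsCentralOver (C.translate g⁻¹) (level B A n) := IsCentralOver.translate hC ih g⁻¹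
    have h : (C.translate g⁻¹).toSubalgebra ≤ (level B A (n + 1)).toSubalgebra :=
      le_iSup₂_of_le (f := fun (C : HopfSubalgebra B A)
        (_ : C ∈ {C | IsCentralOver C (level B A n)}) => C.toSubalgebra) _ hC' le_rfl
    refine h ?_
    change g⁻¹ • g • a ∈ C.toSubalgebra
    rw [inv_smul_smul]; exact ha

/-- The induced action of `G` on `A_n`. -/
instance levelAction (n : ℕ) : MulSemiringAction G (level B A n).toSubalgebra where
  smul g a := ⟨g • (a : A), smul_mem_level (B := B) (A := A) n g a a.2⟩
  one_smul a := Subtype.ext (one_smul G (a : A))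
  mul_smul g h a := Subtype.ext (mul_smul g h (a : A))
  smul_zero g := Subtype.ext (smul_zero g)
  smul_add g a b := Subtype.ext (smul_add g (a : A) b)
  smul_one g := Subtype.ext (smul_one g)
  smul_mul g a b := Subtype.ext (smul_mul' g (a : A) b)

instance levelEquivariant (n : ℕ) : EquivariantHopf G B (level B A n).toSubalgebra where
  smul_distrib_smul g b a := Subtype.ext (smul_distrib_smul (R := B) g b (a : A))
  comul_smul g a := by
    apply HopfSubalgebra.tensor_injective (level B A n).toSubalgebra
    refine ((level B A n).map_comul _).trans ?_
    refine (EquivariantHopf.comul_smul g (a : A)).trans ?_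
    rw [← (level B A n).map_comul a]
    generalize comul (R := B) a = t
    induction t with
    | zero => simp
    | add x y hx hy => simp only [map_add, hx, hy]
    | tmul x y => rfl
  counit_smul g a := EquivariantHopf.counit_smul g (a : A)
  antipode_smul g a := Subtype.ext (EquivariantHopf.antipode_smul (B := B) g (a : A))

end Stable

section Topology
variable (B V : Type u) [Field B] [TopologicalSpace B] [AddCommGroup V] [Module B V]

/-- The inductive limit topology on a `B`-vector space `V`, taken over its finite-dimensional
subspaces with their product topology: the finest topology for which every linear map `B^n → V` is
continuous, where `B^n` has the product topology. (Such a map is a continuous map onto its image `W`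
followed by the inclusion of `W`, and if it is injective, it identifies `W` with `B^n`.) -/
abbrev indTopology : TopologicalSpace V :=
  ⨆ (n : ℕ) (f : (Fin n → B) →ₗ[B] V), TopologicalSpace.coinduced f inferInstance

variable {B V}

theorem continuous_indTopology {W : Type u} [AddCommGroup W] [Module B W] (l : V →ₗ[B] W) :
    Continuous[indTopology B V, indTopology B W] l := by
  refine continuous_iSup_dom.2 fun n => continuous_iSup_dom.2 fun f => ?_
  refine continuous_coinduced_dom.2 ?_
  refine continuous_iff_coinduced_le.2 ?_
  exact le_iSup₂_of_le (f := fun (n : ℕ) (f : (Fin n → B) →ₗ[B] W) =>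
    TopologicalSpace.coinduced f inferInstance) n (l ∘ₗ f) le_rfl

end Topology

section PointTopology
variable {B A S : Type u} [Field B] [TopologicalSpace B] [CommRing A] [Algebra B A]
  [CommRing S] [Algebra B S]

/-- The topology on the points of `Spec A` with values in a `B`-algebra `S`: the coarsest one such that
for each tuple `a` of functions in `A` the map `u ↦ (u (a i))_i` to `S^k` is continuous, where `S^k` has
the inductive limit topology. If `A` is generated by `a_1, …, a_k`, it is the topology induced by the
embedding in affine space given by these generators, as polynomial maps `S^k → S^m` are continuous.
If `A` is the union of an increasing sequence of subalgebras `A_n`, it is the inverse limit of the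
topologies for the `A_n`. -/
instance pointTopology : TopologicalSpace (WithConv (A →ₐ[B] S)) :=
  ⨅ (k : ℕ) (a : Fin k → A),
    TopologicalSpace.induced (fun u i => u.ofConv (a i)) (indTopology B (Fin k → S))

theorem continuous_point_iff {X : Type*} [TopologicalSpace X] {φ : X → WithConv (A →ₐ[B] S)} :
    Continuous φ ↔ ∀ (k : ℕ) (a : Fin k → A),
      Continuous[_, indTopology B (Fin k → S)] fun x i => (φ x).ofConv (a i) := by
  simp only [continuous_iInf_rng, continuous_induced_rng]
  rfl

theorem continuous_point_eval (k : ℕ) (a : Fin k → A) :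
    Continuous[_, indTopology B (Fin k → S)] fun (u : WithConv (A →ₐ[B] S)) i => u.ofConv (a i) :=
  continuous_point_iff.1 continuous_id k a

end PointTopology

section Cohomology
variable (G M : Type u) [Group G] [TopologicalSpace G] [Group M] [TopologicalSpace M]
  [MulDistribMulAction G M]

/-- Continuous 1-cocycles of `G` with values in a (possibly non-commutative) group `M`. -/
@[ext]
structure Cocycle : Type u where
  toFun : G → M
  continuous_toFun : Continuous toFun
  map_mul : ∀ g h, toFun (g * h) = toFun g * g • toFun h

/-- Cohomologous cocycles: `M` acts on the cocycles by `(u c)(g) = u c(g) g(u⁻¹)`. -/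
instance cocycleSetoid : Setoid (Cocycle G M) where
  r c c' := ∃ u : M, ∀ g, c'.toFun g = u * c.toFun g * g • u⁻¹
  iseqv :=
    { refl := fun c => ⟨1, fun g => by simp⟩
      symm := fun {c c'} ⟨u, hu⟩ => ⟨u⁻¹, fun g => by rw [hu]; simp [mul_assoc]⟩
      trans := fun {c c' c''} ⟨u, hu⟩ ⟨v, hv⟩ =>
        ⟨v * u, fun g => by rw [hv, hu]; simp [mul_assoc]⟩ }

/-- The pointed set `H¹(G, M)`. -/
def H1 : Type u := Quotient (cocycleSetoid G M)

variable {G M}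

/-- The class of a cocycle. -/
def H1.mk (c : Cocycle G M) : H1 G M := Quotient.mk _ c

variable {N : Type u} [Group N] [TopologicalSpace N] [MulDistribMulAction G N]

/-- Functoriality of cocycles. -/
def Cocycle.map (f : M →* N) (hf : Continuous f) (he : ∀ (g : G) m, f (g • m) = g • f m)
    (c : Cocycle G M) : Cocycle G N where
  toFun g := f (c.toFun g)
  continuous_toFun := hf.comp c.continuous_toFun
  map_mul g h := by rw [c.map_mul, _root_.map_mul, he]

/-- Functoriality of `H¹`. -/
def H1.map (f : M →* N) (hf : Continuous f) (he : ∀ (g : G) m, f (g • m) = g • f m) :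
    H1 G M → H1 G N :=
  Quotient.map (Cocycle.map f hf he) fun c c' ⟨u, hu⟩ => ⟨f u, fun g => by
    simp only [Cocycle.map]; rw [hu, _root_.map_mul, _root_.map_mul, he, map_inv]⟩

end Cohomology

/-- The coboundary of an inhomogeneous `j`-cochain with values in a commutative group `M` (written
multiplicatively):
`g₀ c(g₁, …, g_j) · ∏_{0 ≤ i < j} c(…, g_i g_{i+1}, …)^{(-1)^{i+1}} · c(g₀, …, g_{j-1})^{(-1)^{j+1}}`. -/
def coboundary {G M : Type u} [Group G] [CommGroup M] [MulDistribMulAction G M] (j : ℕ) (c : (Fin j → G) → M) : (Fin (j + 1) → G) → M := fun g =>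
  g 0 • c (fun i => g i.succ) *
    ∏ i : Fin (j + 1), c (Fin.contractNth i (· * ·) g) ^ ((-1 : ℤ) ^ ((i : ℕ) + 1))

theorem map_coboundary {G M N : Type u} [Group G] [CommGroup M] [MulDistribMulAction G M]
    [CommGroup N] [MulDistribMulAction G N] (f : M →* N) (he : ∀ (g : G) m, f (g • m) = g • f m) (j : ℕ)
    (c : (Fin j → G) → M) (g : Fin (j + 1) → G) :
    f (coboundary j c g) = coboundary j (fun x => f (c x)) g := by
  simp [coboundary, he]

section AbelianCohomology
variable {G M : Type u} [Group G] [TopologicalSpace G] [CommGroup M] [TopologicalSpace M]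
  [MulDistribMulAction G M]

/-- Continuous `j`-cocycles with values in a commutative group. -/
@[ext]
structure NCocycle (G M : Type u) [Group G] [TopologicalSpace G] [CommGroup M] [TopologicalSpace M]
    [MulDistribMulAction G M] (j : ℕ) : Type u where
  toFun : (Fin j → G) → M
  continuous_toFun : Continuous toFun
  coboundary_eq_one : ∀ g, coboundary j toFun g = 1

/-- `j`-coboundaries: the coboundaries of continuous `(j-1)`-cochains (only `1` if `j = 0`). -/
def IsCoboundary : (j : ℕ) → ((Fin j → G) → M) → Prop
  | 0, w => w = 1
  | j + 1, w => ∃ b : (Fin j → G) → M, Continuous b ∧ w = coboundary j b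

/-- Continuous cohomology `H^j(G, M)`: `j`-cocycles modulo `j`-coboundaries. -/
def HN (G M : Type u) [Group G] [TopologicalSpace G] [CommGroup M] [TopologicalSpace M]
    [MulDistribMulAction G M] (j : ℕ) : Type u :=
  Quot fun c c' : NCocycle G M j => ∃ w, IsCoboundary j w ∧ c'.toFun = c.toFun * w

/-- The class of a `j`-cocycle. -/
def HN.mk {j : ℕ} (c : NCocycle G M j) : HN G M j := Quot.mk _ c

/-- The trivial `j`-cocycle. -/
def NCocycle.one (j : ℕ) : NCocycle G M j where
  toFun _ := 1
  continuous_toFun := continuous_const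
  coboundary_eq_one g := by simp [coboundary]

variable {N : Type u} [CommGroup N] [TopologicalSpace N] [MulDistribMulAction G N]

/-- Functoriality of cocycles. -/
def NCocycle.map (f : M →* N) (hf : Continuous f) (he : ∀ (g : G) m, f (g • m) = g • f m)
    {j : ℕ} (c : NCocycle G M j) : NCocycle G N j where
  toFun g := f (c.toFun g)
  continuous_toFun := hf.comp c.continuous_toFun
  coboundary_eq_one g := by rw [← map_coboundary f he, c.coboundary_eq_one, map_one]

/-- Functoriality of `H^j`. -/
def HN.map (f : M →* N) (hf : Continuous f) (he : ∀ (g : G) m, f (g • m) = g • f m)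
    (j : ℕ) : HN G M j → HN G N j :=
  Quot.map (NCocycle.map f hf he) fun c c' ⟨w, hw, h⟩ => ⟨fun g => f (w g), by
    cases j with
    | zero =>
      have hw' : w = 1 := hw
      subst hw'
      exact funext fun g => map_one f
    | succ j =>
      obtain ⟨b, hb, rfl⟩ := hw
      exact ⟨fun g => f (b g), hf.comp hb, funext fun g => map_coboundary f he j b g⟩,
    funext fun g => by simp [NCocycle.map, h]⟩

end AbelianCohomology

section Coefficients
variable (G K B : Type u) [Group G] [Field K] [Field B] [Algebra K B] [MulSemiringAction G B]
  [SMulCommClass G K B]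

/-- The action of `g` on `B ⊗_K R`, `g (b ⊗ r) = (g b) ⊗ r`. -/
noncomputable def coeffAct (R : Type u) [CommRing R] [Algebra K R] (g : G) :
    B ⊗[K] R →ₐ[K] B ⊗[K] R :=
  Algebra.TensorProduct.map (MulSemiringAction.toAlgHom K B g) (AlgHom.id K R)

variable {G K B} {R : Type u} [CommRing R] [Algebra K R]

theorem coeffAct_one (x : B ⊗[K] R) : coeffAct G K B R 1 x = x := by
  induction x with
  | zero => simp
  | add x y hx hy => rw [map_add, hx, hy]
  | tmul b r => simp [coeffAct]

theorem coeffAct_mul (g h : G) (x : B ⊗[K] R) :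
    coeffAct G K B R (g * h) x = coeffAct G K B R g (coeffAct G K B R h x) := by
  induction x with
  | zero => simp
  | add x y hx hy => simp only [map_add, hx, hy]
  | tmul b r => simp [coeffAct, mul_smul]

theorem coeffAct_algebraMap (g : G) (b : B) :
    coeffAct G K B R g (algebraMap B (B ⊗[K] R) b) = algebraMap B (B ⊗[K] R) (g • b) := by
  simp [coeffAct, Algebra.TensorProduct.algebraMap_apply]

theorem coeffAct_map {R' : Type u} [CommRing R'] [Algebra K R'] (f : R →ₐ[K] R') (g : G)
    (x : B ⊗[K] R) :
    Algebra.TensorProduct.map (AlgHom.id B B) f (coeffAct G K B R g x) =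
      coeffAct G K B R' g (Algebra.TensorProduct.map (AlgHom.id B B) f x) := by
  induction x with
  | zero => simp
  | add x y hx hy => simp only [map_add, hx, hy]
  | tmul b r => simp [coeffAct]

end Coefficients

section Points

/-- The points of `Spec A` with values in `B ⊗_K R`, with the convolution group structure. -/
abbrev Points (K B A R : Type u) [Field K] [Field B] [Algebra K B] [CommRing A] [Algebra B A]
    [CommRing R] [Algebra K R] : Type u :=
  WithConv (A →ₐ[B] (B ⊗[K] R))

variable {G K B A R : Type u} [Group G] [Field K] [Field B] [Algebra K B] [MulSemiringAction G B]
  [SMulCommClass G K B] [CommRing A] [HopfAlgebra B A] [MulSemiringAction G A]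
  [EquivariantHopf G B A] [CommRing R] [Algebra K R]

/-- The action on points: `(g u)(a) = g (u (g⁻¹ a))`. -/
noncomputable def smulPoint (g : G) (u : Points K B A R) : Points K B A R :=
  .toConv
    { toFun := fun a => coeffAct G K B R g (u.ofConv (g⁻¹ • a))
      map_one' := by rw [smul_one, map_one, map_one]
      map_zero' := by rw [smul_zero, map_zero, map_zero]
      map_mul' := fun x y => by rw [smul_mul', map_mul, map_mul]
      map_add' := fun x y => by rw [smul_add, map_add, map_add]
      commutes' := fun b => by
        rw [smul_algebraMap', AlgHom.commutes, coeffAct_algebraMap, smul_inv_smul] }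

theorem smulPoint_apply (g : G) (u : Points K B A R) (a : A) :
    (smulPoint g u).ofConv a = coeffAct G K B R g (u.ofConv (g⁻¹ • a)) := rfl

/-- `G` acts on the group `U(B ⊗_K R)` by automorphisms. -/
noncomputable instance pointsAction : MulDistribMulAction G (Points K B A R) where
  smul := smulPoint
  one_smul u := by
    apply WithConv.ext
    ext a
    refine (smulPoint_apply _ _ _).trans ?_
    rw [coeffAct_one, inv_one, one_smul]
  mul_smul g h u := by
    apply WithConv.ext
    ext a
    refine (smulPoint_apply _ _ _).trans ?_
    rw [coeffAct_mul, mul_inv_rev, mul_smul]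
    rfl
  smul_one g := by
    apply WithConv.ext
    ext a
    refine (smulPoint_apply _ _ _).trans ?_
    refine (congrArg (coeffAct G K B R g) (AlgHom.convOne_apply (g⁻¹ • a))).trans ?_
    rw [coeffAct_algebraMap, EquivariantHopf.counit_smul, smul_inv_smul]
    rfl
  smul_mul g u v := by
    apply WithConv.ext
    ext a
    refine (smulPoint_apply _ _ _).trans ?_
    let r := Coalgebra.Repr.arbitrary B a
    let r' : Coalgebra.Repr B (g⁻¹ • a) _ :=
      { index := r.index
        left := fun i => g⁻¹ • r.left i
        right := fun i => g⁻¹ • r.right i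
        eq := by
          rw [EquivariantHopf.comul_smul, ← r.eq, map_sum]
          rfl }
    rw [conv_apply u v _ r', map_sum]
    refine Eq.trans ?_ (conv_apply (smulPoint g u) (smulPoint g v) a r).symm
    exact Finset.sum_congr rfl fun i _ => map_mul _ _ _

theorem smul_points_apply (g : G) (u : Points K B A R) (a : A) :
    (g • u).ofConv a = coeffAct G K B R g (u.ofConv (g⁻¹ • a)) := rfl

/-- Functoriality of `U(B ⊗_K R)` in the `K`-algebra `R`. -/
noncomputable def pointsMap {R' : Type u} [CommRing R'] [Algebra K R'] (f : R →ₐ[K] R') :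
    Points K B A R →* Points K B A R' where
  toFun u := .toConv ((Algebra.TensorProduct.map (AlgHom.id B B) f).comp u.ofConv)
  map_one' := by
    apply WithConv.ext
    ext a
    exact AlgHom.commutes (Algebra.TensorProduct.map (AlgHom.id B B) f) (counit (R := B) a)
  map_mul' u v := by
    apply WithConv.ext
    exact AlgHom.comp_convMul_distrib _ u v

theorem pointsMap_smul {R' : Type u} [CommRing R'] [Algebra K R'] (f : R →ₐ[K] R') (g : G)
    (u : Points K B A R) : pointsMap f (g • u) = g • pointsMap f u := by
  apply WithConv.ext
  ext a
  exact coeffAct_map f g _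

theorem continuous_pointsMap [TopologicalSpace B] {R' : Type u} [CommRing R'] [Algebra K R']
    (f : R →ₐ[K] R') : Continuous (pointsMap (B := B) (A := A) f) := by
  rw [continuous_point_iff]
  intro k a
  let l : (Fin k → B ⊗[K] R) →ₗ[B] (Fin k → B ⊗[K] R') :=
    LinearMap.pi fun i => (Algebra.TensorProduct.map (AlgHom.id B B) f).toLinearMap ∘ₗ
      LinearMap.proj i
  exact @Continuous.comp _ _ _ _ (indTopology B _) (indTopology B _) _ _
    (continuous_indTopology l) (continuous_point_eval k a)

theorem pointsMap_id (K B A : Type u) [Field K] [Field B] [Algebra K B] [CommRing A] [HopfAlgebra B A]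
    (R : Type u) [CommRing R] [Algebra K R] (u : Points K B A R) :
    pointsMap (AlgHom.id K R) u = u := by
  apply WithConv.ext
  change (Algebra.TensorProduct.map (AlgHom.id B B) (AlgHom.id K R)).comp u.ofConv = u.ofConv
  rw [Algebra.TensorProduct.map_id, AlgHom.id_comp]

theorem pointsMap_comp (K B A : Type u) [Field K] [Field B] [Algebra K B] [CommRing A]
    [HopfAlgebra B A] {R R' R'' : Type u} [CommRing R] [Algebra K R] [CommRing R'] [Algebra K R']
    [CommRing R''] [Algebra K R''] (f : R →ₐ[K] R') (f' : R' →ₐ[K] R'') (u : Points K B A R) :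
    pointsMap (f'.comp f) u = pointsMap f' (pointsMap f u) := by
  apply WithConv.ext
  change (Algebra.TensorProduct.map ((AlgHom.id B B).comp (AlgHom.id B B)) (f'.comp f)).comp
    u.ofConv = _
  rw [Algebra.TensorProduct.map_comp]
  rfl

end Points


section Graded

/-- The kernel of `U_{n+1}(S) → U_n(S)`. -/
noncomputable def gradedSubgroup (B A : Type u) [Field B] [CommRing A] [HopfAlgebra B A] (n : ℕ)
    (S : Type u) [CommRing S] [Algebra B S] :
    Subgroup (WithConv ((level B A (n + 1)).toSubalgebra →ₐ[B] S)) :=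
  (restrictHom S (level_le_succ n)).ker

/-- The points of `U^{n+1} / U^{n+2}`, the kernel of `U_{n+1} → U_n`, with values in a `B`-algebra `S`. -/
def Graded (B A : Type u) [Field B] [CommRing A] [HopfAlgebra B A] (n : ℕ)
    (S : Type u) [CommRing S] [Algebra B S] : Type u :=
  gradedSubgroup B A n S

variable {G K B A : Type u} [Group G] [Field K] [Field B] [Algebra K B] [MulSemiringAction G B]
  [SMulCommClass G K B] [CommRing A] [HopfAlgebra B A] [MulSemiringAction G A]
  [EquivariantHopf G B A] {R R' : Type u} [CommRing R] [Algebra K R] [CommRing R'] [Algebra K R']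

noncomputable instance gradedCommGroup (n : ℕ) (S : Type u) [CommRing S] [Algebra B S] :
    CommGroup (Graded B A n S) where
  __ := (gradedSubgroup B A n S).toGroup
  mul_comm u v := Subtype.ext (by
    obtain ⟨h, hc⟩ := level_succ_isCentralOver (B := B) (A := A) n
    exact hc S u.1 v.1 v.2)

theorem restrictHom_smul (n : ℕ) (g : G) (u : Points K B (level B A (n + 1)).toSubalgebra R) :
    restrictHom (B ⊗[K] R) (level_le_succ n) (g • u) =
      g • restrictHom (B ⊗[K] R) (level_le_succ n) u := rfl

theorem restrictTopHom_smul (n : ℕ) (g : G) (u : Points K B A R) :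
    restrictTopHom (B ⊗[K] R) (level B A n) (g • u) =
      g • restrictTopHom (B ⊗[K] R) (level B A n) u := rfl

/-- The action of `G` on `(U^{n+1} / U^{n+2})(B ⊗_K R)`, induced from that on `U_{n+1}(B ⊗_K R)`. -/
noncomputable instance gradedSMul (n : ℕ) : SMul G (Graded B A n (B ⊗[K] R)) where
  smul g v := ⟨g • (v.1 : Points K B (level B A (n + 1)).toSubalgebra R), by
    change restrictHom _ _ _ = 1
    have hv : restrictHom (B ⊗[K] R) (level_le_succ n) v.1 = 1 := v.2
    rw [restrictHom_smul, hv, smul_one]⟩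

noncomputable instance gradedAction (n : ℕ) :
    MulDistribMulAction G (Graded B A n (B ⊗[K] R)) where
  one_smul v := Subtype.ext (one_smul G v.1)
  mul_smul g h v := Subtype.ext (mul_smul g h v.1)
  smul_one g := Subtype.ext (smul_one g)
  smul_mul g v w := Subtype.ext (smul_mul' g v.1 w.1)

/-- Functoriality of `(U^{n+1} / U^{n+2})(B ⊗_K R)` in the `K`-algebra `R`. -/
noncomputable def gradedMap (n : ℕ) (f : R →ₐ[K] R') :
    Graded B A n (B ⊗[K] R) →* Graded B A n (B ⊗[K] R') where
  toFun v := ⟨pointsMap f v.1, by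
    change pointsMap f (restrictHom (B ⊗[K] R) (level_le_succ n) v.1) = 1
    have hv : restrictHom (B ⊗[K] R) (level_le_succ n) v.1 = 1 := v.2
    rw [hv, map_one]⟩
  map_one' := Subtype.ext (map_one (pointsMap f))
  map_mul' v w := Subtype.ext (map_mul (pointsMap f) v.1 w.1)

theorem gradedMap_smul (n : ℕ) (f : R →ₐ[K] R') (g : G) (v : Graded B A n (B ⊗[K] R)) :
    gradedMap n f (g • v) = g • gradedMap n f v :=
  Subtype.ext (pointsMap_smul f g v.1)

end Graded

section GradedTopology

/-- The topology of `(U^{n+1} / U^{n+2})(S)`, induced from that of `U_{n+1}(S)`. -/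
noncomputable instance gradedTopology (B A : Type u) [Field B] [TopologicalSpace B] [CommRing A]
    [HopfAlgebra B A] (n : ℕ) (S : Type u) [CommRing S] [Algebra B S] :
    TopologicalSpace (Graded B A n S) :=
  TopologicalSpace.induced Subtype.val pointTopology

variable {K B A : Type u} [Field K] [Field B] [TopologicalSpace B] [Algebra K B]
  [CommRing A] [HopfAlgebra B A] {R R' : Type u} [CommRing R] [Algebra K R] [CommRing R']
  [Algebra K R']

theorem continuous_gradedMap (n : ℕ) (f : R →ₐ[K] R') :
    Continuous (gradedMap (B := B) (A := A) n f) :=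
  continuous_induced_rng.2 ((continuous_pointsMap f).comp continuous_induced_dom)

theorem continuous_restrictHom {S : Type u} [CommRing S] [Algebra B S] {D C : HopfSubalgebra B A}
    (h : D.toSubalgebra ≤ C.toSubalgebra) : Continuous (restrictHom S h) :=
  continuous_point_iff.2 fun k a =>
    continuous_point_eval k fun i => Subalgebra.inclusion h (a i)

theorem continuous_restrictTopHom {S : Type u} [CommRing S] [Algebra B S]
    (C : HopfSubalgebra B A) : Continuous (restrictTopHom S C) :=
  continuous_point_iff.2 fun k a => continuous_point_eval k fun i => (a i : A)

end GradedTopology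

/-- Functoriality of `H^j(G, (U^{n+1} / U^{n+2})(B ⊗_K R))` in the `K`-algebra `R`. -/
noncomputable def hGradedMap (G : Type u) [Group G] [TopologicalSpace G] (n j : ℕ)
    {K B A : Type u} [Field K] [Field B] [TopologicalSpace B]
    [Algebra K B] [MulSemiringAction G B] [SMulCommClass G K B] [CommRing A] [HopfAlgebra B A]
    [MulSemiringAction G A] [EquivariantHopf G B A] {R R' : Type u}
    [CommRing R] [Algebra K R] [CommRing R'] [Algebra K R'] (f : R →ₐ[K] R') :
    HN G (Graded B A n (B ⊗[K] R)) j → HN G (Graded B A n (B ⊗[K] R')) j :=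
  HN.map (G := G) (M := Graded B A n (B ⊗[K] R)) (N := Graded B A n (B ⊗[K] R'))
    (gradedMap n f) (continuous_gradedMap n f) (gradedMap_smul n f) j

section Functors

variable (G K B A : Type u) [Group G] [TopologicalSpace G] [Field K] [Field B] [TopologicalSpace B]
  [Algebra K B] [MulSemiringAction G B] [SMulCommClass G K B] [CommRing A] [HopfAlgebra B A]
  [MulSemiringAction G A] [EquivariantHopf G B A]

/-- The functor `R ↦ H¹(G, U(B ⊗_K R))` on commutative `K`-algebras, where `U = Spec A`. -/
noncomputable def h1Functor : CommAlgCat.{u} K ⥤ Type u where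
  obj R := H1 G (Points K B A R)
  map f := ↾(H1.map (pointsMap f.hom) (continuous_pointsMap _) (pointsMap_smul _))
  map_id R := by
    ext x
    induction x using Quotient.ind with | _ c => ?_
    exact congrArg H1.mk (Cocycle.ext (funext fun g => pointsMap_id K B A R _))
  map_comp f f' := by
    ext x
    induction x using Quotient.ind with | _ c => ?_
    exact congrArg H1.mk (Cocycle.ext (funext fun g => pointsMap_comp K B A f.hom f'.hom _))


/-- The map `H¹(G, U) → H¹(G, U_n)` induced by `U → U_n`. -/
noncomputable def h1Restrict (n : ℕ) :
    h1Functor G K B A ⟶ h1Functor G K B (level B A n).toSubalgebra where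
  app R := ↾(H1.map (restrictTopHom (B ⊗[K] R) (level B A n)) (continuous_restrictTopHom _)
    (restrictTopHom_smul n))
  naturality R R' f := by
    ext x
    induction x using Quotient.ind with | _ c => ?_
    rfl

/-- The map `H¹(G, U_{n+1}) → H¹(G, U_n)` induced by `U_{n+1} → U_n`. -/
noncomputable def h1Step (n : ℕ) :
    h1Functor G K B (level B A (n + 1)).toSubalgebra ⟶ h1Functor G K B (level B A n).toSubalgebra where
  app R := ↾(H1.map (restrictHom (B ⊗[K] R) (level_le_succ n)) (continuous_restrictHom _)
    (restrictHom_smul n))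
  naturality R R' f := by
    ext x
    induction x using Quotient.ind with | _ c => ?_
    rfl

/-- The functor `R ↦ H¹(G, (U^{n+1} / U^{n+2})(B ⊗_K R))`. -/
noncomputable def h1Graded (n : ℕ) : CommAlgCat.{u} K ⥤ Type u where
  obj R := H1 G (Graded B A n (B ⊗[K] R))
  map f := ↾(H1.map (gradedMap n f.hom) (continuous_gradedMap n f.hom) (gradedMap_smul n f.hom))
  map_id R := by
    ext x
    induction x using Quotient.ind with | _ c => ?_
    exact congrArg H1.mk (Cocycle.ext (funext fun g => Subtype.ext (pointsMap_id K B _ R _)))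
  map_comp f f' := by
    ext x
    induction x using Quotient.ind with | _ c => ?_
    exact congrArg H1.mk (Cocycle.ext (funext fun g =>
      Subtype.ext (pointsMap_comp K B _ f.hom f'.hom _)))

/-- The functor `R ↦ H^j(G, (U^{n+1} / U^{n+2})(B ⊗_K R))`. -/
noncomputable def hGraded (j n : ℕ) : CommAlgCat.{u} K ⥤ Type u where
  obj R := HN G (Graded B A n (B ⊗[K] R)) j
  map f := ↾(hGradedMap G n j f.hom)
  map_id R := by
    ext x
    induction x using Quot.ind with | _ c => ?_
    exact congrArg HN.mk (NCocycle.ext (funext fun g => Subtype.ext (pointsMap_id K B _ R _)))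
  map_comp f f' := by
    ext x
    induction x using Quot.ind with | _ c => ?_
    exact congrArg HN.mk (NCocycle.ext (funext fun g =>
      Subtype.ext (pointsMap_comp K B _ f.hom f'.hom _)))

end Functors

section Hypotheses

/-- The socle filtration `0 = F_0 ⊆ F_1 ⊆ …` of the regular representation `A` of `U = Spec A`:
`F_{n+1} / F_n` is the space of `U`-invariants of `A / F_n`, i.e.
`F_{n+1} = {a | Δ(a) - a ⊗ 1 ∈ F_n ⊗ A}`. -/
noncomputable def invariantFiltration (B A : Type u) [Field B] [CommRing A] [HopfAlgebra B A] :
    ℕ → Submodule B A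
  | 0 => ⊥
  | n + 1 =>
    (LinearMap.range ((invariantFiltration B A n).subtype.rTensor A)).comap
      (comul (R := B) - (TensorProduct.mk B A A).flip 1)

/-- `Spec A` is pro-unipotent: its regular representation is a union of finite iterated extensions
of trivial representations (equivalently, every non-zero representation has a non-zero invariant
vector; equivalently, `Spec A` is an inverse limit of unipotent algebraic groups). -/
def IsProUnipotent (B A : Type u) [Field B] [CommRing A] [HopfAlgebra B A] : Prop :=
  ∀ a : A, ∃ n, a ∈ invariantFiltration B A n

/-- The action map `G × A → A` is continuous, `A` with the inductive limit topology. -/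
def HasContinuousAction (G B A : Type u) [Group G] [TopologicalSpace G] [Field B]
    [TopologicalSpace B] [CommRing A] [Algebra B A] [MulSemiringAction G A] : Prop :=
  letI : TopologicalSpace A := indTopology B A
  Continuous fun p : G × A => p.1 • p.2

variable {B A : Type u} [Field B] [CommRing A] [HopfAlgebra B A]

/-- The function `p` on `U_{n+1}` restricts to an additive character of `U^{n+1} / U^{n+2}`, i.e. to a
homomorphism from `U^{n+1} / U^{n+2}` to the additive group. -/
def IsAdditiveCharacter (n : ℕ) (p : (level B A (n + 1)).toSubalgebra) : Prop :=
  ∀ (S : Type u) [CommRing S] [Algebra B S] (v w : Graded B A n S),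
    (v * w).1.ofConv p = v.1.ofConv p + w.1.ofConv p

/-- `w = b • v` in the vector group `V = U^{n+1} / U^{n+2}`. As `B` has characteristic zero, the
commutative unipotent group `V` is in a unique way a vector group, its linear coordinates are its
additive characters, and they separate points. -/
def IsScalarMultiple {n : ℕ} {S : Type u} [CommRing S] [Algebra B S] (b : B)
    (v w : Graded B A n S) : Prop :=
  ∀ p, IsAdditiveCharacter n p → w.1.ofConv p = b • v.1.ofConv p

variable (G K B A : Type u) [Group G] [TopologicalSpace G] [Field K] [Field B] [TopologicalSpace B]
  [Algebra K B] [MulSemiringAction G B] [SMulCommClass G K B] [CommRing A] [HopfAlgebra B A]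
  [MulSemiringAction G A] [EquivariantHopf G B A]

/-- `H^j(G, V(B))` with `V = U^{n+1} / U^{n+2}` is a finite-dimensional vector space over the fixed field
`F` of `G` in `B`: there are finitely many cocycles `z_1, …, z_d` such that each cocycle is, up to a
coboundary, a linear combination `r_1 • z_1 + … + r_d • z_d` with `r_k ∈ F`. Here `B` is written as
`B ⊗_K K`, and the group law of `V` multiplicatively. -/
def FiniteDimensionalCohomology (j n : ℕ) : Prop :=
  ∃ (d : ℕ) (z : Fin d → NCocycle G (Graded B A n (B ⊗[K] K)) j),
    ∀ y : NCocycle G (Graded B A n (B ⊗[K] K)) j,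
      ∃ (r : Fin d → FixedPoints.intermediateField (F := K) (E := B) G)
        (t : Fin d → (Fin j → G) → Graded B A n (B ⊗[K] K))
        (w : (Fin j → G) → Graded B A n (B ⊗[K] K)),
        (∀ k g, IsScalarMultiple (r k : B) ((z k).toFun g) (t k g)) ∧
        IsCoboundary j w ∧ y.toFun = (∏ k, t k) * w

end Hypotheses

section Connecting
variable {G K B A : Type u} [Group G] [TopologicalSpace G] [Field K] [Field B] [TopologicalSpace B]
  [Algebra K B] [MulSemiringAction G B] [SMulCommClass G K B] [CommRing A] [HopfAlgebra B A]
  [MulSemiringAction G A] [EquivariantHopf G B A]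

/-- `l : G → U_{n+1}(B ⊗_K R)` is a continuous cochain that lifts the cocycle `c` with values in
`U_n(B ⊗_K R)`. -/
def IsLift {n : ℕ} {R : Type u} [CommRing R] [Algebra K R]
    (c : Cocycle G (Points K B (level B A n).toSubalgebra R))
    (l : G → Points K B (level B A (n + 1)).toSubalgebra R) : Prop :=
  Continuous l ∧ ∀ g, restrictHom (B ⊗[K] R) (level_le_succ n) (l g) = c.toFun g

/-- `δ` is the connecting map `H¹(G, U_n) → H²(G, U^{n+1} / U^{n+2})` of the central extension
`0 → U^{n+1} / U^{n+2} → U_{n+1} → U_n → 0`: each cocycle `c` has a continuous lift `l`, and for each such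
lift `δ [c]` is the class of the 2-cocycle `dl(g, h) = l(gh) (g l(h))⁻¹ l(g)⁻¹`. -/
def IsConnectingMap (n : ℕ)
    (δ : h1Functor G K B (level B A n).toSubalgebra ⟶ hGraded G K B A 2 n) : Prop :=
  ∀ (R : CommAlgCat.{u} K) (c : Cocycle G (Points K B (level B A n).toSubalgebra R)),
    (∃ l, IsLift c l) ∧
    ∀ l, IsLift c l → ∃ z : NCocycle G (Graded B A n (B ⊗[K] R)) 2,
      (∀ g : Fin 2 → G, (z.toFun g).1 =
        l (g 0 * g 1) * (g 0 • l (g 1))⁻¹ * (l (g 0))⁻¹) ∧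
      (δ.app R (H1.mk c) : HN G (Graded B A n (B ⊗[K] R)) 2) = HN.mk z

/-- The functor `I(G, U_n) = δ⁻¹(0)`, the kernel of the connecting map. -/
noncomputable def connectingKernel {n : ℕ}
    (δ : h1Functor G K B (level B A n).toSubalgebra ⟶ hGraded G K B A 2 n) :
    CommAlgCat.{u} K ⥤ Type u where
  obj R := {x : (h1Functor G K B (level B A n).toSubalgebra).obj R //
    (δ.app R x : HN G (Graded B A n (B ⊗[K] R)) 2) = HN.mk (NCocycle.one 2)}
  map {R R'} f := ↾fun x => ⟨(h1Functor G K B (level B A n).toSubalgebra).map f x.1, by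
    have h := ConcreteCategory.congr_hom (δ.naturality f) x.1
    refine h.trans ?_
    refine (congrArg ((hGraded G K B A 2 n).map f) x.2).trans ?_
    refine congrArg HN.mk (NCocycle.ext (funext fun g => ?_))
    exact map_one (gradedMap n f.hom)⟩
  map_id R := by
    ext x
    exact ConcreteCategory.congr_hom ((h1Functor G K B (level B A n).toSubalgebra).map_id R) x.1
  map_comp f f' := by
    ext x
    exact ConcreteCategory.congr_hom
      ((h1Functor G K B (level B A n).toSubalgebra).map_comp f f') x.1

end Connecting
end UnipCoh

open UnipCoh CategoryTheory.Limits

/-! The proof is an induction along the central extensions `0 → V_n → U_{n+1} → U_n → 0`, where `V_n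
= U^{n+1} / U^{n+2}`, followed by a passage to the limit.

Group schemes. A function `x` in one layer of the socle filtration is primitive modulo the previous
layer: `Δ x - x ⊗ 1 - 1 ⊗ x` is defined over a smaller Hopf subalgebra `E`, and then `Spec E[x]` is
a central extension of `Spec E` (`isCentralOver_adjoinHopf`). Hence the levels exhaust `A`
(`exists_mem_level`). In characteristic zero a new primitive `x` is transcendental over `E`
(`aeval_injective_of_isPrimitiveOver`), and an extension of Hopf subalgebras with finitely generated
top is a finite tower of such steps (`tower_of_finiteType`). Two consequences carry the rest:
`U_{n+1} → U_n` has a section as a morphism of schemes (`exists_isRetraction`), and the commutative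
kernel `V_n` is a vector group (`Tower.exists_isLinearCoords`) on whose coordinates `G` acts
semilinearly by matrices (`exists_matrix`).

Topology. As `G` is compact, a continuous map from `G^j` to a space with the inductive limit
topology takes values in a finite-dimensional subspace (`mem_finCont_iff_continuous`). A continuous
cochain is thus a finite sum `∑ φ_i v_i` with continuous `φ_i : G^j → B`, a condition preserved by
products, inverses, the action and the algebraic section. Expanding in a `K`-basis of `R` shows that
in positive degrees the cohomology of `V_n(B ⊗ R)` is that of `V_n(B)` tensored with `R` over `K`
(`exists_cohomology_basis`); it has finite rank because `F` is finite over `K`. So `H¹(G, V_n)` is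
an affine space, and the vanishing of a class in `H²(G, V_n)` is a closed condition
(`exists_ideal_of_class`).

Non-abelian cohomology. The section gives continuous lifts of cocycles, hence `δ`, whose kernel is
the image of `H¹(G, U_{n+1})` (`connectingApp_eq_one_iff`). The group `H¹(G, V_n)` acts transitively
on the fibres of `H¹(G, U_{n+1}) → H¹(G, U_n)` (`exists_h1Translate_eq`). The action is free,
because the triviality of the invariants of all `V_i` forces that of the invariants of every twist
of `U_n` (`eq_one_of_twisted_fixed`). If `O` represents `H¹(G, U_n)`, then some quotient `O / I`
represents the kernel of `δ`. Its universal class lifts, the lift is a natural section `σ` by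
Yoneda, and `(x, y) ↦ x · σ(y)` is the required isomorphism (`translationIso`).

Limit. The triviality of twisted invariants also makes the element relating two cohomologous
cocycles unique, so such elements are compatible and glue; and cocycles can be lifted from `U_n` to
`U_{n+1}` strictly. So `H¹(G, U)` is the limit of the `H¹(G, U_n)` and is represented by the colimit
of the algebras (`exists_corepresentableBy_colimit`). -/

set_option linter.unusedSectionVars false

namespace UnipCoh

/-! ### Slices of tensors -/

section Slices
variable {B V W : Type*} [Field B] [AddCommGroup V] [Module B V] [AddCommGroup W] [Module B W]

/-- `v ⊗ w ↦ φ(w) v`. -/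
noncomputable def sliceR (φ : Module.Dual B W) : V ⊗[B] W →ₗ[B] V :=
  (TensorProduct.rid B V).toLinearMap ∘ₗ φ.lTensor V

/-- `v ⊗ w ↦ φ(v) w`. -/
noncomputable def sliceL (φ : Module.Dual B V) : V ⊗[B] W →ₗ[B] W :=
  (TensorProduct.lid B W).toLinearMap ∘ₗ φ.rTensor W

@[simp]
theorem sliceR_tmul (φ : Module.Dual B W) (v : V) (w : W) : sliceR φ (v ⊗ₜ[B] w) = φ w • v := by
  simp [sliceR]

@[simp]
theorem sliceL_tmul (φ : Module.Dual B V) (v : V) (w : W) : sliceL φ (v ⊗ₜ[B] w) = φ v • w := by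
  simp [sliceL]

/-- The slices by the coordinate functionals of a basis of `W` are the coefficients of `t` in that
basis. -/
theorem eq_zero_of_sliceR {t : V ⊗[B] W} (h : ∀ φ, sliceR φ t = 0) : t = 0 := by
  classical
  let b := Module.Basis.ofVectorSpace B W
  apply (TensorProduct.equivFinsuppOfBasisRight (M := V) b).injective
  rw [map_zero]
  ext i
  rw [Finsupp.coe_zero, Pi.zero_apply, ← h (b.coord i)]
  clear h
  induction t with
  | zero => simp
  | add x y hx hy => simp only [map_add, Finsupp.coe_add, Pi.add_apply, hx, hy]
  | tmul v w => simp

theorem sliceR_map {V' : Type*} [AddCommGroup V'] [Module B V'] (f : V →ₗ[B] V')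
    (φ : Module.Dual B W) (t : V ⊗[B] W) : sliceR φ (f.rTensor W t) = f (sliceR φ t) := by
  induction t with
  | zero => simp
  | add x y hx hy => simp only [map_add, hx, hy]
  | tmul v w => simp

theorem sliceL_map {W' : Type*} [AddCommGroup W'] [Module B W'] (f : W →ₗ[B] W')
    (φ : Module.Dual B V) (t : V ⊗[B] W) : sliceL φ (f.lTensor V t) = f (sliceL φ t) := by
  induction t with
  | zero => simp
  | add x y hx hy => simp only [map_add, hx, hy]
  | tmul v w => simp

theorem eq_zero_of_sliceL {t : V ⊗[B] W} (h : ∀ φ, sliceL φ t = 0) : t = 0 := by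
  apply (TensorProduct.comm B V W).injective
  rw [map_zero]
  refine eq_zero_of_sliceR fun φ => (Eq.trans ?_ (h φ))
  clear h
  induction t with
  | zero => simp
  | add x y hx hy => simp only [map_add, hx, hy]
  | tmul v w => simp

/-- Over a field `E` is a direct summand; if all slices lie in `E`, a linear projection to `E`
leaves them unchanged and hence leaves `t` unchanged. -/
theorem mem_range_rTensor_iff {E : Submodule B V} {t : V ⊗[B] W} :
    t ∈ LinearMap.range (E.subtype.rTensor W) ↔ ∀ φ, sliceR φ t ∈ E := by
  constructor
  · rintro ⟨t, rfl⟩ φ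
    rw [sliceR_map]
    exact (sliceR φ t).2
  · intro h
    obtain ⟨π, hπ⟩ := E.subtype.exists_leftInverse_of_injective E.ker_subtype
    refine ⟨π.rTensor W t, ?_⟩
    rw [← sub_eq_zero]
    refine eq_zero_of_sliceR fun φ => ?_
    rw [map_sub, sliceR_map, sliceR_map, sub_eq_zero]
    exact congrArg Subtype.val (DFunLike.congr_fun hπ ⟨_, h φ⟩)

/-- This is `(E ⊗ W) ∩ (V ⊗ E') = E ⊗ E'`, obtained by projecting the two factors one after the
other. -/
theorem mem_range_map_of_slices {E : Submodule B V} {E' : Submodule B W} {t : V ⊗[B] W}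
    (h : ∀ φ, sliceR φ t ∈ E) (h' : ∀ φ, sliceL φ t ∈ E') :
    t ∈ LinearMap.range (TensorProduct.map E.subtype E'.subtype) := by
  obtain ⟨s, rfl⟩ := mem_range_rTensor_iff.2 h
  obtain ⟨π, hπ⟩ := E'.subtype.exists_leftInverse_of_injective E'.ker_subtype
  refine ⟨π.lTensor E s, ?_⟩
  rw [← sub_eq_zero]
  refine eq_zero_of_sliceL fun φ => ?_
  rw [map_sub, sub_eq_zero]
  have h1 : TensorProduct.map E.subtype E'.subtype (π.lTensor E s) =
      (E'.subtype ∘ₗ π).lTensor V (E.subtype.rTensor W s) := by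
    generalize s = s
    clear h h'
    induction s with
    | zero => simp
    | add x y hx hy => simp only [map_add, hx, hy]
    | tmul v w => simp
  rw [h1, sliceL_map]
  exact congrArg Subtype.val (DFunLike.congr_fun hπ ⟨_, h' φ⟩)

end Slices

/-! ### The socle filtration -/

section Filtration
variable {B A : Type u} [Field B] [CommRing A] [HopfAlgebra B A]

/-- The action of a functional on the right regular representation, `a ↦ (id ⊗ φ) Δ a`. -/
noncomputable def hitL (φ : Module.Dual B A) : A →ₗ[B] A := sliceR φ ∘ₗ comul

/-- The action of a functional on the left regular representation, `a ↦ (φ ⊗ id) Δ a`. -/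
noncomputable def hitR (φ : Module.Dual B A) : A →ₗ[B] A := sliceL φ ∘ₗ comul

theorem hitL_apply (φ : Module.Dual B A) (a : A) : hitL φ a = sliceR φ (comul (R := B) a) := rfl

theorem hitR_apply (φ : Module.Dual B A) (a : A) : hitR φ a = sliceL φ (comul (R := B) a) := rfl

/-- Coassociativity: the left and the right regular representation commute. -/
theorem hitL_hitR (φ ψ : Module.Dual B A) (a : A) : hitL φ (hitR ψ a) = hitR ψ (hitL φ a) := by
  have h1 : ∀ t : A ⊗[B] A, sliceR φ (comul (R := B) (sliceL ψ t)) =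
      sliceL ψ (sliceR φ ((TensorProduct.assoc B A A A).symm ((comul (R := B)).lTensor A t))) := by
    intro t
    induction t with
    | zero => simp
    | add x y hx hy => simp only [map_add, hx, hy]
    | tmul x y =>
      simp only [sliceL_tmul, map_smul, LinearMap.lTensor_tmul]
      generalize comul (R := B) y = s
      induction s with
      | zero => simp
      | add x y hx hy => simp only [map_add, TensorProduct.tmul_add, smul_add, hx, hy]
      | tmul p q => simp [smul_smul, mul_comm]
  have h2 : ∀ t : A ⊗[B] A, sliceL ψ (comul (R := B) (sliceR φ t)) =
      sliceL ψ (sliceR φ ((comul (R := B)).rTensor A t)) := by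
    intro t
    induction t with
    | zero => simp
    | add x y hx hy => simp only [map_add, hx, hy]
    | tmul x y => simp
  refine (h1 _).trans (Eq.trans ?_ (h2 _).symm)
  rw [coassoc_symm_apply]

theorem hitL_counit (a : A) : hitL (counit (R := B)) a = a := by
  rw [hitL_apply]
  refine (congrArg (TensorProduct.rid B A) (lTensor_counit_comul (R := B) a)).trans ?_
  simp

theorem hitR_counit (a : A) : hitR (counit (R := B)) a = a := by
  rw [hitR_apply]
  refine (congrArg (TensorProduct.lid B A) (rTensor_counit_comul (R := B) a)).trans ?_
  simp

/-- Slicing replaces the tensor condition in the definition by one on elements of `A`: modulo the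
previous layer, every functional `φ` acts through the scalar `φ 1`, as on a trivial representation.
-/
theorem mem_invariantFiltration_succ {n : ℕ} {a : A} :
    a ∈ invariantFiltration B A (n + 1) ↔
      ∀ φ : Module.Dual B A, hitL φ a - φ 1 • a ∈ invariantFiltration B A n := by
  have h : a ∈ invariantFiltration B A (n + 1) ↔ comul (R := B) a - a ⊗ₜ 1 ∈
    LinearMap.range ((invariantFiltration B A n).subtype.rTensor A) := Iff.rfl
  rw [h, mem_range_rTensor_iff]
  simp [hitL_apply]

/-- The invariants of the regular representation are the constants: apply the counit to the left
factor of `Δ a = a ⊗ 1`. -/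
theorem eq_algebraMap_of_hitL {a : A} (h : ∀ φ : Module.Dual B A, hitL φ a - φ 1 • a = 0) :
    a = algebraMap B A (counit (R := B) a) := by
  have h0 : comul (R := B) a - a ⊗ₜ 1 = 0 :=
    eq_zero_of_sliceR fun φ => by simpa [hitL_apply] using h φ
  have := congrArg (sliceL (counit (R := B))) h0
  rw [map_sub, ← hitR_apply, hitR_counit, map_zero, sub_eq_zero] at this
  rw [this]
  simp [Algebra.algebraMap_eq_smul_one]

/-- The filtration is defined by one regular representation but is also the right one for the other:
this holds for constants, and the two representations commute. It puts both tensor factors of the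
reduced comultiplication into the lower layer. -/
theorem hitR_sub_mem {n : ℕ} {a : A} (ha : a ∈ invariantFiltration B A (n + 1))
    (φ : Module.Dual B A) : hitR φ a - φ 1 • a ∈ invariantFiltration B A n := by
  induction n generalizing a with
  | zero =>
    have h := eq_algebraMap_of_hitL (a := a) fun φ => mem_invariantFiltration_succ.1 ha φ
    rw [h, hitR_apply, ← comulAlgHom_apply B, AlgHom.commutes]
    simp [Algebra.TensorProduct.one_def, Algebra.algebraMap_eq_smul_one, smul_smul, mul_comm]
  | succ n ih =>
    rw [mem_invariantFiltration_succ]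
    intro ψ
    have := ih (mem_invariantFiltration_succ.1 ha ψ)
    convert this using 1
    simp only [map_sub, map_smul, hitL_hitR, smul_sub]
    rw [smul_comm]
    abel

theorem invariantFiltration_mono_succ (n : ℕ) :
    invariantFiltration B A n ≤ invariantFiltration B A (n + 1) := by
  induction n with
  | zero => exact bot_le
  | succ n ih =>
    intro a ha
    rw [mem_invariantFiltration_succ] at ha ⊢
    exact fun φ => ih (ha φ)

/-- The reduced comultiplication `a ↦ Δ a - a ⊗ 1 - 1 ⊗ a`. -/
noncomputable def redComul (B : Type u) {A : Type u} [Field B] [CommRing A] [HopfAlgebra B A]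
    (a : A) : A ⊗[B] A :=
  comul (R := B) a - a ⊗ₜ 1 - 1 ⊗ₜ a

theorem comul_eq_redComul (a : A) :
    comul (R := B) a = a ⊗ₜ 1 + 1 ⊗ₜ a + redComul B a := by
  rw [redComul]; abel

/-- The functions `x` whose reduced comultiplication is defined over the Hopf subalgebra `E`. -/
def IsPrimitiveOver (E : HopfSubalgebra B A) (x : A) : Prop :=
  redComul B x ∈ (Algebra.TensorProduct.map E.toSubalgebra.val E.toSubalgebra.val).range

theorem isPrimitiveOver_of_hit {E : HopfSubalgebra B A} {x : A}
    (h : ∀ φ : Module.Dual B A, hitL φ x - φ 1 • x ∈ E.toSubalgebra)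
    (h' : ∀ φ : Module.Dual B A, hitR φ x - φ 1 • x ∈ E.toSubalgebra) : IsPrimitiveOver E x := by
  obtain ⟨t, ht⟩ := mem_range_map_of_slices (E := Subalgebra.toSubmodule E.toSubalgebra)
    (E' := Subalgebra.toSubmodule E.toSubalgebra) (t := redComul B x)
    (fun φ => by
      have : sliceR φ (redComul B x) = (hitL φ x - φ 1 • x) - algebraMap B A (φ x) := by
        simp [redComul, hitL_apply, Algebra.algebraMap_eq_smul_one]
      rw [this]
      exact sub_mem (h φ) (E.toSubalgebra.algebraMap_mem _))
    (fun φ => by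
      have : sliceL φ (redComul B x) = (hitR φ x - φ 1 • x) - algebraMap B A (φ x) := by
        simp only [redComul, hitR_apply, Algebra.algebraMap_eq_smul_one, map_sub, sliceL_tmul]
        abel
      rw [this]
      exact sub_mem (h' φ) (E.toSubalgebra.algebraMap_mem _))
  exact ⟨t, ht⟩

theorem isPrimitiveOver_of_mem_filtration {E : HopfSubalgebra B A} {n : ℕ}
    (hE : ∀ a ∈ invariantFiltration B A n, a ∈ E.toSubalgebra) {x : A}
    (hx : x ∈ invariantFiltration B A (n + 1)) : IsPrimitiveOver E x :=
  isPrimitiveOver_of_hit (fun φ => hE _ (mem_invariantFiltration_succ.1 hx φ))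
    fun φ => hE _ (hitR_sub_mem hx φ)

end Filtration
end UnipCoh

namespace UnipCoh

/-! ### Adjoining primitive elements -/

section Adjoin
variable {B A : Type u} [Field B] [CommRing A] [HopfAlgebra B A]

/-- The Hopf subalgebra generated by a Hopf subalgebra `E` and elements that are primitive over it. -/
noncomputable def adjoinHopf (E : HopfSubalgebra B A) (X : Set A)
    (hX : ∀ x ∈ X, IsPrimitiveOver E x) : HopfSubalgebra B A where
  toSubalgebra := E.toSubalgebra ⊔ Algebra.adjoin B X
  comul_mem := by
    set T : Subalgebra B A := E.toSubalgebra ⊔ Algebra.adjoin B X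
    have hle : E.toSubalgebra ≤ T := le_sup_left
    have hr : ∀ t, Algebra.TensorProduct.map E.toSubalgebra.val E.toSubalgebra.val t ∈
        (Algebra.TensorProduct.map T.val T.val).range := fun t => by
      refine ⟨Algebra.TensorProduct.map (Subalgebra.inclusion hle) (Subalgebra.inclusion hle) t, ?_⟩
      have : (Algebra.TensorProduct.map T.val T.val).comp (Algebra.TensorProduct.map
          (Subalgebra.inclusion hle) (Subalgebra.inclusion hle)) =
          Algebra.TensorProduct.map E.toSubalgebra.val E.toSubalgebra.val := by
        rw [← Algebra.TensorProduct.map_comp]; rfl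
      exact DFunLike.congr_fun this t
    suffices h : T ≤ (Algebra.TensorProduct.map T.val T.val).range.comap (comulAlgHom B A) from
      fun a ha => h ha
    refine sup_le (fun a ha => ?_) (Algebra.adjoin_le fun x hx => ?_)
    · obtain ⟨t, ht⟩ := E.comul_mem a ha
      change comul (R := B) a ∈ (Algebra.TensorProduct.map T.val T.val).range
      rw [← ht]
      exact hr t
    · have hxT : x ∈ T := (le_sup_right : _ ≤ T) (Algebra.subset_adjoin hx)
      change comul (R := B) x ∈ (Algebra.TensorProduct.map T.val T.val).range
      rw [comul_eq_redComul]
      obtain ⟨t, ht⟩ := hX x hx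
      refine add_mem (add_mem ⟨⟨x, hxT⟩ ⊗ₜ 1, rfl⟩ ⟨1 ⊗ₜ ⟨x, hxT⟩, rfl⟩) ?_
      rw [← ht]
      exact hr t
  antipode_mem := by
    set T : Subalgebra B A := E.toSubalgebra ⊔ Algebra.adjoin B X
    have hle : E.toSubalgebra ≤ T := le_sup_left
    suffices h : T ≤ T.comap (antipodeAlgHom B A) from fun a ha => h ha
    refine sup_le (fun a ha => hle (E.antipode_mem a ha)) (Algebra.adjoin_le fun x hx => ?_)
    have hxT : x ∈ T := (le_sup_right : _ ≤ T) (Algebra.subset_adjoin hx)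
    change antipode B x ∈ T
    obtain ⟨t, ht⟩ := hX x hx
    -- The antipode axiom at `x` reads `S(x) + x + m(S ⊗ 1)(t) = ε(x)`, and the third term lies in
    -- `E`.
    have h := mul_antipode_rTensor_comul_apply (R := B) x
    rw [comul_eq_redComul, ← ht] at h
    simp only [map_add, LinearMap.rTensor_tmul, LinearMap.mul'_apply, mul_one, antipode_one,
      one_mul] at h
    rw [add_assoc, ← eq_sub_iff_add_eq] at h
    rw [h]
    refine sub_mem (T.algebraMap_mem _) (add_mem hxT (hle ?_))
    clear ht h
    induction t with
    | zero => simp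
    | add x y hx hy => simp only [map_add]; exact add_mem hx hy
    | tmul p q => exact mul_mem (E.antipode_mem _ p.2) q.2

theorem le_adjoinHopf (E : HopfSubalgebra B A) (X : Set A) (hX : ∀ x ∈ X, IsPrimitiveOver E x) :
    E.toSubalgebra ≤ (adjoinHopf E X hX).toSubalgebra := le_sup_left

theorem mem_adjoinHopf (E : HopfSubalgebra B A) (X : Set A) (hX : ∀ x ∈ X, IsPrimitiveOver E x)
    {x : A} (hx : x ∈ X) : x ∈ (adjoinHopf E X hX).toSubalgebra :=
  (le_sup_right : _ ≤ E.toSubalgebra ⊔ Algebra.adjoin B X) (Algebra.subset_adjoin hx)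

theorem comul_of_isPrimitiveOver {E T : HopfSubalgebra B A} (h : E.toSubalgebra ≤ T.toSubalgebra)
    (x : T.toSubalgebra) {t : E.toSubalgebra ⊗[B] E.toSubalgebra}
    (ht : Algebra.TensorProduct.map E.toSubalgebra.val E.toSubalgebra.val t = redComul B (x : A)) :
    comul (R := B) x = x ⊗ₜ 1 + 1 ⊗ₜ x +
      Algebra.TensorProduct.map (Subalgebra.inclusion h) (Subalgebra.inclusion h) t := by
  apply HopfSubalgebra.tensor_injective T.toSubalgebra
  refine (T.map_comulHom x).trans ?_
  rw [comul_eq_redComul, ← ht, map_add, map_add]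
  congr 1
  have : (Algebra.TensorProduct.map T.toSubalgebra.val T.toSubalgebra.val).comp
      (Algebra.TensorProduct.map (Subalgebra.inclusion h) (Subalgebra.inclusion h)) =
      Algebra.TensorProduct.map E.toSubalgebra.val E.toSubalgebra.val := by
    rw [← Algebra.TensorProduct.map_comp]; rfl
  exact (DFunLike.congr_fun this t).symm

/-- The group law in the coordinate `x` is addition plus a term that sees only the images of the two
points in `Spec E`. Centrality and the group law of the kernel are both read off from this formula.
-/
theorem mul_apply_of_isPrimitiveOver {E T : HopfSubalgebra B A}
    (h : E.toSubalgebra ≤ T.toSubalgebra) (x : T.toSubalgebra)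
    {t : E.toSubalgebra ⊗[B] E.toSubalgebra}
    (ht : Algebra.TensorProduct.map E.toSubalgebra.val E.toSubalgebra.val t = redComul B (x : A))
    {S : Type u} [CommRing S] [Algebra B S] (u v : WithConv (T.toSubalgebra →ₐ[B] S)) :
    (u * v).ofConv x = u.ofConv x + v.ofConv x +
      Algebra.TensorProduct.productMap (restrictHom S h u).ofConv (restrictHom S h v).ofConv t := by
  refine (AlgHom.convMul_apply u v x).trans ?_
  change Algebra.TensorProduct.productMap u.ofConv v.ofConv _ = _
  rw [comul_of_isPrimitiveOver h x ht]
  have : ∀ t, Algebra.TensorProduct.productMap u.ofConv v.ofConv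
      (Algebra.TensorProduct.map (Subalgebra.inclusion h) (Subalgebra.inclusion h) t) =
      Algebra.TensorProduct.productMap (restrictHom S h u).ofConv (restrictHom S h v).ofConv t := by
    intro t
    induction t with
    | zero => simp
    | add x y hx hy => simp only [map_add, hx, hy]
    | tmul p q => rfl
  rw [← this]
  generalize Algebra.TensorProduct.map (Subalgebra.inclusion h) (Subalgebra.inclusion h) t = s
  simp only [map_add, Algebra.TensorProduct.productMap_apply_tmul, map_one, mul_one, one_mul]

theorem isCentralOver_adjoinHopf (E : HopfSubalgebra B A) (X : Set A)
    (hX : ∀ x ∈ X, IsPrimitiveOver E x) : IsCentralOver (adjoinHopf E X hX) E := by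
  refine ⟨le_adjoinHopf E X hX, fun S _ _ u v hv => ?_⟩
  have hE : restrictHom S (le_adjoinHopf E X hX) (u * v) =
      restrictHom S (le_adjoinHopf E X hX) (v * u) := by
    rw [map_mul, map_mul, hv, one_mul, mul_one]
  let Q : Subalgebra B (adjoinHopf E X hX).toSubalgebra := AlgHom.equalizer (u * v).ofConv (v * u).ofConv
  have hle : (adjoinHopf E X hX).toSubalgebra ≤ Q.map (adjoinHopf E X hX).toSubalgebra.val := by
    refine sup_le (fun a ha => ?_) (Algebra.adjoin_le fun x hx => ?_)
    · exact ⟨⟨a, le_adjoinHopf E X hX ha⟩, (AlgHom.mem_equalizer _ _ _).2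
        (DFunLike.congr_fun (congrArg WithConv.ofConv hE) (⟨a, ha⟩ : E.toSubalgebra)), rfl⟩
    · refine ⟨⟨x, mem_adjoinHopf E X hX hx⟩, (AlgHom.mem_equalizer _ _ _).2 ?_, rfl⟩
      obtain ⟨t, ht⟩ := hX x hx
      have key := fun a b : WithConv ((adjoinHopf E X hX).toSubalgebra →ₐ[B] S) =>
        mul_apply_of_isPrimitiveOver (le_adjoinHopf E X hX) ⟨x, mem_adjoinHopf E X hX hx⟩ ht a b
      -- As `v` and `1` agree on `E`, the correction terms of `u v` and `v u` are those of `u · 1`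
      -- and `1 · u`, and both are determined by `u · 1 = u = 1 · u`.
      have h1 := key u 1
      have h2 := key 1 u
      rw [mul_one, map_one] at h1
      rw [one_mul, map_one] at h2
      rw [key u v, key v u, hv]
      linear_combination h2 - h1
  apply WithConv.ext
  ext a
  obtain ⟨a', ha', hh⟩ := hle a.2
  have : a' = a := Subtype.ext hh
  exact this ▸ ha'

theorem le_level_succ_of_isCentralOver {C : HopfSubalgebra B A} {n : ℕ}
    (hC : IsCentralOver C (level B A n)) : C.toSubalgebra ≤ (level B A (n + 1)).toSubalgebra :=
  le_iSup₂_of_le (f := fun (C : HopfSubalgebra B A)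
    (_ : C ∈ {C | IsCentralOver C (level B A n)}) => C.toSubalgebra) C hC le_rfl

/-- The first layer consists of the constants, which form level `0`; this is the shift by one. Each
further layer is primitive over the level reached so far and generates a central extension of it, so
it lies in the next level. -/
theorem invariantFiltration_le_level (n : ℕ) :
    ∀ a ∈ invariantFiltration B A (n + 1), a ∈ (level B A n).toSubalgebra := by
  induction n with
  | zero =>
    intro a ha
    rw [eq_algebraMap_of_hitL fun φ => mem_invariantFiltration_succ.1 ha φ]
    exact Subalgebra.algebraMap_mem _ _
  | succ n ih =>
    intro a ha
    have hX : ∀ x ∈ (invariantFiltration B A (n + 1 + 1) : Set A),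
        IsPrimitiveOver (level B A n) x := fun x hx => isPrimitiveOver_of_mem_filtration ih hx
    exact le_level_succ_of_isCentralOver (isCentralOver_adjoinHopf _ _ hX) (mem_adjoinHopf _ _ hX ha)

theorem exists_mem_level (hunip : IsProUnipotent B A) (a : A) :
    ∃ n, a ∈ (level B A n).toSubalgebra := by
  obtain ⟨n, hn⟩ := hunip a
  exact ⟨n, invariantFiltration_le_level n a (invariantFiltration_mono_succ n hn)⟩

end Adjoin

/-! ### Primitive elements are transcendental -/

section Transcendence
open Polynomial
variable {B A : Type u} [Field B] [CommRing A] [HopfAlgebra B A]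

/-- The right coaction of `A` on a Hopf subalgebra. -/
noncomputable def coactHom (E : HopfSubalgebra B A) :
    E.toSubalgebra →ₐ[B] E.toSubalgebra ⊗[B] A :=
  (Algebra.TensorProduct.map (AlgHom.id B _) E.toSubalgebra.val).comp
    (comulAlgHom B E.toSubalgebra)

theorem map_coactHom (E : HopfSubalgebra B A) (a : E.toSubalgebra) :
    Algebra.TensorProduct.map E.toSubalgebra.val (AlgHom.id B A) (coactHom E a) =
      comul (R := B) (a : A) := by
  rw [← E.map_comulHom]
  have : (Algebra.TensorProduct.map E.toSubalgebra.val (AlgHom.id B A)).comp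
      (Algebra.TensorProduct.map (AlgHom.id B _) E.toSubalgebra.val) =
      Algebra.TensorProduct.map E.toSubalgebra.val E.toSubalgebra.val := by
    rw [← Algebra.TensorProduct.map_comp]; rfl
  exact DFunLike.congr_fun this _

theorem coe_sliceR_coactHom (E : HopfSubalgebra B A) (a : E.toSubalgebra) (φ : Module.Dual B A) :
    ((sliceR φ (coactHom E a) : E.toSubalgebra) : A) = hitL φ (a : A) := by
  rw [hitL_apply, ← map_coactHom]
  exact (sliceR_map E.toSubalgebra.val.toLinearMap φ _).symm

/-- Slicing an algebraic relation of a primitive element. -/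
theorem exists_slice_relation {E : HopfSubalgebra B A} {x : A}
    {c : E.toSubalgebra ⊗[B] A}
    (hc : comul (R := B) x = x ⊗ₜ 1 +
      Algebra.TensorProduct.map E.toSubalgebra.val (AlgHom.id B A) c)
    {P : E.toSubalgebra[X]} (hP : aeval x P = 0) {d : ℕ} (hd : P.natDegree ≤ d)
    (φ : Module.Dual B A) :
    ∃ Q : E.toSubalgebra[X], aeval x Q = 0 ∧ Q.natDegree ≤ d ∧
      Q.coeff d = sliceR φ (coactHom E (P.coeff d)) ∧
      ∀ e, d = e + 1 → Q.coeff e =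
        sliceR φ (coactHom E (P.coeff e) + (d : E.toSubalgebra ⊗[B] A) *
          coactHom E (P.coeff d) * c) := by
  set j := Algebra.TensorProduct.map E.toSubalgebra.val (AlgHom.id B A) with hj
  -- Applying `Δ` to `P(x) = 0` and substituting `Δ x = x ⊗ 1 + c` turns the relation for `x` into
  -- one for `x ⊗ 1`, with coefficients in `E ⊗ A`.
  set P' := taylor c (P.map (coactHom E).toRingHom) with hP'
  have hP'd : P'.natDegree ≤ d := by
    rw [hP', natDegree_taylor]
    exact natDegree_map_le.trans hd
  have h0 : P'.eval₂ j.toRingHom (x ⊗ₜ 1) = 0 := by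
    have h1 : P'.eval₂ j.toRingHom (x ⊗ₜ 1) =
        P.eval₂ (j.comp (coactHom E)).toRingHom (comul (R := B) x) := by
      rw [hP', taylor_apply, eval₂_comp, eval₂_map, hc]
      simp
      rfl
    have h2 : (j.comp (coactHom E)).toRingHom =
        (comulAlgHom B A).toRingHom.comp (algebraMap E.toSubalgebra A) :=
      RingHom.ext fun a => map_coactHom E a
    rw [h1, h2, ← comulAlgHom_apply B]
    have := hom_eval₂ P (algebraMap E.toSubalgebra A) (comulAlgHom B A).toRingHom x
    refine this.symm.trans ?_
    rw [← aeval_def, hP, map_zero]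
  -- Slicing the right factor brings the coefficients back to `E`. The Taylor shift keeps the
  -- coefficient in degree `d` and adds `d` times it times `c` to the one in degree `d - 1`; only
  -- these two are needed.
  refine ⟨∑ i ∈ Finset.range (d + 1), C (sliceR φ (P'.coeff i)) * X ^ i, ?_, ?_, ?_, ?_⟩
  · rw [eval₂_eq_sum_range' _ (Nat.lt_succ_of_le hP'd)] at h0
    have := congrArg (sliceR φ) h0
    rw [map_zero, map_sum] at this
    rw [map_sum, ← this]
    refine Finset.sum_congr rfl fun i _ => ?_
    rw [map_mul, map_pow, aeval_X, aeval_C, Algebra.TensorProduct.tmul_pow, one_pow]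
    generalize P'.coeff i = t
    induction t with
    | zero => simp
    | add p q hp hq => simp only [map_add, add_mul, hp, hq]
    | tmul p q =>
      have : (j.toRingHom (p ⊗ₜ q) : A ⊗[B] A) = (p : A) ⊗ₜ q := rfl
      rw [this, Algebra.TensorProduct.tmul_mul_tmul, mul_one, sliceR_tmul, sliceR_tmul]
      exact smul_mul_assoc (φ q) (p : A) (x ^ i)
  · refine natDegree_sum_le_of_forall_le _ _ fun i hi => ?_
    exact (natDegree_C_mul_X_pow_le _ _).trans (Nat.lt_succ_iff.1 (Finset.mem_range.1 hi))
  · rw [finsetSum_coeff]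
    simp only [coeff_C_mul_X_pow]
    rw [Finset.sum_eq_single d (fun b _ hb => if_neg hb.symm)
      (fun h => absurd (Finset.mem_range.2 (by omega)) h)]
    rw [if_pos rfl, hP', taylor_coeff]
    congr 1
    rw [eval_eq_sum_range' (n := 1)]
    · simp [hasseDeriv_coeff]
    · refine Nat.lt_succ_of_le ((natDegree_hasseDeriv_le _ _).trans ?_)
      have := (natDegree_map_le (p := P) (f := (coactHom E).toRingHom)).trans hd
      omega
  · rintro e rfl
    rw [finsetSum_coeff]
    simp only [coeff_C_mul_X_pow]
    rw [Finset.sum_eq_single e (fun b _ hb => if_neg hb.symm)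
      (fun h => absurd (Finset.mem_range.2 (by omega)) h)]
    rw [if_pos rfl, hP', taylor_coeff]
    congr 1
    rw [eval_eq_sum_range' (n := 2)]
    · simp [Finset.sum_range_succ, hasseDeriv_coeff, add_comm 1 e]
    · refine Nat.lt_succ_of_le ((natDegree_hasseDeriv_le _ _).trans ?_)
      have := (natDegree_map_le (p := P) (f := (coactHom E).toRingHom)).trans hd
      omega

/-- Take a relation of minimal degree `d`. Slicing it and subtracting `φ 1` times the relation
pushes its leading coefficient down the socle filtration, so this coefficient may be assumed to be
`1`. For a monic relation the same difference has smaller degree and is zero by minimality. Its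
coefficient in degree `d - 1` then gives `d x ∈ E`, which contradicts `x ∉ E` in characteristic
zero. -/
theorem aeval_injective_of_isPrimitiveOver [CharZero B] (hunip : IsProUnipotent B A)
    {E : HopfSubalgebra B A} {x : A} (hx : IsPrimitiveOver E x) (hxE : x ∉ E.toSubalgebra) :
    Function.Injective (aeval x : E.toSubalgebra[X] →ₐ[E.toSubalgebra] A) := by
  classical
  obtain ⟨t, ht⟩ := hx
  set j := Algebra.TensorProduct.map E.toSubalgebra.val (AlgHom.id B A) with hj
  set y : E.toSubalgebra ⊗[B] A :=
    Algebra.TensorProduct.map (AlgHom.id B _) E.toSubalgebra.val t with hy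
  have hjy : j y = redComul B x := by
    rw [← ht]
    have : j.comp (Algebra.TensorProduct.map (AlgHom.id B _) E.toSubalgebra.val) =
        Algebra.TensorProduct.map E.toSubalgebra.val E.toSubalgebra.val := by
      rw [hj, ← Algebra.TensorProduct.map_comp]; rfl
    exact DFunLike.congr_fun this _
  have hc : comul (R := B) x = x ⊗ₜ 1 + j (1 ⊗ₜ x + y) := by
    rw [map_add, hjy, comul_eq_redComul, add_assoc]
    rfl
  rw [injective_iff_map_eq_zero]
  by_contra! hne
  obtain ⟨P₀, hP₀, hP₀'⟩ := hne
  -- a relation of minimal degree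
  have hex : ∃ d, ∃ P : E.toSubalgebra[X], aeval x P = 0 ∧ P ≠ 0 ∧ P.natDegree = d :=
    ⟨_, P₀, hP₀, hP₀', rfl⟩
  set d := Nat.find hex with hd
  obtain ⟨P₁, hP₁, hP₁', hP₁d⟩ := Nat.find_spec hex
  have hmin : ∀ Q : E.toSubalgebra[X], aeval x Q = 0 → Q.natDegree < d → Q = 0 := by
    intro Q hQ hlt
    by_contra hQ'
    exact Nat.find_min hex hlt ⟨Q, hQ, hQ', rfl⟩
  -- its leading coefficient may be taken to be constant
  have hlead : ∀ m (Q : E.toSubalgebra[X]), aeval x Q = 0 → Q.natDegree ≤ d → Q.coeff d ≠ 0 →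
      (Q.coeff d : A) ∈ invariantFiltration B A m →
      ∃ P : E.toSubalgebra[X], aeval x P = 0 ∧ P.natDegree ≤ d ∧ P.coeff d = 1 := by
    intro m
    induction m with
    | zero =>
      intro Q _ _ h h'
      exact absurd (Subtype.ext ((Submodule.mem_bot B).1 h')) h
    | succ m ih =>
      intro Q hQ hQd h h'
      by_cases hφ : ∀ φ : Module.Dual B A, hitL φ (Q.coeff d : A) - φ 1 • (Q.coeff d : A) = 0
      · have hb := eq_algebraMap_of_hitL hφ
        set b := counit (R := B) (Q.coeff d : A)
        have hb0 : b ≠ 0 := by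
          intro hb0
          rw [hb0, map_zero] at hb
          exact h (Subtype.ext hb)
        refine ⟨b⁻¹ • Q, ?_, (natDegree_smul_le _ _).trans hQd, ?_⟩
        · rw [← IsScalarTower.algebraMap_smul E.toSubalgebra, map_smul, hQ, smul_zero]
        · rw [coeff_smul]
          apply Subtype.ext
          change b⁻¹ • (Q.coeff d : A) = 1
          rw [hb, Algebra.algebraMap_eq_smul_one, smul_smul, inv_mul_cancel₀ hb0, one_smul]
      · push Not at hφ
        obtain ⟨φ, hφ⟩ := hφ
        obtain ⟨Q', hQ', hQd', hl, _⟩ := exists_slice_relation hc hQ hQd φ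
        have hcoef : ((Q' - φ 1 • Q).coeff d : A) =
            hitL φ (Q.coeff d : A) - φ 1 • (Q.coeff d : A) := by
          rw [coeff_sub, coeff_smul, hl]
          exact congrArg (· - _) (coe_sliceR_coactHom E _ φ)
        refine ih (Q' - φ 1 • Q) ?_ ?_ ?_ ?_
        · rw [map_sub, hQ', ← IsScalarTower.algebraMap_smul E.toSubalgebra, map_smul, hQ, smul_zero,
            sub_zero]
        · exact (natDegree_sub_le _ _).trans (max_le hQd' ((natDegree_smul_le _ _).trans hQd))
        · intro h0
          rw [h0] at hcoef
          exact hφ hcoef.symm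
        · rw [hcoef]
          exact mem_invariantFiltration_succ.1 h' φ
  obtain ⟨m, hm⟩ := hunip (P₁.coeff d : A)
  obtain ⟨P, hP, hPd, hP1⟩ := hlead m P₁ hP₁ hP₁d.le
    (by have h : P₁.natDegree = d := hP₁d
        rw [← h]; exact leadingCoeff_ne_zero.2 hP₁') hm
  rcases Nat.eq_zero_or_eq_succ_pred d with h0 | hsucc
  · rw [h0] at hPd hP1
    rw [eq_C_of_natDegree_le_zero hPd, hP1, aeval_C, map_one] at hP
    refine hxE ?_
    have : x = 0 := by rw [← mul_one x, hP, mul_zero]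
    rw [this]
    exact zero_mem _
  · set e := d.pred
    -- the next coefficient shows `x ∈ E`
    have hkey : coactHom E (P.coeff e) + (d : E.toSubalgebra ⊗[B] A) * (1 ⊗ₜ x + y) -
        P.coeff e ⊗ₜ 1 = 0 := by
      refine eq_zero_of_sliceR fun φ => ?_
      obtain ⟨Q, hQ, hQd, hl, hl'⟩ := exists_slice_relation hc hP hPd φ
      have hz : Q - φ 1 • P = 0 := by
        refine hmin _ ?_ ?_
        · rw [map_sub, hQ, ← IsScalarTower.algebraMap_smul E.toSubalgebra, map_smul, hP, smul_zero,
            sub_zero]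
        · have hle : (Q - φ 1 • P).natDegree ≤ d :=
            (natDegree_sub_le _ _).trans (max_le hQd ((natDegree_smul_le _ _).trans hPd))
          refine lt_of_le_of_ne hle fun heq => ?_
          have h1 : (Q - φ 1 • P).coeff d = 0 := by
            rw [coeff_sub, coeff_smul, hl, hP1, map_one, Algebra.TensorProduct.one_def, sliceR_tmul,
              sub_self]
          rw [← heq] at h1
          rw [← leadingCoeff, leadingCoeff_eq_zero] at h1
          rw [h1, natDegree_zero] at heq
          omega
      have := congrArg (fun R : E.toSubalgebra[X] => R.coeff e) hz
      simp only [coeff_sub, coeff_smul, coeff_zero, hl' e hsucc, hP1, map_one, mul_one] at this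
      rw [map_sub, sliceR_tmul]
      exact this
    -- The counit on the left factor turns `hkey` into `P_e + d (x - ε(x)) = ε(P_e)`, where `P_e` is
    -- the coefficient of `P` in degree `e = d - 1`.
    have := congrArg (fun s => sliceL (counit (R := B)) (j s)) hkey
    simp only [map_sub, map_add, map_mul, map_natCast, map_zero] at this
    rw [map_coactHom, ← hitR_apply, hitR_counit] at this
    have h1 : sliceL (counit (R := B)) (j (P.coeff e ⊗ₜ 1)) =
        algebraMap B A (counit (R := B) (P.coeff e : A)) := by
      rw [Algebra.algebraMap_eq_smul_one]
      exact sliceL_tmul _ _ _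
    have h2 : sliceL (counit (R := B)) ((d : A ⊗[B] A) * (j (1 ⊗ₜ x) + j y)) =
        (d : B) • (x + sliceL (counit (R := B)) (redComul B x)) := by
      rw [← nsmul_eq_mul, map_nsmul, hjy, map_add, Nat.cast_smul_eq_nsmul]
      congr 2
      refine (sliceL_tmul (counit (R := B)) (1 : A) x).trans ?_
      rw [counit_one, one_smul]
    have h3 : sliceL (counit (R := B)) (redComul B x) = - algebraMap B A (counit (R := B) x) := by
      rw [redComul, map_sub, map_sub, ← hitR_apply, hitR_counit, sliceL_tmul, sliceL_tmul]
      simp [Algebra.algebraMap_eq_smul_one]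
    rw [h1, h2, h3] at this
    refine hxE ?_
    have hd0 : (d : B) ≠ 0 := by
      rw [hsucc]
      exact Nat.cast_ne_zero.2 (Nat.succ_ne_zero _)
    have hx' : (d : B) • x = (d : B) • algebraMap B A (counit (R := B) x) +
        algebraMap B A (counit (R := B) (P.coeff e : A)) - (P.coeff e : A) := by
      rw [smul_add, smul_neg] at this
      linear_combination this
    have hmem : (d : B) • x ∈ E.toSubalgebra := by
      rw [hx']
      exact sub_mem (add_mem (Subalgebra.smul_mem _ (Subalgebra.algebraMap_mem _ _) _)
        (Subalgebra.algebraMap_mem _ _)) (P.coeff e).2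
    have := Subalgebra.smul_mem _ hmem (d : B)⁻¹
    rwa [smul_smul, inv_mul_cancel₀ hd0, one_smul] at this

end Transcendence
end UnipCoh

namespace UnipCoh

/-! ### Towers of primitive extensions -/

section Tower
open Polynomial
variable {B A : Type u} [Field B] [CommRing A] [HopfAlgebra B A]

theorem HopfSubalgebra.ext_toSubalgebra {C D : HopfSubalgebra B A}
    (h : C.toSubalgebra = D.toSubalgebra) : C = D := by
  cases C; cases D; cases h; rfl

/-- The Hopf subalgebra `E[x]`, `x` primitive over `E`. -/
noncomputable abbrev adjoinOne (E : HopfSubalgebra B A) (x : A) (hx : IsPrimitiveOver E x) :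
    HopfSubalgebra B A :=
  adjoinHopf E {x} fun _ hy => by rwa [Set.mem_singleton_iff.1 hy]

theorem le_adjoinOne (E : HopfSubalgebra B A) (x : A) (hx : IsPrimitiveOver E x) :
    E.toSubalgebra ≤ (adjoinOne E x hx).toSubalgebra := le_adjoinHopf _ _ _

theorem mem_adjoinOne (E : HopfSubalgebra B A) (x : A) (hx : IsPrimitiveOver E x) :
    x ∈ (adjoinOne E x hx).toSubalgebra := mem_adjoinHopf _ _ _ rfl

/-- `Tower D E`: the Hopf subalgebra `E` is obtained from `D` by adjoining finitely many elements,
each one primitive over the preceding ones. -/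
inductive Tower (D : HopfSubalgebra B A) : HopfSubalgebra B A → Prop
  | refl : Tower D D
  | step (E : HopfSubalgebra B A) (x : A) (hx : IsPrimitiveOver E x) (hxE : x ∉ E.toSubalgebra) :
      Tower D E → Tower D (adjoinOne E x hx)

theorem Tower.le {D E : HopfSubalgebra B A} (h : Tower D E) : D.toSubalgebra ≤ E.toSubalgebra := by
  induction h with
  | refl => exact le_rfl
  | step E x hx _ _ ih => exact ih.trans (le_adjoinOne E x hx)

theorem hitL_hitL (φ ψ : Module.Dual B A) (a : A) : hitL ψ (hitL φ a) = hitL (ψ ∘ₗ hitL φ) a := by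
  have h1 : ∀ t : A ⊗[B] A, sliceR ψ (comul (R := B) (sliceR φ t)) =
      sliceR ψ (sliceR φ ((comul (R := B)).rTensor A t)) := by
    intro t
    induction t with
    | zero => simp
    | add x y hx hy => simp only [map_add, hx, hy]
    | tmul x y => simp
  have h2 : ∀ t : A ⊗[B] A, sliceR (ψ ∘ₗ hitL φ) t =
      sliceR ψ (sliceR φ ((TensorProduct.assoc B A A A).symm ((comul (R := B)).lTensor A t))) := by
    intro t
    induction t with
    | zero => simp
    | add x y hx hy => simp only [map_add, hx, hy]
    | tmul x y =>
      simp only [sliceR_tmul, LinearMap.lTensor_tmul, LinearMap.comp_apply, hitL_apply]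
      generalize comul (R := B) y = s
      induction s with
      | zero => simp
      | add x y hx hy => simp only [map_add, TensorProduct.tmul_add, add_smul, hx, hy]
      | tmul p q => simp [smul_smul]
  refine (h1 _).trans (Eq.trans ?_ (h2 _).symm)
  rw [coassoc_symm_apply]

theorem hitR_hitR (φ ψ : Module.Dual B A) (a : A) : hitR ψ (hitR φ a) = hitR (ψ ∘ₗ hitR φ) a := by
  have h1 : ∀ t : A ⊗[B] A, sliceL ψ (comul (R := B) (sliceL φ t)) =
      sliceL ψ (sliceL φ ((comul (R := B)).lTensor A t)) := by
    intro t
    induction t with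
    | zero => simp
    | add x y hx hy => simp only [map_add, hx, hy]
    | tmul x y => simp
  have h2 : ∀ t : A ⊗[B] A, sliceL (ψ ∘ₗ hitR φ) t =
      sliceL ψ (sliceL φ (TensorProduct.assoc B A A A ((comul (R := B)).rTensor A t))) := by
    intro t
    induction t with
    | zero => simp
    | add x y hx hy => simp only [map_add, hx, hy]
    | tmul x y =>
      simp only [sliceL_tmul, LinearMap.rTensor_tmul, LinearMap.comp_apply, hitR_apply]
      generalize comul (R := B) x = s
      induction s with
      | zero => simp
      | add x y hx hy => simp only [map_add, TensorProduct.add_tmul, add_smul, hx, hy]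
      | tmul p q => simp [smul_smul]
  refine (h1 _).trans (Eq.trans ?_ (h2 _).symm)
  rw [coassoc_apply]

/-- Local finiteness of comodules: all slices of `Δ a` lie in the span of the first factors of one
expression of `Δ a` as a finite sum. -/
theorem exists_finite_hitL (a : A) :
    ∃ T : Set A, T.Finite ∧ ∀ φ : Module.Dual B A, hitL φ a ∈ Submodule.span B T := by
  obtain ⟨s, hs⟩ := TensorProduct.exists_finset (comul (R := B) a)
  refine ⟨Prod.fst '' (s : Set (A × A)), s.finite_toSet.image _, fun φ => ?_⟩
  rw [hitL_apply, hs, map_sum]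
  refine Submodule.sum_mem _ fun p hp => ?_
  rw [sliceR_tmul]
  exact Submodule.smul_mem _ _ (Submodule.subset_span ⟨p, hp, rfl⟩)

theorem exists_finite_hitR (a : A) :
    ∃ T : Set A, T.Finite ∧ ∀ φ : Module.Dual B A, hitR φ a ∈ Submodule.span B T := by
  obtain ⟨s, hs⟩ := TensorProduct.exists_finset (comul (R := B) a)
  refine ⟨Prod.snd '' (s : Set (A × A)), s.finite_toSet.image _, fun φ => ?_⟩
  rw [hitR_apply, hs, map_sum]
  refine Submodule.sum_mem _ fun p hp => ?_
  rw [sliceL_tmul]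
  exact Submodule.smul_mem _ _ (Submodule.subset_span ⟨p, hp, rfl⟩)

theorem hitL_mem (C : HopfSubalgebra B A) {a : A} (ha : a ∈ C.toSubalgebra)
    (φ : Module.Dual B A) : hitL φ a ∈ C.toSubalgebra := by
  obtain ⟨t, ht⟩ := C.comul_mem a ha
  rw [hitL_apply, ← ht]
  clear ht
  induction t with
  | zero => simp
  | add x y hx hy => simp only [map_add]; exact add_mem hx hy
  | tmul p q => exact Subalgebra.smul_mem _ p.2 _

theorem hitR_mem (C : HopfSubalgebra B A) {a : A} (ha : a ∈ C.toSubalgebra)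
    (φ : Module.Dual B A) : hitR φ a ∈ C.toSubalgebra := by
  obtain ⟨t, ht⟩ := C.comul_mem a ha
  rw [hitR_apply, ← ht]
  clear ht
  induction t with
  | zero => simp
  | add x y hx hy => simp only [map_add]; exact add_mem hx hy
  | tmul p q => exact Subalgebra.smul_mem _ q.2 _

/-- A finite set of functions is contained in a finite-dimensional subspace that is stable under the
left and the right regular representation. -/
theorem exists_finite_bistable (C : HopfSubalgebra B A) {s : Set A} (hs : s.Finite)
    (hsC : ∀ a ∈ s, a ∈ C.toSubalgebra) :
    ∃ W : Submodule B A, FiniteDimensional B W ∧ s ⊆ W ∧ (∀ w ∈ W, w ∈ C.toSubalgebra) ∧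
      ∀ w ∈ W, ∀ φ : Module.Dual B A, hitL φ w ∈ W ∧ hitR φ w ∈ W := by
  choose TL hTL hTL' using exists_finite_hitL (B := B) (A := A)
  choose TR hTR hTR' using exists_finite_hitR (B := B) (A := A)
  -- All two-sided translates of `s`. Local finiteness on each side bounds their span, and it is
  -- stable because translates compose and the two sides commute.
  let X : Set A := {w | ∃ a ∈ s, ∃ φ ψ : Module.Dual B A, w = hitL φ (hitR ψ a)}
  refine ⟨Submodule.span B X, ?_, ?_, ?_, ?_⟩
  · have hfin : (⋃ a ∈ s, ⋃ b ∈ TR a, TL b).Finite :=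
      hs.biUnion fun a _ => (hTR a).biUnion fun b _ => hTL b
    have := FiniteDimensional.span_of_finite B hfin
    refine Submodule.finiteDimensional_of_le (Submodule.span_le.2 ?_ : _ ≤
      Submodule.span B (⋃ a ∈ s, ⋃ b ∈ TR a, TL b))
    rintro _ ⟨a, ha, φ, ψ, rfl⟩
    have h1 : hitL φ (hitR ψ a) ∈ (Submodule.span B (TR a)).map (hitL φ) :=
      Submodule.mem_map_of_mem (hTR' a ψ)
    rw [Submodule.map_span] at h1
    refine Submodule.span_le.2 ?_ h1
    rintro _ ⟨b, hb, rfl⟩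
    refine Submodule.span_mono ?_ (hTL' b φ)
    exact fun c hc => Set.mem_biUnion ha (Set.mem_biUnion hb hc)
  · intro a ha
    exact Submodule.subset_span ⟨a, ha, counit (R := B), counit (R := B), by
      rw [hitR_counit, hitL_counit]⟩
  · intro w hw
    refine (Submodule.span_le (p := Subalgebra.toSubmodule C.toSubalgebra)).2 ?_ hw
    rintro _ ⟨a, ha, φ, ψ, rfl⟩
    exact hitL_mem C (hitR_mem C (hsC a ha) ψ) φ
  · intro w hw θ
    constructor
    · refine (Submodule.span_le (p := (Submodule.span B X).comap (hitL θ))).2 ?_ hw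
      rintro _ ⟨a, ha, φ, ψ, rfl⟩
      exact Submodule.subset_span ⟨a, ha, _, ψ, hitL_hitL _ _ _⟩
    · refine (Submodule.span_le (p := (Submodule.span B X).comap (hitR θ))).2 ?_ hw
      rintro _ ⟨a, ha, φ, ψ, rfl⟩
      exact Submodule.subset_span ⟨a, ha, φ, _, by rw [← hitL_hitR, hitR_hitR]⟩

/-- A finite-dimensional bistable space `W` generates `C`. As long as `E` does not contain `W`, some
element of `W` is primitive over `E` and new, and adjoining it enlarges `W ∩ E`. -/
theorem tower_of_finiteType (hunip : IsProUnipotent B A) {D C : HopfSubalgebra B A}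
    (h : D.toSubalgebra ≤ C.toSubalgebra) (hfg : Algebra.FiniteType B C.toSubalgebra) :
    Tower D C := by
  obtain ⟨s, hs⟩ := (Subalgebra.fg_iff_finiteType C.toSubalgebra).2 hfg
  have hsC : ∀ a ∈ (s : Set A), a ∈ C.toSubalgebra := fun a ha => by
    rw [← hs]; exact Algebra.subset_adjoin ha
  obtain ⟨W, hW, hsW, hWC, hstab⟩ := exists_finite_bistable C s.finite_toSet hsC
  suffices key : ∀ (n : ℕ) (E : HopfSubalgebra B A), Tower D E → E.toSubalgebra ≤ C.toSubalgebra →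
      Module.finrank B W - Module.finrank B
        (W ⊓ Subalgebra.toSubmodule E.toSubalgebra : Submodule B A) = n → Tower D C from
    key _ D Tower.refl h rfl
  intro n
  induction n using Nat.strong_induction_on with
  | _ n ih =>
  intro E hE hEC hn
  by_cases hWE : ∀ w ∈ W, w ∈ E.toSubalgebra
  · have : E = C := HopfSubalgebra.ext_toSubalgebra (le_antisymm hEC (by
      rw [← hs]
      exact Algebra.adjoin_le fun a ha => hWE a (hsW ha)))
    exact this ▸ hE
  · classical
    -- Take `x ∈ W` outside `E` in the lowest possible layer of the filtration. Its translates,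
    -- corrected by multiples of `x`, stay in `W` and lie one layer lower, hence in `E`; so `x` is
    -- primitive over `E`.
    have hex : ∃ m, ∃ w ∈ W, w ∈ invariantFiltration B A m ∧ w ∉ E.toSubalgebra := by
      push Not at hWE
      obtain ⟨w, hw, hwE⟩ := hWE
      obtain ⟨m, hm⟩ := hunip w
      exact ⟨m, w, hw, hm, hwE⟩
    obtain ⟨x, hxW, hxF, hxE⟩ := Nat.find_spec hex
    have hlt : ∀ k < Nat.find hex, ∀ w ∈ W, w ∈ invariantFiltration B A k → w ∈ E.toSubalgebra := by
      intro k hk w hw hw'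
      by_contra hwE
      exact Nat.find_min hex hk ⟨w, hw, hw', hwE⟩
    obtain ⟨m, hm⟩ : ∃ m, Nat.find hex = m + 1 := by
      refine Nat.exists_eq_succ_of_ne_zero fun h0 => hxE ?_
      rw [h0] at hxF
      rw [(Submodule.mem_bot B).1 hxF]
      exact zero_mem _
    rw [hm] at hxF hlt
    have hprim : IsPrimitiveOver E x := isPrimitiveOver_of_hit
      (fun φ => hlt m m.lt_succ_self _ (sub_mem (hstab x hxW φ).1 (W.smul_mem _ hxW))
        (mem_invariantFiltration_succ.1 hxF φ))
      (fun φ => hlt m m.lt_succ_self _ (sub_mem (hstab x hxW φ).2 (W.smul_mem _ hxW))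
        (hitR_sub_mem hxF φ))
    have hlt' : (W ⊓ Subalgebra.toSubmodule E.toSubalgebra : Submodule B A) <
        W ⊓ Subalgebra.toSubmodule (adjoinOne E x hprim).toSubalgebra := by
      refine lt_of_le_of_ne (inf_le_inf_left _ (le_adjoinOne E x hprim)) fun heq => hxE ?_
      have : x ∈ (W ⊓ Subalgebra.toSubmodule (adjoinOne E x hprim).toSubalgebra : Submodule B A) :=
        ⟨hxW, mem_adjoinOne E x hprim⟩
      rw [← heq] at this
      exact this.2
    have hfr : FiniteDimensional B
        (W ⊓ Subalgebra.toSubmodule (adjoinOne E x hprim).toSubalgebra : Submodule B A) :=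
      Submodule.finiteDimensional_of_le inf_le_left
    have h1 := Submodule.finrank_lt_finrank_of_lt hlt'
    have h2 : Module.finrank B (W ⊓ Subalgebra.toSubmodule (adjoinOne E x hprim).toSubalgebra :
      Submodule B A) ≤ Module.finrank B W := Submodule.finrank_mono inf_le_left
    refine ih _ ?_ (adjoinOne E x hprim) (Tower.step E x hprim hxE hE) ?_ rfl
    · omega
    · refine sup_le hEC (Algebra.adjoin_le ?_)
      rintro _ rfl
      exact hWC _ hxW

/-- If `x` is primitive over `E` and not in `E`, then `E[x]` is a polynomial ring over `E`. -/
theorem existsUnique_extend_adjoinOne [CharZero B] (hunip : IsProUnipotent B A)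
    {E : HopfSubalgebra B A} {x : A} (hx : IsPrimitiveOver E x) (hxE : x ∉ E.toSubalgebra)
    {S : Type u} [CommRing S] [Algebra B S] (v : WithConv (E.toSubalgebra →ₐ[B] S)) (s : S) :
    ∃! w : WithConv ((adjoinOne E x hx).toSubalgebra →ₐ[B] S),
      restrictHom S (le_adjoinOne E x hx) w = v ∧ w.ofConv ⟨x, mem_adjoinOne E x hx⟩ = s := by
  set T := adjoinOne E x hx with hT
  let f : E.toSubalgebra[X] →ₐ[B] A := (aeval x).restrictScalars B
  have hf : f.range = T.toSubalgebra := by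
    apply le_antisymm
    · rintro _ ⟨p, rfl⟩
      change aeval x p ∈ T.toSubalgebra
      rw [aeval_eq_sum_range]
      refine sum_mem fun i _ => ?_
      rw [Algebra.smul_def]
      exact mul_mem (le_adjoinOne E x hx (p.coeff i).2) (pow_mem (mem_adjoinOne E x hx) i)
    · refine sup_le (fun a ha => ⟨C ⟨a, ha⟩, ?_⟩) (Algebra.adjoin_le ?_)
      · exact aeval_C x (⟨a, ha⟩ : E.toSubalgebra)
      · intro y hy
        rw [Set.mem_singleton_iff.1 hy]
        exact ⟨X, aeval_X x⟩
  have hinj : Function.Injective f := aeval_injective_of_isPrimitiveOver hunip hx hxE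
  let e : E.toSubalgebra[X] ≃ₐ[B] T.toSubalgebra :=
    (AlgEquiv.ofInjective f hinj).trans (Subalgebra.equivOfEq _ _ hf)
  have heC : ∀ a, e (C a) = Subalgebra.inclusion (le_adjoinOne E x hx) a := fun a =>
    Subtype.ext (aeval_C x a)
  have heX : e X = ⟨x, mem_adjoinOne E x hx⟩ := Subtype.ext (aeval_X x)
  let g : E.toSubalgebra[X] →ₐ[B] S :=
    { eval₂RingHom v.ofConv.toRingHom s with
      commutes' := fun b => (eval₂_C v.ofConv.toRingHom s).trans (v.ofConv.commutes b) }
  refine ⟨.toConv (g.comp e.symm.toAlgHom), ⟨?_, ?_⟩, ?_⟩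
  · apply WithConv.ext
    ext a
    change g (e.symm (Subalgebra.inclusion (le_adjoinOne E x hx) a)) = _
    rw [← heC, AlgEquiv.symm_apply_apply]
    exact eval₂_C v.ofConv.toRingHom s
  · change g (e.symm ⟨x, mem_adjoinOne E x hx⟩) = s
    rw [← heX, AlgEquiv.symm_apply_apply]
    exact eval₂_X v.ofConv.toRingHom s
  · rintro w ⟨h1, h2⟩
    apply WithConv.ext
    have : w.ofConv.comp e.toAlgHom = g := by
      refine Polynomial.algHom_ext' ?_ ?_
      · ext a
        change w.ofConv (e (C a)) = g (C a)
        rw [heC]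
        refine Eq.trans ?_ (eval₂_C v.ofConv.toRingHom s).symm
        rw [← h1]
        rfl
      · change w.ofConv (e X) = g X
        rw [heX, h2]
        exact (eval₂_X v.ofConv.toRingHom s).symm
    rw [← this]
    ext a
    exact congrArg w.ofConv (e.apply_symm_apply a).symm

/-- Each step of the tower adds a free polynomial variable, whose value may be taken to be `0`. -/
theorem Tower.exists_extend [CharZero B] (hunip : IsProUnipotent B A) {D E : HopfSubalgebra B A}
    (h : Tower D E) {S : Type u} [CommRing S] [Algebra B S]
    (v : WithConv (D.toSubalgebra →ₐ[B] S)) :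
    ∃ w : WithConv (E.toSubalgebra →ₐ[B] S), restrictHom S h.le w = v := by
  induction h with
  | refl => exact ⟨v, rfl⟩
  | step E x hx hxE hE ih =>
    obtain ⟨w, hw⟩ := ih
    obtain ⟨w', ⟨hw', _⟩, _⟩ := existsUnique_extend_adjoinOne hunip hx hxE w 0
    exact ⟨w', by rw [← hw, ← hw']; rfl⟩

end Tower
end UnipCoh

namespace UnipCoh

/-! ### Symmetric cocycles of vector groups -/

section Polynomials
open MvPolynomial
variable {B : Type u} [Field B] {σ τ : Type}

theorem homogeneousComponent_aeval_linear (l : σ → MvPolynomial τ B)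
    (hl : ∀ i, (l i).IsHomogeneous 1) (d : ℕ) (p : MvPolynomial σ B) :
    homogeneousComponent d (aeval l p) = aeval l (homogeneousComponent d p) := by
  classical
  conv_lhs => rw [← sum_homogeneousComponent p, map_sum, map_sum]
  have h : ∀ i, homogeneousComponent d (aeval l (homogeneousComponent i p)) =
      if d = i then aeval l (homogeneousComponent d p) else 0 := by
    intro i
    have hi : (aeval l (homogeneousComponent i p)).IsHomogeneous (1 * i) :=
      (homogeneousComponent_isHomogeneous i p).aeval l hl
    rw [one_mul] at hi
    rw [homogeneousComponent_of_mem hi]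
    split_ifs with hd
    · rw [hd]
    · rfl
  simp_rw [h]
  rw [Finset.sum_ite_eq]
  split_ifs with hd
  · rfl
  · rw [homogeneousComponent_eq_zero, map_zero]
    simpa using hd

theorem aeval_add_of_isHomogeneous_one {S : Type*} [CommRing S] [Algebra B S]
    {p : MvPolynomial σ B} (hp : p.IsHomogeneous 1) (a b : σ → S) :
    aeval (fun i => a i + b i) p = aeval a p + aeval b p := by
  have hp' : p ∈ Submodule.span B (Set.range (X : σ → MvPolynomial σ B)) := by
    rw [← homogeneousSubmodule_one_eq_span_X]; exact hp
  clear hp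
  induction hp' using Submodule.span_induction with
  | mem x hx => obtain ⟨i, rfl⟩ := hx; simp
  | zero => simp
  | add x y _ _ hx hy => simp only [map_add, hx, hy]; abel
  | smul c x _ hx => simp only [map_smul, hx, smul_add]

theorem aeval_nsmul_of_isHomogeneous {S : Type*} [CommRing S] [Algebra B S]
    {p : MvPolynomial σ B} {d : ℕ} (hp : p.IsHomogeneous d) (c : ℕ) (a : σ → S) :
    aeval (fun i => c • a i) p = c ^ d • aeval a p := by
  rw [aeval_def, aeval_def, eval₂_eq, eval₂_eq, Finset.smul_sum]
  refine Finset.sum_congr rfl fun m hm => ?_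
  have hd : m.degree = d := by
    by_contra hne
    exact (mem_support_iff.1 hm) (hp.coeff_eq_zero hne)
  simp only [nsmul_eq_mul, mul_pow, Finset.prod_mul_distrib, Finset.prod_pow_eq_pow_sum]
  rw [← hd, show m.degree = ∑ i ∈ m.support, m i from rfl]
  push_cast
  ring

/-- A polynomial that satisfies `p(2 X) = 2 p(X)` is linear. -/
theorem isHomogeneous_one_of_aeval_two [CharZero B] {p : MvPolynomial σ B}
    (hp : aeval (fun i => 2 • X i) p = 2 • p) : p.IsHomogeneous 1 := by
  have h : ∀ d, d ≠ 1 → homogeneousComponent d p = 0 := by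
    intro d hd
    have h1 := congrArg (homogeneousComponent d) hp
    rw [homogeneousComponent_aeval_linear _ (fun i => by
      rw [← Nat.cast_smul_eq_nsmul B]
      exact (homogeneousSubmodule σ B 1).smul_mem _ (isHomogeneous_X B i)),
      aeval_nsmul_of_isHomogeneous (homogeneousComponent_isHomogeneous d p), map_nsmul,
      ← Nat.cast_smul_eq_nsmul B, ← Nat.cast_smul_eq_nsmul B 2, aeval_X_left_apply, ← sub_eq_zero,
      ← sub_smul] at h1
    -- Doubling the variables multiplies degree `d` by `2 ^ d`, and `2 ^ d ≠ 2` unless `d = 1`.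
    refine (smul_eq_zero.1 h1).resolve_left ?_
    refine sub_ne_zero.2 fun h2 => ?_
    have h3 : 2 ^ d = 2 ^ 1 := by exact_mod_cast h2
    exact hd (Nat.pow_right_injective le_rfl h3)
  have hsum := sum_homogeneousComponent p
  rw [← hsum]
  refine IsHomogeneous.sum _ _ _ fun i _ => ?_
  by_cases hi : i = 1
  · rw [hi]; exact homogeneousComponent_isHomogeneous 1 p
  · rw [h i hi]; exact isHomogeneous_zero _ _ _

/-- A polynomial symmetric 2-cocycle of a vector group is a coboundary, in characteristic zero. -/
theorem exists_coboundary_of_doubling [CharZero B] (f : MvPolynomial (σ ⊕ σ) B) (q : MvPolynomial σ B)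
    (hdbl : aeval (fun i => 2 • X i) f - 2 • f =
      aeval (fun i => X (Sum.inl i) + X (Sum.inr i)) q -
        aeval (fun i => X (Sum.inl i)) q - aeval (fun i => X (Sum.inr i)) q)
    (e : B) (hl : aeval (Sum.elim X 0) f = (C e : MvPolynomial σ B))
    (hr : aeval (Sum.elim 0 X) f = (C e : MvPolynomial σ B)) :
    ∃ h : MvPolynomial σ B, f = aeval (fun i => X (Sum.inl i) + X (Sum.inr i)) h -
        aeval (fun i => X (Sum.inl i)) h - aeval (fun i => X (Sum.inr i)) h := by
  classical
  have hX : ∀ i : σ ⊕ σ, (X i : MvPolynomial (σ ⊕ σ) B).IsHomogeneous 1 := isHomogeneous_X B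
  -- the linear component of `f` vanishes
  have hf1 : homogeneousComponent 1 f = 0 := by
    have hC : homogeneousComponent 1 (C e : MvPolynomial σ B) = 0 :=
      homogeneousComponent_eq_zero _ _ (by simp)
    have h1 := congrArg (homogeneousComponent 1) hl
    have h2 := congrArg (homogeneousComponent 1) hr
    rw [homogeneousComponent_aeval_linear _ (by
      rintro (i | i)
      · exact isHomogeneous_X B i
      · exact isHomogeneous_zero _ _ _), hC] at h1
    rw [homogeneousComponent_aeval_linear _ (by
      rintro (i | i)
      · exact isHomogeneous_zero _ _ _
      · exact isHomogeneous_X B i), hC] at h2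
    have h1' := congrArg (aeval fun i => (X (Sum.inl i) : MvPolynomial (σ ⊕ σ) B)) h1
    have h2' := congrArg (aeval fun i => (X (Sum.inr i) : MvPolynomial (σ ⊕ σ) B)) h2
    rw [map_zero, ← AlgHom.comp_apply, comp_aeval] at h1' h2'
    -- A linear form in two sets of variables is the sum of its restrictions to the two coordinate
    -- subspaces, and on these `f` is constant.
    have := aeval_add_of_isHomogeneous_one (homogeneousComponent_isHomogeneous 1 f)
      (fun i => aeval (fun i => (X (Sum.inl i) : MvPolynomial (σ ⊕ σ) B))
        ((Sum.elim X 0 : σ ⊕ σ → MvPolynomial σ B) i))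
      (fun i => aeval (fun i => (X (Sum.inr i) : MvPolynomial (σ ⊕ σ) B))
        ((Sum.elim 0 X : σ ⊕ σ → MvPolynomial σ B) i))
    rw [h1', h2', add_zero] at this
    rw [← this]
    conv_lhs => rw [← aeval_X_left_apply (homogeneousComponent 1 f)]
    congr 2
    funext i
    rcases i with i | i <;> simp
  have hd : ∀ d, ((2 : B) ^ d - 2) • homogeneousComponent d f =
      aeval (fun i => X (Sum.inl i) + X (Sum.inr i)) (homogeneousComponent d q) -
        aeval (fun i => X (Sum.inl i)) (homogeneousComponent d q) -
        aeval (fun i => X (Sum.inr i)) (homogeneousComponent d q) := by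
    intro d
    have h := congrArg (homogeneousComponent d) hdbl
    rw [map_sub, map_sub, map_sub,
      homogeneousComponent_aeval_linear _ (fun i => (hX _).add (hX _)),
      homogeneousComponent_aeval_linear _ (fun i => hX _),
      homogeneousComponent_aeval_linear _ (fun i => hX _),
      homogeneousComponent_aeval_linear _ (fun i => by
        rw [← Nat.cast_smul_eq_nsmul B]
        exact (homogeneousSubmodule _ B 1).smul_mem _ (hX i)),
      aeval_nsmul_of_isHomogeneous (homogeneousComponent_isHomogeneous d f), map_nsmul,
      ← Nat.cast_smul_eq_nsmul B, ← Nat.cast_smul_eq_nsmul B 2, aeval_X_left_apply,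
      ← sub_smul] at h
    rw [← h]
    push_cast
    rfl
  -- The doubling relation in degree `d` says that `(2 ^ d - 2) f_d` is the coboundary of `q_d`;
  -- divide by the scalar. For `d = 1` the inverse is `0⁻¹ = 0`, which is harmless since `f_1 = 0`.
  let h : MvPolynomial σ B := ∑ d ∈ Finset.range (f.totalDegree + 1),
    ((2 : B) ^ d - 2)⁻¹ • homogeneousComponent d q
  refine ⟨h, ?_⟩
  conv_lhs => rw [← sum_homogeneousComponent f]
  simp only [h, map_sum, ← Finset.sum_sub_distrib, map_smul, ← smul_sub]
  refine Finset.sum_congr rfl fun d _ => ?_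
  rw [← hd, smul_smul]
  by_cases h1 : d = 1
  · rw [h1, hf1, smul_zero]
  · rw [inv_mul_cancel₀, one_smul]
    refine sub_ne_zero.2 fun h2 => ?_
    have h3 : 2 ^ d = 2 ^ 1 := by exact_mod_cast h2
    exact h1 (Nat.pow_right_injective le_rfl h3)

end Polynomials

/-! ### Commutative kernels are vector groups -/

section LinearCoords
open MvPolynomial
variable {B A : Type u} [Field B] [CommRing A] [HopfAlgebra B A]

/-- The functions `y i` on `Spec E` restrict to an isomorphism from the kernel of `Spec E → Spec D`
to a power of the additive group. -/
structure IsLinearCoords {D E : HopfSubalgebra B A} (h : D.toSubalgebra ≤ E.toSubalgebra) {ι : Type}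
    (y : ι → E.toSubalgebra) : Prop where
  mul_apply : ∀ (S : Type u) [CommRing S] [Algebra B S] (v w : WithConv (E.toSubalgebra →ₐ[B] S)),
    restrictHom S h v = 1 → restrictHom S h w = 1 →
      ∀ i, (v * w).ofConv (y i) = v.ofConv (y i) + w.ofConv (y i)
  existsUnique : ∀ (S : Type u) [CommRing S] [Algebra B S] (s : ι → S),
    ∃! v : WithConv (E.toSubalgebra →ₐ[B] S), restrictHom S h v = 1 ∧ ∀ i, v.ofConv (y i) = s i

/-- Composition of a point with a homomorphism. -/
def compPoint {E S S' : Type*} [CommRing E] [Algebra B E] [CommRing S] [Algebra B S]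
    [CommRing S'] [Algebra B S'] (θ : S →ₐ[B] S') (v : WithConv (E →ₐ[B] S)) :
    WithConv (E →ₐ[B] S') := .toConv (θ.comp v.ofConv)

theorem restrictHom_compPoint {D E : HopfSubalgebra B A} (h : D.toSubalgebra ≤ E.toSubalgebra)
    {S S' : Type u} [CommRing S] [Algebra B S] [CommRing S'] [Algebra B S'] (θ : S →ₐ[B] S')
    {v : WithConv (E.toSubalgebra →ₐ[B] S)} (hv : restrictHom S h v = 1) :
    restrictHom S' h (compPoint θ v) = 1 := by
  have : restrictHom S' h (compPoint θ v) = compPoint θ (restrictHom S h v) := rfl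
  rw [this, hv]
  apply WithConv.ext
  ext d
  exact θ.commutes _

namespace IsLinearCoords
variable {D E : HopfSubalgebra B A} {h : D.toSubalgebra ≤ E.toSubalgebra} {ι : Type}
  {y : ι → E.toSubalgebra}

theorem ext (hy : IsLinearCoords h y) {S : Type u} [CommRing S] [Algebra B S]
    {v w : WithConv (E.toSubalgebra →ₐ[B] S)} (hv : restrictHom S h v = 1)
    (hw : restrictHom S h w = 1) (hvw : ∀ i, v.ofConv (y i) = w.ofConv (y i)) : v = w :=
  (hy.existsUnique S fun i => w.ofConv (y i)).unique ⟨hv, hvw⟩ ⟨hw, fun _ => rfl⟩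

/-- Every point of the kernel is a specialization of a point with given coordinates `X i`. -/
theorem eq_compPoint (hy : IsLinearCoords h y) {S S' : Type u} [CommRing S] [Algebra B S]
    [CommRing S'] [Algebra B S'] (θ : S →ₐ[B] S') {v : WithConv (E.toSubalgebra →ₐ[B] S)}
    {w : WithConv (E.toSubalgebra →ₐ[B] S')} (hv : restrictHom S h v = 1)
    (hw : restrictHom S' h w = 1) (hvw : ∀ i, θ (v.ofConv (y i)) = w.ofConv (y i)) :
    w = compPoint θ v :=
  hy.ext hw (restrictHom_compPoint h θ hv) fun i => (hvw i).symm

end IsLinearCoords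

theorem isLinearCoords_refl (D : HopfSubalgebra B A) :
    IsLinearCoords (le_refl D.toSubalgebra) (fun i : Empty => i.elim) where
  mul_apply _ _ _ _ _ _ _ i := i.elim
  existsUnique _ _ _ _ := ⟨1, ⟨map_one _, fun i => i.elim⟩, fun _ hv => hv.1⟩

/-- The inductive step: over `E[x]`, the coordinate `x` can be corrected by a polynomial in the
coordinates of `E` to become additive. -/
theorem IsLinearCoords.adjoinOne [CharZero B] (hunip : IsProUnipotent B A)
    {D E : HopfSubalgebra B A} {h : D.toSubalgebra ≤ E.toSubalgebra} {ι : Type}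
    {y : ι → E.toSubalgebra} (hy : IsLinearCoords h y)
    {x : A} (hx : IsPrimitiveOver E x) (hxE : x ∉ E.toSubalgebra)
    (hcomm : ∀ (S : Type u) [CommRing S] [Algebra B S]
      (v w : WithConv ((adjoinOne E x hx).toSubalgebra →ₐ[B] S)),
      restrictHom S (h.trans (le_adjoinOne E x hx)) v = 1 →
      restrictHom S (h.trans (le_adjoinOne E x hx)) w = 1 → v * w = w * v) :
    ∃ y' : Option ι → (UnipCoh.adjoinOne E x hx).toSubalgebra,
      IsLinearCoords (h.trans (le_adjoinOne E x hx)) y' := by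
  set T := UnipCoh.adjoinOne E x hx with hT
  set hET := le_adjoinOne E x hx
  set xT : T.toSubalgebra := ⟨x, mem_adjoinOne E x hx⟩ with hxT
  obtain ⟨t, ht⟩ := id hx
  have hker : ∀ {S : Type u} [CommRing S] [Algebra B S] {v : WithConv (T.toSubalgebra →ₐ[B] S)},
      restrictHom S (h.trans hET) v = 1 → restrictHom S h (restrictHom S hET v) = 1 :=
    fun hv => hv
  have hpt : ∀ {S : Type u} [CommRing S] [Algebra B S] (s : ι → S) (r : S),
      ∃ v : WithConv (T.toSubalgebra →ₐ[B] S), restrictHom S (h.trans hET) v = 1 ∧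
        (∀ i, v.ofConv (Subalgebra.inclusion hET (y i)) = s i) ∧ v.ofConv xT = r := by
    intro S _ _ s r
    obtain ⟨v, ⟨hv, hvs⟩, _⟩ := hy.existsUnique S s
    obtain ⟨w, ⟨hw, hwr⟩, _⟩ := existsUnique_extend_adjoinOne hunip hx hxE v r
    refine ⟨w, ?_, fun i => ?_, hwr⟩
    · have : restrictHom S (h.trans hET) w = restrictHom S h (restrictHom S hET w) := rfl
      rw [this, hw, hv]
    · rw [← hvs i, ← hw]; rfl
  have hyadd : ∀ {S : Type u} [CommRing S] [Algebra B S] {v w : WithConv (T.toSubalgebra →ₐ[B] S)},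
      restrictHom S (h.trans hET) v = 1 → restrictHom S (h.trans hET) w = 1 → ∀ i,
      (v * w).ofConv (Subalgebra.inclusion hET (y i)) =
        v.ofConv (Subalgebra.inclusion hET (y i)) + w.ofConv (Subalgebra.inclusion hET (y i)) := by
    intro S _ _ v w hv hw i
    have := hy.mul_apply S (restrictHom S hET v) (restrictHom S hET w) hv hw i
    rw [← map_mul (restrictHom S hET)] at this
    exact this
  have hmulker : ∀ {S : Type u} [CommRing S] [Algebra B S]
      {v w : WithConv (T.toSubalgebra →ₐ[B] S)},
      restrictHom S (h.trans hET) v = 1 → restrictHom S (h.trans hET) w = 1 →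
      restrictHom S (h.trans hET) (v * w) = 1 := by
    intro S _ _ v w hv hw
    rw [map_mul, hv, hw, one_mul]
  -- the universal pair of points
  obtain ⟨V, hV, hVy, hVx⟩ := hpt (S := MvPolynomial (ι ⊕ ι) B) (fun i => X (Sum.inl i)) 0
  obtain ⟨W, hW, hWy, hWx⟩ := hpt (S := MvPolynomial (ι ⊕ ι) B) (fun i => X (Sum.inr i)) 0
  set f : MvPolynomial (ι ⊕ ι) B := (V * W).ofConv xT with hf
  have hfV : f = Algebra.TensorProduct.productMap (restrictHom _ hET V).ofConv
      (restrictHom _ hET W).ofConv t := by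
    rw [hf, mul_apply_of_isPrimitiveOver hET xT ht, hVx, hWx, zero_add, zero_add]
  -- Pairs of kernel points of `Spec E` are specializations of the images of `(V, W)`, so the single
  -- polynomial `f` describes the group law in the coordinate `x` over every `S`.
  have hmul : ∀ {S : Type u} [CommRing S] [Algebra B S] {v w : WithConv (T.toSubalgebra →ₐ[B] S)},
      restrictHom S (h.trans hET) v = 1 → restrictHom S (h.trans hET) w = 1 →
      (v * w).ofConv xT = v.ofConv xT + w.ofConv xT +
        aeval (Sum.elim (fun i => v.ofConv (Subalgebra.inclusion hET (y i)))
          (fun i => w.ofConv (Subalgebra.inclusion hET (y i)))) f := by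
    intro S _ _ v w hv hw
    rw [mul_apply_of_isPrimitiveOver hET xT ht, hfV]
    set θ : MvPolynomial (ι ⊕ ι) B →ₐ[B] S :=
      aeval (Sum.elim (fun i => v.ofConv (Subalgebra.inclusion hET (y i)))
          (fun i => w.ofConv (Subalgebra.inclusion hET (y i)))) with hθ
    rw [hy.eq_compPoint θ (hker hV) (hker hv) (fun i => by
        refine (congrArg θ (hVy i)).trans ?_
        rw [hθ, aeval_X]; rfl),
      hy.eq_compPoint θ (hker hW) (hker hw) (fun i => by
        refine (congrArg θ (hWy i)).trans ?_
        rw [hθ, aeval_X]; rfl)]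
    congr 1
    have : Algebra.TensorProduct.productMap (compPoint θ (restrictHom _ hET V)).ofConv
        (compPoint θ (restrictHom _ hET W)).ofConv =
        θ.comp (Algebra.TensorProduct.productMap (restrictHom _ hET V).ofConv
          (restrictHom _ hET W).ofConv) := by
      apply Algebra.TensorProduct.ext' fun a b => ?_
      exact (_root_.map_mul θ _ _).symm
    rw [this]; rfl
  -- The restriction of `f` to the diagonal: the `x`-coordinate of a square.
  let q : MvPolynomial ι B := aeval (Sum.elim X X) f
  have hq : ∀ {S : Type u} [CommRing S] [Algebra B S] (s : ι → S),
      aeval (Sum.elim s s) f = aeval s q := by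
    intro S _ _ s
    have : (aeval s).comp (aeval (Sum.elim X X : ι ⊕ ι → MvPolynomial ι B)) =
        aeval (Sum.elim s s) := by
      ext i
      rcases i with i | i <;> simp
    rw [← this]; rfl
  have hdbl : aeval (fun i => 2 • X i) f - 2 • f =
      aeval (fun i => X (Sum.inl i) + X (Sum.inr i)) q -
        aeval (fun i => X (Sum.inl i)) q - aeval (fun i => X (Sum.inr i)) q := by
    have hc := hcomm _ V W hV hW
    -- Commutativity of the kernel enters here: comparing the `x`-coordinates of the two sides is
    -- the doubling relation.
    have h1 : (V * W) * (V * W) = (V * V) * (W * W) := by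
      rw [mul_assoc, ← mul_assoc W, ← hc, mul_assoc, mul_assoc]
    have h2 := congrArg (fun v => v.ofConv xT) h1
    rw [hmul (hmulker hV hW) (hmulker hV hW), hmul (hmulker hV hV) (hmulker hW hW),
      hmul hV hV, hmul hW hW, hVx, hWx, ← hf] at h2
    simp only [hyadd hV hW, hyadd hV hV, hyadd hW hW, hVy, hWy] at h2
    rw [hq, hq, hq] at h2
    have h3 : (Sum.elim (fun i => X (Sum.inl i) + X (Sum.inl i))
        (fun i => X (Sum.inr i) + X (Sum.inr i)) : ι ⊕ ι → MvPolynomial (ι ⊕ ι) B) =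
        fun i => 2 • X i := by
      funext i
      rcases i with i | i <;> simp [two_mul]
    rw [h3] at h2
    rw [two_nsmul]
    linear_combination -h2
  obtain ⟨V₁, hV₁, hV₁y, hV₁x⟩ := hpt (S := MvPolynomial ι B) (fun i => X i) 0
  -- The function `x` need not vanish at the identity, so `f` is normalized only up to the constant
  -- `-ε(x)`.
  set e : B := - counit (R := B) xT with he
  have hone : restrictHom (MvPolynomial ι B) (h.trans hET) 1 = 1 := map_one _
  have hone_y : ∀ i, (1 : WithConv (T.toSubalgebra →ₐ[B] MvPolynomial ι B)).ofConv
      (Subalgebra.inclusion hET (y i)) = 0 := by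
    intro i
    have := hyadd hone hone i
    rw [one_mul] at this
    simpa using this
  have hone_x : (1 : WithConv (T.toSubalgebra →ₐ[B] MvPolynomial ι B)).ofConv xT = - C e := by
    rw [he, C_neg, neg_neg]; rfl
  have hl : aeval (Sum.elim X 0) f = (C e : MvPolynomial ι B) := by
    have := hmul hV₁ hone
    simp only [mul_one, hone_x, hV₁x, hV₁y, hone_y] at this
    have h0 : (fun _ => 0 : ι → MvPolynomial ι B) = 0 := rfl
    rw [h0] at this
    linear_combination -this
  have hr : aeval (Sum.elim 0 X) f = (C e : MvPolynomial ι B) := by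
    have := hmul hone hV₁
    simp only [one_mul, hone_x, hV₁x, hV₁y, hone_y] at this
    have h0 : (fun _ => 0 : ι → MvPolynomial ι B) = 0 := rfl
    rw [h0] at this
    linear_combination -this
  obtain ⟨p, hp⟩ := exists_coboundary_of_doubling f q hdbl e hl hr
  have hpf : ∀ {S : Type u} [CommRing S] [Algebra B S] (s s' : ι → S),
      aeval (Sum.elim s s') f = aeval (fun i => s i + s' i) p - aeval s p - aeval s' p := by
    intro S _ _ s s'
    conv_lhs => rw [hp]
    rw [map_sub, map_sub, ← AlgHom.comp_apply, ← AlgHom.comp_apply, ← AlgHom.comp_apply,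
      comp_aeval, comp_aeval, comp_aeval]
    simp
  -- As `f` is the coboundary of `p`, the function `x - p(y)` is additive on the kernel.
  let P : T.toSubalgebra := aeval (fun i => Subalgebra.inclusion hET (y i)) p
  have hP : ∀ {S : Type u} [CommRing S] [Algebra B S] (v : WithConv (T.toSubalgebra →ₐ[B] S)),
      v.ofConv P = aeval (fun i => v.ofConv (Subalgebra.inclusion hET (y i))) p := by
    intro S _ _ v
    rw [← comp_aeval]; rfl
  refine ⟨fun o => o.elim (xT - P) fun i => Subalgebra.inclusion hET (y i), ?_, ?_⟩
  · rintro S _ _ v w hv hw (_ | i)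
    · change (v * w).ofConv (xT - P) = v.ofConv (xT - P) + w.ofConv (xT - P)
      rw [map_sub, map_sub, map_sub, hmul hv hw, hP, hP, hP, hpf]
      simp only [hyadd hv hw]
      ring
    · exact hyadd hv hw i
  · intro S _ _ s
    obtain ⟨v, hv, hvy, hvx⟩ := hpt (fun i => s (some i)) (s none + aeval (fun i => s (some i)) p)
    refine ⟨v, ⟨hv, ?_⟩, ?_⟩
    · rintro (_ | i)
      · change v.ofConv (xT - P) = s none
        rw [map_sub, hvx, hP]
        simp only [hvy]
        ring
      · exact hvy i
    · rintro w ⟨hw, hws⟩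
      have hwy : ∀ i, w.ofConv (Subalgebra.inclusion hET (y i)) = s (some i) := fun i => hws (some i)
      have hwx : w.ofConv (xT - P) = s none := hws none
      have hEq : restrictHom S hET w = restrictHom S hET v :=
        hy.ext (hker hw) (hker hv) fun i => (hwy i).trans (hvy i).symm
      refine (existsUnique_extend_adjoinOne hunip hx hxE (restrictHom S hET v)
        (v.ofConv xT)).unique ⟨hEq, ?_⟩ ⟨rfl, rfl⟩
      rw [map_sub, hP] at hwx
      simp only [hwy] at hwx
      change w.ofConv xT = v.ofConv xT
      rw [hvx, ← hwx]
      ring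

/-- Induction along the tower. The kernel at a lower stage is again commutative, because its points
lift to the upper stage with the new variable set to `0`. -/
theorem Tower.exists_isLinearCoords [CharZero B] (hunip : IsProUnipotent B A)
    {D E : HopfSubalgebra B A} (hDE : Tower D E)
    (hcomm : ∀ (S : Type u) [CommRing S] [Algebra B S] (v w : WithConv (E.toSubalgebra →ₐ[B] S)),
      restrictHom S hDE.le v = 1 → restrictHom S hDE.le w = 1 → v * w = w * v) :
    ∃ (ι : Type) (_ : Finite ι) (y : ι → E.toSubalgebra), IsLinearCoords hDE.le y := by
  induction hDE with
  | refl => exact ⟨Empty, inferInstance, _, isLinearCoords_refl D⟩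
  | step E x hx hxE hE ih =>
    obtain ⟨ι, hι, y, hy⟩ := ih fun S _ _ v w hv hw => by
      obtain ⟨v', ⟨rfl, _⟩, _⟩ := existsUnique_extend_adjoinOne hunip hx hxE v 0
      obtain ⟨w', ⟨rfl, _⟩, _⟩ := existsUnique_extend_adjoinOne hunip hx hxE w 0
      rw [← map_mul, ← map_mul, hcomm S v' w' hv hw]
    obtain ⟨y', hy'⟩ := hy.adjoinOne hunip hx hxE hcomm
    exact ⟨Option ι, inferInstance, y', hy'⟩

end LinearCoords
end UnipCoh

namespace UnipCoh

/-! ### Continuous functions on compact spaces -/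

section FinCont
variable (B : Type*) [Field B] [TopologicalSpace B] (X : Type*) [TopologicalSpace X]
  (V : Type*) [AddCommGroup V] [Module B V]

/-- The functions `X → V` of the form `x ↦ ∑ φ_i(x) v_i` with continuous `φ_i : X → B`. -/
def finCont : Submodule B (X → V) :=
  Submodule.span B {f | ∃ φ : X → B, Continuous φ ∧ ∃ v : V, f = fun x => φ x • v}

variable {B X V} {W : Type*} [AddCommGroup W] [Module B W]

theorem smul_mem_finCont {φ : X → B} (hφ : Continuous φ) (v : V) :
    (fun x => φ x • v) ∈ finCont B X V :=
  Submodule.subset_span ⟨φ, hφ, v, rfl⟩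

theorem const_mem_finCont (v : V) : (fun _ => v) ∈ finCont B X V := by
  simpa using smul_mem_finCont (X := X) (continuous_const (y := (1 : B))) v

theorem exists_sum_of_mem_finCont {f : X → V} (hf : f ∈ finCont B X V) :
    ∃ (n : ℕ) (φ : Fin n → X → B) (v : Fin n → V), (∀ i, Continuous (φ i)) ∧
      f = fun x => ∑ i, φ i x • v i := by
  suffices h : ∃ (ι : Type) (_ : Fintype ι) (φ : ι → X → B) (v : ι → V), (∀ i, Continuous (φ i)) ∧
      f = fun x => ∑ i, φ i x • v i by
    obtain ⟨ι, _, φ, v, hφ, rfl⟩ := h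
    refine ⟨Fintype.card ι, fun i => φ ((Fintype.equivFin ι).symm i),
      fun i => v ((Fintype.equivFin ι).symm i), fun i => hφ _, funext fun x => ?_⟩
    exact ((Fintype.equivFin ι).symm.sum_comp fun i => φ i x • v i).symm
  induction hf using Submodule.span_induction with
  | mem f hf =>
    obtain ⟨φ, hφ, v, rfl⟩ := hf
    exact ⟨Unit, inferInstance, fun _ => φ, fun _ => v, fun _ => hφ, by simp⟩
  | zero => exact ⟨Empty, inferInstance, fun i => i.elim, fun i => i.elim, fun i => i.elim, by
      funext x; simp⟩
  | add f g _ _ hf hg =>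
    obtain ⟨ι, _, φ, v, hφ, rfl⟩ := hf
    obtain ⟨κ, _, ψ, w, hψ, rfl⟩ := hg
    refine ⟨ι ⊕ κ, inferInstance, Sum.elim φ ψ, Sum.elim v w, ?_, ?_⟩
    · rintro (i | i)
      · exact hφ i
      · exact hψ i
    · funext x
      simp
  | smul c f _ hf =>
    obtain ⟨ι, _, φ, v, hφ, rfl⟩ := hf
    refine ⟨ι, inferInstance, φ, fun i => c • v i, hφ, ?_⟩
    funext x
    simp only [Pi.smul_apply, Finset.smul_sum, smul_comm c]

theorem sum_mem_finCont {ι : Type*} [Fintype ι] {φ : ι → X → B} (hφ : ∀ i, Continuous (φ i))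
    (v : ι → V) : (fun x => ∑ i, φ i x • v i) ∈ finCont B X V := by
  have : (fun x => ∑ i, φ i x • v i) = ∑ i, fun x => φ i x • v i := by
    funext x; simp
  rw [this]
  exact Submodule.sum_mem _ fun i _ => smul_mem_finCont (hφ i) _

theorem comp_mem_finCont (l : V →ₗ[B] W) {f : X → V} (hf : f ∈ finCont B X V) :
    (fun x => l (f x)) ∈ finCont B X W := by
  obtain ⟨n, φ, v, hφ, rfl⟩ := exists_sum_of_mem_finCont hf
  simp only [map_sum, map_smul]
  exact sum_mem_finCont hφ _

theorem precomp_mem_finCont {Y : Type*} [TopologicalSpace Y] {p : Y → X} (hp : Continuous p)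
    {f : X → V} (hf : f ∈ finCont B X V) : (fun y => f (p y)) ∈ finCont B Y V := by
  obtain ⟨n, φ, v, hφ, rfl⟩ := exists_sum_of_mem_finCont hf
  exact sum_mem_finCont (φ := fun i y => φ i (p y)) (fun i => (hφ i).comp hp) _

/-- Compose with a linear retraction of `j`. -/
theorem mem_finCont_of_comp_injective {j : V →ₗ[B] W} (hj : Function.Injective j) {f : X → V}
    (hf : (fun x => j (f x)) ∈ finCont B X W) : f ∈ finCont B X V := by
  obtain ⟨r, hr⟩ := j.exists_leftInverse_of_injective (LinearMap.ker_eq_bot.2 hj)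
  have := comp_mem_finCont r hf
  have h : (fun x => r (j (f x))) = f := funext fun x => DFunLike.congr_fun hr (f x)
  rwa [h] at this

theorem pi_mem_finCont {ι : Type*} [Finite ι] {f : X → ι → V}
    (hf : ∀ i, (fun x => f x i) ∈ finCont B X V) : f ∈ finCont B X (ι → V) := by
  classical
  have := Fintype.ofFinite ι
  have h : f = ∑ i, fun x => LinearMap.single B (fun _ : ι => V) i (f x i) := by
    funext x i
    simp [Finset.sum_apply, Pi.single_apply]
  rw [h]
  exact Submodule.sum_mem _ fun i _ => comp_mem_finCont _ (hf i)

section Mul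
variable [ContinuousMul B]

theorem mul_smul_mem_finCont {φ : X → B} (hφ : Continuous φ) {f : X → V}
    (hf : f ∈ finCont B X V) : (fun x => φ x • f x) ∈ finCont B X V := by
  obtain ⟨n, ψ, v, hψ, rfl⟩ := exists_sum_of_mem_finCont hf
  simp only [Finset.smul_sum, smul_smul]
  exact sum_mem_finCont (φ := fun i x => φ x * ψ i x) (fun i => hφ.mul (hψ i)) _

theorem mul_mem_finCont {S : Type*} [CommRing S] [Algebra B S] {f g : X → S}
    (hf : f ∈ finCont B X S) (hg : g ∈ finCont B X S) : (fun x => f x * g x) ∈ finCont B X S := by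
  obtain ⟨n, φ, v, hφ, rfl⟩ := exists_sum_of_mem_finCont hf
  have : (fun x => (∑ i, φ i x • v i) * g x) =
      ∑ i, fun x => φ i x • LinearMap.mulLeft B (v i) (g x) := by
    funext x
    simp [Finset.sum_mul]
  rw [this]
  exact Submodule.sum_mem _ fun i _ => mul_smul_mem_finCont (hφ i) (comp_mem_finCont _ hg)

end Mul
end FinCont

/-! ### Compact sets in the inductive limit topology. -/

section Compact
variable {B : Type u} [Field B] [TopologicalSpace B] [IsTopologicalRing B]
  {X : Type*} [TopologicalSpace X] {V : Type u} [AddCommGroup V] [Module B V]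

theorem continuous_linear_indTopology {n : ℕ} (l : (Fin n → B) →ₗ[B] V) :
    Continuous[inferInstance, indTopology B V] l :=
  continuous_iff_coinduced_le.2 (le_iSup₂_of_le (f := fun (n : ℕ) (f : (Fin n → B) →ₗ[B] V) =>
    TopologicalSpace.coinduced f inferInstance) n l le_rfl)

theorem continuous_dual_indTopology (l : Module.Dual B V) :
    Continuous[indTopology B V, inferInstance] l := by
  refine continuous_iSup_dom.2 fun n => continuous_iSup_dom.2 fun f => ?_
  exact continuous_coinduced_dom.2 ((l ∘ₗ f).continuous_on_pi)

theorem continuous_of_mem_finCont {f : X → V} (hf : f ∈ finCont B X V) :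
    Continuous[_, indTopology B V] f := by
  obtain ⟨n, φ, v, hφ, rfl⟩ := exists_sum_of_mem_finCont hf
  have h := continuous_linear_indTopology (Fintype.linearCombination B v)
  have h' : (fun x => ∑ i, φ i x • v i) =
      fun x => Fintype.linearCombination B v (fun i => φ i x) := by
    funext x
    rw [Fintype.linearCombination_apply]
  rw [h']
  exact @Continuous.comp _ _ _ _ _ (indTopology B V) _ _ h (continuous_pi hφ)

variable [T2Space B]

/-- A linearly independent set meets the finite-dimensional image of a map `B^n → V` in finitely
many points, and the fibre over a point is closed because linear functionals separate points and are
continuous on `B^n`. -/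
theorem isClosed_indTopology_of_linearIndependent {b c : Set V}
    (hb : LinearIndependent B ((↑) : b → V)) (hc : c ⊆ b) :
    IsClosed[indTopology B V] c := by
  refine isClosed_iSup_iff.2 fun n => isClosed_iSup_iff.2 fun f => isClosed_coinduced.2 ?_
  have hfin : (c ∩ LinearMap.range f).Finite := by
    have h1 : LinearIndependent B (fun x : (c ∩ LinearMap.range f : Set V) =>
        (⟨x, x.2.2⟩ : LinearMap.range f)) := by
      refine LinearIndependent.of_comp (LinearMap.range f).subtype ?_
      exact hb.comp (fun x : (c ∩ LinearMap.range f : Set V) => (⟨x, hc x.2.1⟩ : b))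
        fun x y h => Subtype.ext (congrArg (fun z : b => (z : V)) h)
    have := h1.finite
    exact Set.toFinite _
  have hpre : f ⁻¹' c = ⋃ w ∈ c ∩ LinearMap.range f, f ⁻¹' {w} := by
    ext x
    simp
  rw [hpre]
  refine hfin.isClosed_biUnion fun w _ => ?_
  have h2 : f ⁻¹' {w} = ⋂ l : Module.Dual B V, (l ∘ₗ f) ⁻¹' {l w} := by
    ext x
    simp only [Set.mem_preimage, Set.mem_singleton_iff, Set.mem_iInter, LinearMap.comp_apply]
    refine ⟨fun h l => by rw [h], fun h => ?_⟩
    rw [← sub_eq_zero, ← Module.forall_dual_apply_eq_zero_iff B]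
    exact fun l => by rw [map_sub, h l, sub_self]
  rw [h2]
  exact isClosed_iInter fun l => isClosed_singleton.preimage (l ∘ₗ f).continuous_on_pi

/-- A continuous map from a compact space to a vector space with the inductive limit topology takes
values in a finite-dimensional subspace. -/
theorem mem_finCont_iff_continuous [CompactSpace X] {f : X → V} :
    f ∈ finCont B X V ↔ Continuous[_, indTopology B V] f := by
  refine ⟨continuous_of_mem_finCont, fun hf => ?_⟩
  -- The set `b` is a linearly independent part of the range with the same span. An infinite `b`
  -- would accumulate at a point `x` of the compact range, yet `b \ {x}` is closed and misses `x`.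
  obtain ⟨b, hbf, hspan, hb⟩ := exists_linearIndependent B (Set.range f)
  have hfin : b.Finite := by
    let : TopologicalSpace V := indTopology B V
    by_contra hinf
    obtain ⟨x, _, hx⟩ := Set.Infinite.exists_accPt_of_subset_isCompact hinf
      (isCompact_range hf) hbf
    have hcl := isClosed_indTopology_of_linearIndependent hb (Set.sdiff_subset (s := b) (t := {x}))
    have := accPt_iff_clusterPt.1 hx
    have h3 : x ∈ closure (b \ {x}) := by
      rw [mem_closure_iff_clusterPt]
      convert this using 1
      rw [Filter.inf_principal, Set.inter_comm]
      rfl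
    rw [hcl.closure_eq] at h3
    exact h3.2 rfl
  have := hfin.fintype
  let e := Module.Basis.span hb
  have hval : ∀ x, f x ∈ Submodule.span B (Set.range ((↑) : b → V)) := fun x => by
    rw [Subtype.range_coe, hspan]
    exact Submodule.subset_span ⟨x, rfl⟩
  obtain ⟨r, hr⟩ := (Submodule.span B (Set.range ((↑) : b → V))).subtype.exists_leftInverse_of_injective
    (Submodule.ker_subtype _)
  have hf' : f = fun x => ∑ i, (e.coord i ∘ₗ r) (f x) • (e i : V) := by
    funext x
    have h1 : r (f x) = ⟨f x, hval x⟩ := DFunLike.congr_fun hr ⟨f x, hval x⟩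
    have h2 := congrArg (fun z : Submodule.span B (Set.range ((↑) : b → V)) => (z : V))
      (e.sum_repr ⟨f x, hval x⟩)
    simp only [Submodule.coe_sum, Submodule.coe_smul] at h2
    simp only [LinearMap.comp_apply, h1, Module.Basis.coord_apply]
    exact h2.symm
  rw [hf']
  exact sum_mem_finCont (fun i => @Continuous.comp _ _ _ _ (indTopology B V) _ _ _
    (continuous_dual_indTopology _) hf) _

end Compact

/-! ### Continuous families of points -/

section PointFamilies
variable {B A S : Type u} [Field B] [TopologicalSpace B] [IsTopologicalRing B] [T2Space B]
  [CommRing A] [CommRing S] [Algebra B S] {X : Type*} [TopologicalSpace X] [CompactSpace X]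

/-- Over a compact parameter space a family of points can be tested one function at a time, by an
algebraic condition. The continuity of products, inverses and translates is derived from this for
families only; joint continuity of the group law on points is never needed. -/
theorem continuous_points_iff [Algebra B A] {v : X → WithConv (A →ₐ[B] S)} :
    Continuous v ↔ ∀ a, (fun x => (v x).ofConv a) ∈ finCont B X S := by
  rw [continuous_point_iff]
  constructor
  · intro h a
    have h1 := mem_finCont_iff_continuous.2 (h 1 fun _ => a)
    exact comp_mem_finCont (LinearMap.proj (0 : Fin 1)) h1
  · intro h k a
    exact continuous_of_mem_finCont (pi_mem_finCont fun i => h (a i))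

theorem continuous_points_mul [HopfAlgebra B A] {v w : X → WithConv (A →ₐ[B] S)}
    (hv : Continuous v) (hw : Continuous w) : Continuous fun x => v x * w x := by
  rw [continuous_points_iff] at hv hw ⊢
  intro a
  let r := Coalgebra.Repr.arbitrary B a
  have : (fun x => (v x * w x).ofConv a) =
      ∑ i ∈ r.index, fun x => (v x).ofConv (r.left i) * (w x).ofConv (r.right i) := by
    funext x
    rw [Finset.sum_apply]
    exact conv_apply (v x) (w x) a r
  rw [this]
  exact Submodule.sum_mem _ fun i _ => mul_mem_finCont (hv _) (hw _)

theorem continuous_points_inv [HopfAlgebra B A] {v : X → WithConv (A →ₐ[B] S)}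
    (hv : Continuous v) : Continuous fun x => (v x)⁻¹ := by
  rw [continuous_points_iff] at hv ⊢
  exact fun a => hv (antipode B a)

end PointFamilies

/-! ### The action of `G` on continuous families of points. -/

section ActionFamilies
variable {G K B A R : Type u} [Group G] [TopologicalSpace G] [IsTopologicalGroup G]
  [CompactSpace G] [Field K] [Field B] [TopologicalSpace B] [IsTopologicalRing B] [T2Space B]
  [Algebra K B] [MulSemiringAction G B] [ContinuousSMul G B] [SMulCommClass G K B]
  [CommRing A] [HopfAlgebra B A] [MulSemiringAction G A] [EquivariantHopf G B A]
  [CommRing R] [Algebra K R]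

variable (G B A) in
/-- The orbit maps `g ↦ g • a` are continuous, with values in finite-dimensional subspaces. -/
def ContinuousOrbits : Prop := ∀ a : A, (fun g : G => g • a) ∈ finCont B G A

theorem HasContinuousAction.continuousOrbits (h : HasContinuousAction G B A) :
    ContinuousOrbits G B A := by
  intro a
  rw [mem_finCont_iff_continuous]
  let : TopologicalSpace A := indTopology B A
  have h' : Continuous fun p : G × A => p.1 • p.2 := h
  exact h'.comp (by fun_prop : Continuous fun g : G => (g, a))

theorem ContinuousOrbits.level (h : ContinuousOrbits G B A) (n : ℕ) :
    ContinuousOrbits G B (level B A n).toSubalgebra := fun a =>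
  mem_finCont_of_comp_injective (j := (UnipCoh.level B A n).toSubalgebra.val.toLinearMap)
    Subtype.val_injective (h a)

/-- On a term `φ(x) b ⊗ r` the action affects only the scalar: the result is `γ(x)(φ(x) b)` times
the fixed vector `1 ⊗ r`. -/
theorem coeffAct_mem_finCont {X : Type*} [TopologicalSpace X] {γ : X → G} (hγ : Continuous γ)
    {f : X → B ⊗[K] R} (hf : f ∈ finCont B X (B ⊗[K] R)) :
    (fun x => coeffAct G K B R (γ x) (f x)) ∈ finCont B X (B ⊗[K] R) := by
  obtain ⟨n, φ, v, hφ, rfl⟩ := exists_sum_of_mem_finCont hf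
  have h1 : (fun x => coeffAct G K B R (γ x) (∑ i, φ i x • v i)) =
      ∑ i, fun x => coeffAct G K B R (γ x) (φ i x • v i) := by
    funext x
    rw [map_sum, Finset.sum_apply]
  rw [h1]
  refine Submodule.sum_mem _ fun i _ => ?_
  generalize v i = t
  induction t with
  | zero => simpa using const_mem_finCont (0 : B ⊗[K] R)
  | add s t hs ht =>
    simp only [smul_add, map_add]
    exact add_mem hs ht
  | tmul b r =>
    have h2 : (fun x => coeffAct G K B R (γ x) (φ i x • b ⊗ₜ[K] r)) =
        fun x => (γ x • (φ i x * b)) • ((1 : B) ⊗ₜ[K] r) := by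
      funext x
      rw [TensorProduct.smul_tmul', TensorProduct.smul_tmul', smul_eq_mul, smul_eq_mul, mul_one]
      simp [coeffAct]
    rw [h2]
    exact smul_mem_finCont (hγ.smul ((hφ i).mul continuous_const)) _

/-- In `(g v)(a) = g (v (g⁻¹ a))` the element `g⁻¹ a` runs through a finite-dimensional space with
continuous coordinates, so `v` is evaluated only at finitely many fixed functions. -/
theorem continuous_points_smul {X : Type*} [TopologicalSpace X] [CompactSpace X]
    (hA : ContinuousOrbits G B A) {γ : X → G} (hγ : Continuous γ) {v : X → Points K B A R}
    (hv : Continuous v) : Continuous fun x => γ x • v x := by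
  rw [continuous_points_iff] at hv ⊢
  intro a
  refine coeffAct_mem_finCont hγ (f := fun x => (v x).ofConv ((γ x)⁻¹ • a)) ?_
  obtain ⟨n, φ, b, hφ, hb⟩ := exists_sum_of_mem_finCont
    (precomp_mem_finCont (p := fun x => (γ x)⁻¹) hγ.inv (hA a))
  have : (fun x => (v x).ofConv ((γ x)⁻¹ • a)) =
      ∑ i, fun x => φ i x • (v x).ofConv (b i) := by
    funext x
    rw [congrFun hb x, map_sum, Finset.sum_apply]
    exact Finset.sum_congr rfl fun i _ => map_smul _ _ _
  rw [this]
  exact Submodule.sum_mem _ fun i _ => mul_smul_mem_finCont (hφ i) (hv _)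

end ActionFamilies
end UnipCoh

namespace UnipCoh

/-! ### Linear coordinates on the graded pieces -/

section Coordinates
variable {B A : Type u} [Field B] [CommRing A] [HopfAlgebra B A] {n : ℕ} {ι : Type}
  {y : ι → (level B A (n + 1)).toSubalgebra} {S : Type u} [CommRing S] [Algebra B S]

/-- The coordinates of a point of `U^{n+1} / U^{n+2}`. -/
noncomputable def coord (y : ι → (level B A (n + 1)).toSubalgebra) (v : Graded B A n S) : ι → S :=
  fun i => v.1.ofConv (y i)

theorem coord_one (hy : IsLinearCoords (level_le_succ n) y) :
    coord y (1 : Graded B A n S) = 0 := by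
  funext i
  have h := hy.mul_apply S 1 1 (map_one _) (map_one _) i
  rw [one_mul, left_eq_add] at h
  exact h

theorem coord_mul (hy : IsLinearCoords (level_le_succ n) y) (v w : Graded B A n S) :
    coord y (v * w) = coord y v + coord y w :=
  funext fun i => hy.mul_apply S v.1 w.1 v.2 w.2 i

/-- The coordinates as a homomorphism. -/
noncomputable def coordHom (hy : IsLinearCoords (level_le_succ n) y) :
    Graded B A n S →* Multiplicative (ι → S) where
  toFun v := .ofAdd (coord y v)
  map_one' := coord_one hy
  map_mul' := coord_mul hy

theorem coord_inv (hy : IsLinearCoords (level_le_succ n) y) (v : Graded B A n S) :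
    coord y v⁻¹ = - coord y v :=
  map_inv (coordHom hy) v

theorem coord_zpow (hy : IsLinearCoords (level_le_succ n) y) (v : Graded B A n S) (k : ℤ) :
    coord y (v ^ k) = k • coord y v :=
  map_zpow (coordHom hy) v k

theorem coord_prod (hy : IsLinearCoords (level_le_succ n) y) {κ : Type*} (s : Finset κ)
    (v : κ → Graded B A n S) : coord y (∏ k ∈ s, v k) = ∑ k ∈ s, coord y (v k) :=
  map_prod (coordHom hy) v s

theorem coord_injective (hy : IsLinearCoords (level_le_succ n) y) :
    Function.Injective (coord (S := S) y) := fun v w h =>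
  Subtype.ext (hy.ext v.2 w.2 fun i => congrFun h i)

theorem coord_surjective (hy : IsLinearCoords (level_le_succ n) y) :
    Function.Surjective (coord (S := S) y) := fun s => by
  obtain ⟨v, ⟨hv, hvs⟩, _⟩ := hy.existsUnique S s
  exact ⟨⟨v, hv⟩, funext hvs⟩

/-- The point with given coordinates. -/
noncomputable def ofCoord (hy : IsLinearCoords (level_le_succ n) y) (s : ι → S) : Graded B A n S :=
  (coord_surjective hy s).choose

@[simp]
theorem coord_ofCoord (hy : IsLinearCoords (level_le_succ n) y) (s : ι → S) :
    coord y (ofCoord hy s) = s := (coord_surjective hy s).choose_spec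

/-- The universal point expresses the functions on `U_{n+1}` as polynomials on the kernel. -/
theorem exists_polynomial (hy : IsLinearCoords (level_le_succ n) y)
    (a : (level B A (n + 1)).toSubalgebra) :
    ∃ p : MvPolynomial ι B, ∀ (S : Type u) [CommRing S] [Algebra B S] (v : Graded B A n S),
      v.1.ofConv a = MvPolynomial.aeval (coord y v) p := by
  obtain ⟨V, ⟨hV, hVy⟩, _⟩ := hy.existsUnique (MvPolynomial ι B) MvPolynomial.X
  refine ⟨V.ofConv a, fun S _ _ v => ?_⟩
  have := hy.eq_compPoint (MvPolynomial.aeval (coord y v)) hV v.2 fun i => by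
    rw [hVy, MvPolynomial.aeval_X]; rfl
  exact DFunLike.congr_fun (congrArg WithConv.ofConv this) a

/-- All functions on the kernel are polynomials in the linear coordinates, and the
finite-dimensional continuous functions form a ring. -/
theorem continuous_graded_iff [TopologicalSpace B] [IsTopologicalRing B] [T2Space B]
    {X : Type*} [TopologicalSpace X] [CompactSpace X] (hy : IsLinearCoords (level_le_succ n) y)
    {v : X → Graded B A n S} :
    Continuous v ↔ ∀ i, (fun x => coord y (v x) i) ∈ finCont B X S := by
  have h0 : Continuous v ↔ Continuous fun x => (v x).1 := continuous_induced_rng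
  rw [h0, continuous_points_iff]
  refine ⟨fun h i => h (y i), fun h a => ?_⟩
  obtain ⟨p, hp⟩ := exists_polynomial hy a
  simp only [hp]
  clear hp
  induction p using MvPolynomial.induction_on with
  | C b => simpa using const_mem_finCont _
  | add p q hp hq => simp only [map_add]; exact add_mem hp hq
  | mul_X p i hp => simp only [map_mul, MvPolynomial.aeval_X]; exact mul_mem_finCont hp (h i)

end Coordinates

/-! ### The semilinear action of `G` on linear coordinates. -/

section LinearAction
variable {G K B A : Type u} [Group G] [Field K] [Field B] [Algebra K B] [MulSemiringAction G B]
  [SMulCommClass G K B] [CommRing A] [HopfAlgebra B A] [MulSemiringAction G A]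
  [EquivariantHopf G B A] {n : ℕ} {ι : Type} {y : ι → (level B A (n + 1)).toSubalgebra}
  {R R' : Type u} [CommRing R] [Algebra K R] [CommRing R'] [Algebra K R']

theorem smul_graded_apply (g : G) (v : Graded B A n (B ⊗[K] R))
    (a : (level B A (n + 1)).toSubalgebra) :
    (g • v).1.ofConv a = coeffAct G K B R g (v.1.ofConv (g⁻¹ • a)) := rfl

variable (K) in
/-- `G` acts on the coordinates by matrices: an additive polynomial is linear. -/
theorem exists_matrix [CharZero B] [Fintype ι] (hy : IsLinearCoords (level_le_succ n) y) (g : G)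
    (i : ι) :
    ∃ c : ι → B, ∀ (R : Type u) [CommRing R] [Algebra K R] (v : Graded B A n (B ⊗[K] R)),
      v.1.ofConv (g • y i) = ∑ j, c j • coord y v j := by
  obtain ⟨p, hp⟩ := exists_polynomial hy (g • y i)
  -- Test on the point with coordinates `X i` over `R = K[X]`, where `B ⊗ R = B[X]`. As `g⁻¹` acts
  -- by a group automorphism, the function `g • y i` doubles from `v` to `v * v`, that is, `p(2 X) =
  -- 2 p(X)`.
  have hlin : p.IsHomogeneous 1 := by
    apply isHomogeneous_one_of_aeval_two
    let e := MvPolynomial.algebraTensorAlgEquiv (σ := ι) K B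
    let x : ι → B ⊗[K] MvPolynomial ι K := fun i => 1 ⊗ₜ MvPolynomial.X i
    have hx : ∀ i, e (x i) = MvPolynomial.X i := fun i => by simp [e, x]
    obtain ⟨v, hv⟩ := coord_surjective hy x
    have h1 : (v * v).1.ofConv (g • y i) = 2 • v.1.ofConv (g • y i) := by
      have hw : ∀ w : Graded B A n (B ⊗[K] MvPolynomial ι K), coord y (g⁻¹ • w) i =
          coeffAct G K B _ g⁻¹ (w.1.ofConv (g • y i)) := fun w => by
        refine (smul_graded_apply g⁻¹ w (y i)).trans ?_
        rw [inv_inv]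
      have h2 := hw (v * v)
      rw [smul_mul', coord_mul hy, Pi.add_apply, hw, ← two_nsmul, ← map_nsmul] at h2
      have h3 := congrArg (coeffAct G K B _ g) h2
      rwa [← coeffAct_mul, ← coeffAct_mul, mul_inv_cancel, coeffAct_one, coeffAct_one,
        eq_comm] at h3
    rw [hp, hp, coord_mul hy, hv] at h1
    have h2 := congrArg e h1
    rw [map_nsmul, ← AlgEquiv.coe_toAlgHom, ← AlgHom.comp_apply, ← AlgHom.comp_apply,
      MvPolynomial.comp_aeval, MvPolynomial.comp_aeval] at h2
    simp only [Pi.add_apply, map_nsmul, AlgEquiv.coe_toAlgHom, ← two_nsmul, hx] at h2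
    rw [h2, MvPolynomial.aeval_X_left_apply]
  have hp' : p ∈ Submodule.span B (Set.range (MvPolynomial.X : ι → MvPolynomial ι B)) := by
    rw [← MvPolynomial.homogeneousSubmodule_one_eq_span_X]; exact hlin
  obtain ⟨c, hc⟩ := (Submodule.mem_span_range_iff_exists_fun B).1 hp'
  refine ⟨c, fun R _ _ v => ?_⟩
  rw [hp, ← hc, map_sum]
  simp

/-- The action of `g` in coordinates. -/
noncomputable def coordAct [Fintype ι] (c : G → ι → ι → B) (R : Type u) [CommRing R] [Algebra K R]
    (g : G) : (ι → B ⊗[K] R) →ₗ[K] (ι → B ⊗[K] R) where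
  toFun s i := coeffAct G K B R g (∑ j, c g⁻¹ i j • s j)
  map_add' s t := by
    funext i
    simp only [Pi.add_apply, smul_add, Finset.sum_add_distrib, map_add]
  map_smul' k s := by
    funext i
    simp only [Pi.smul_apply, RingHom.id_apply]
    rw [← map_smul, Finset.smul_sum]
    simp only [smul_comm k]

/-- The matrices `c` describe the action of `G` on the coordinates `y`. -/
def IsActionMatrix [Fintype ι] (K : Type u) [Field K] [Algebra K B] [SMulCommClass G K B]
    (y : ι → (level B A (n + 1)).toSubalgebra) (c : G → ι → ι → B) : Prop :=
  ∀ (g : G) (i : ι) (R : Type u) [CommRing R] [Algebra K R] (v : Graded B A n (B ⊗[K] R)),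
      v.1.ofConv (g • y i) = ∑ j, c g i j • coord y v j

theorem coord_smul [Fintype ι] {c : G → ι → ι → B} (hc : IsActionMatrix K y c) (g : G)
    (v : Graded B A n (B ⊗[K] R)) : coord y (g • v) = coordAct c R g (coord y v) := by
  funext i
  change (g • v).1.ofConv (y i) = _
  rw [smul_graded_apply, hc]
  rfl

/-- A `B`-linear map of coefficients that commutes with `G`. -/
def CommutesWithCoeffAct (G : Type u) [Group G] [MulSemiringAction G B] [SMulCommClass G K B]
    (T : B ⊗[K] R →ₗ[B] B ⊗[K] R') : Prop :=
  ∀ (g : G) (x : B ⊗[K] R), T (coeffAct G K B R g x) = coeffAct G K B R' g (T x)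

variable (G) in
theorem commutesWithCoeffAct_baseChange (l : R →ₗ[K] R') :
    CommutesWithCoeffAct G (l.baseChange B) := by
  intro g x
  induction x with
  | zero => simp
  | add x y hx hy => simp only [map_add, hx, hy]
  | tmul b r => simp [coeffAct]

-- With this, multiplication by elements of the fixed field `F` maps cocycles to cocycles.
variable (G) in
theorem commutesWithCoeffAct_smul {b : B} (hb : ∀ g : G, g • b = b) :
    CommutesWithCoeffAct G (b • LinearMap.id : B ⊗[K] R →ₗ[B] B ⊗[K] R) := by
  intro g x
  simp only [LinearMap.smul_apply, LinearMap.id_apply]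
  rw [Algebra.smul_def, Algebra.smul_def, map_mul, coeffAct_algebraMap, hb]

theorem coordAct_comp [Fintype ι] (c : G → ι → ι → B) {T : B ⊗[K] R →ₗ[B] B ⊗[K] R'}
    (hT : CommutesWithCoeffAct G T) (g : G) (s : ι → B ⊗[K] R) :
    coordAct c R' g (fun i => T (s i)) = fun i => T (coordAct c R g s i) := by
  funext i
  change coeffAct G K B R' g _ = T (coeffAct G K B R g _)
  rw [hT]
  simp only [map_sum, map_smul]

end LinearAction
end UnipCoh

namespace UnipCoh

/-! ### Cochains in coordinates -/

section Cochains
variable {G K B : Type u} [Group G] [TopologicalSpace G] [Field K] [Field B] [TopologicalSpace B]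
  [Algebra K B] [MulSemiringAction G B] [SMulCommClass G K B] {ι : Type} [Fintype ι]
  {R R' R'' : Type u} [CommRing R] [Algebra K R] [CommRing R'] [Algebra K R']
  [CommRing R''] [Algebra K R'']

/-- Cochains with values in `(B ⊗_K R)^ι`. -/
abbrev Cochain (G K B : Type u) [Field K] [Field B] [Algebra K B] (ι : Type) (R : Type u) [CommRing R]
    [Algebra K R] (j : ℕ) : Type u :=
  (Fin j → G) → ι → B ⊗[K] R

/-- The coboundary in coordinates. -/
noncomputable def dCochain (c : G → ι → ι → B) (R : Type u) [CommRing R] [Algebra K R] (j : ℕ) :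
    Cochain G K B ι R j →ₗ[K] Cochain G K B ι R (j + 1) where
  toFun f g := coordAct c R (g 0) (f fun i => g i.succ) +
    ∑ i : Fin (j + 1), ((-1 : ℤ) ^ ((i : ℕ) + 1)) • f (Fin.contractNth i (· * ·) g)
  map_add' f f' := by
    funext g
    simp only [Pi.add_apply, map_add, smul_add, Finset.sum_add_distrib]
    abel
  map_smul' k f := by
    funext g
    simp only [Pi.smul_apply, map_smul, RingHom.id_apply, smul_add, Finset.smul_sum]
    congr 1
    exact Finset.sum_congr rfl fun i _ => smul_comm _ _ _

/-- The effect of a coefficient map on cochains. -/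
def mapCochain (T : B ⊗[K] R →ₗ[B] B ⊗[K] R') (j : ℕ) :
    Cochain G K B ι R j →ₗ[K] Cochain G K B ι R' j where
  toFun f x i := T (f x i)
  map_add' f f' := by funext x i; exact map_add T _ _
  map_smul' k f := by
    funext x i
    exact map_smul (T.restrictScalars K) k (f x i)

theorem dCochain_mapCochain (c : G → ι → ι → B) {T : B ⊗[K] R →ₗ[B] B ⊗[K] R'}
    (hT : CommutesWithCoeffAct G T) {j : ℕ} (f : Cochain G K B ι R j) :
    dCochain c R' j (mapCochain T j f) = mapCochain T (j + 1) (dCochain c R j f) := by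
  funext g
  have h1 : ∀ s : ι → B ⊗[K] R, (fun i => T (s i)) = (T.compLeft ι) s := fun s => rfl
  change coordAct c R' (g 0) (fun i => T (f (fun i => g i.succ) i)) + ∑ i : Fin (j + 1),
    ((-1 : ℤ) ^ ((i : ℕ) + 1)) • (T.compLeft ι) (f (Fin.contractNth i (· * ·) g)) =
      (T.compLeft ι) _
  rw [coordAct_comp c hT, h1]
  change _ = (T.compLeft ι) (coordAct c R (g 0) (f fun i => g i.succ) +
    ∑ i : Fin (j + 1), ((-1 : ℤ) ^ ((i : ℕ) + 1)) • f (Fin.contractNth i (· * ·) g))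
  rw [map_add, map_sum]
  simp only [map_zsmul]

variable (G B ι R) in
/-- The continuous cochains. -/
def contCochain (j : ℕ) : Submodule K (Cochain G K B ι R j) where
  carrier := {f | ∀ i, (fun x => f x i) ∈ finCont B (Fin j → G) (B ⊗[K] R)}
  add_mem' hf hf' i := add_mem (hf i) (hf' i)
  zero_mem' i := zero_mem (finCont B (Fin j → G) (B ⊗[K] R))
  smul_mem' k f hf i := by
    have := (finCont B (Fin j → G) (B ⊗[K] R)).smul_mem (algebraMap K B k) (hf i)
    convert this using 1
    funext x
    exact (algebraMap_smul B k (f x i)).symm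

theorem mapCochain_mem (T : B ⊗[K] R →ₗ[B] B ⊗[K] R') {j : ℕ} {f : Cochain G K B ι R j}
    (hf : f ∈ contCochain G B ι R j) : mapCochain T j f ∈ contCochain G B ι R' j :=
  fun i => comp_mem_finCont T (hf i)

/-- Continuous cocycles. -/
noncomputable def contCocycle (c : G → ι → ι → B) (R : Type u) [CommRing R] [Algebra K R] (j : ℕ) :
    Submodule K (Cochain G K B ι R j) :=
  contCochain G B ι R j ⊓ LinearMap.ker (dCochain c R j)

/-- Coboundaries of continuous cochains. -/
noncomputable def contCoboundary (c : G → ι → ι → B) (R : Type u) [CommRing R] [Algebra K R] (j : ℕ) :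
    Submodule K (Cochain G K B ι R (j + 1)) :=
  (contCochain G B ι R j).map (dCochain c R j)

theorem mapCochain_mem_contCocycle (c : G → ι → ι → B) {T : B ⊗[K] R →ₗ[B] B ⊗[K] R'}
    (hT : CommutesWithCoeffAct G T) {j : ℕ} {f : Cochain G K B ι R j}
    (hf : f ∈ contCocycle c R j) : mapCochain T j f ∈ contCocycle c R' j := by
  refine ⟨mapCochain_mem T hf.1, ?_⟩
  change dCochain c R' j (mapCochain T j f) = 0
  rw [dCochain_mapCochain c hT, show dCochain c R j f = 0 from hf.2, map_zero]

theorem mapCochain_mem_contCoboundary (c : G → ι → ι → B) {T : B ⊗[K] R →ₗ[B] B ⊗[K] R'}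
    (hT : CommutesWithCoeffAct G T) {j : ℕ} {f : Cochain G K B ι R (j + 1)}
    (hf : f ∈ contCoboundary c R j) : mapCochain T (j + 1) f ∈ contCoboundary c R' j := by
  obtain ⟨b, hb, rfl⟩ := hf
  exact ⟨mapCochain T j b, mapCochain_mem T hb, dCochain_mapCochain c hT b⟩

/-- The effect of a `K`-linear map `R → R'` on cochains. -/
noncomputable abbrev linCochain (l : R →ₗ[K] R') (j : ℕ) :
    Cochain G K B ι R j →ₗ[K] Cochain G K B ι R' j :=
  mapCochain (l.baseChange B) j

theorem linCochain_comp (l' : R' →ₗ[K] R'') (l : R →ₗ[K] R') {j : ℕ} (f : Cochain G K B ι R j) :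
    linCochain l' j (linCochain l j f) = linCochain (l' ∘ₗ l) j f := by
  funext x i
  change (l'.baseChange B) ((l.baseChange B) (f x i)) = ((l' ∘ₗ l).baseChange B) (f x i)
  rw [LinearMap.baseChange_comp]; rfl

theorem linCochain_add (l l' : R →ₗ[K] R') {j : ℕ} (f : Cochain G K B ι R j) :
    linCochain (l + l') j f = linCochain l j f + linCochain l' j f := by
  funext x i
  change ((l + l').baseChange B) (f x i) = _
  rw [LinearMap.baseChange_add]; rfl

theorem linCochain_smul (k : K) (l : R →ₗ[K] R') {j : ℕ} (f : Cochain G K B ι R j) :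
    linCochain (k • l) j f = k • linCochain l j f := by
  funext x i
  change ((k • l).baseChange B) (f x i) = _
  rw [LinearMap.baseChange_smul]; rfl

theorem linCochain_sum {κ : Type*} (s : Finset κ) (l : κ → R →ₗ[K] R') {j : ℕ}
    (f : Cochain G K B ι R j) : linCochain (∑ a ∈ s, l a) j f = ∑ a ∈ s, linCochain (l a) j f := by
  classical
  induction s using Finset.induction_on with
  | empty =>
    funext x i
    change ((0 : R →ₗ[K] R').baseChange B) (f x i) = 0
    rw [LinearMap.baseChange_zero]; rfl
  | insert a s ha ih => rw [Finset.sum_insert ha, Finset.sum_insert ha, linCochain_add, ih]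

theorem linCochain_id {j : ℕ} (f : Cochain G K B ι R j) :
    linCochain (LinearMap.id : R →ₗ[K] R) j f = f := by
  funext x i
  change ((LinearMap.id : R →ₗ[K] R).baseChange B) (f x i) = f x i
  rw [LinearMap.baseChange_id]; rfl

/-- A continuous cochain with values in `(B ⊗_K R)^ι` involves finitely many elements of a `K`-basis
of `R`. -/
theorem exists_finset_expansion {κ : Type*} (ρ : Module.Basis κ K R) {j : ℕ}
    {f : Cochain G K B ι R j} (hf : f ∈ contCochain G B ι R j) :
    ∃ s : Finset κ, f = ∑ a ∈ s,
      linCochain (LinearMap.toSpanSingleton K R (ρ a)) j (linCochain (ρ.coord a) j f) := by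
  classical
  let P : κ → B ⊗[K] R →ₗ[B] B ⊗[K] R := fun a =>
    (LinearMap.toSpanSingleton K R (ρ a) ∘ₗ ρ.coord a).baseChange B
  -- The expansion is asked for every larger finite set, so that the finitely many tensors occurring
  -- in a cochain can share one set.
  have h1 : ∀ t : B ⊗[K] R, ∃ s : Finset κ, ∀ s', s ⊆ s' → t = ∑ a ∈ s', P a t := by
    intro t
    induction t with
    | zero => exact ⟨∅, fun s' _ => by simp⟩
    | add t t' ht ht' =>
      obtain ⟨s, hs⟩ := ht
      obtain ⟨s', hs'⟩ := ht'
      refine ⟨s ∪ s', fun s'' h => ?_⟩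
      simp only [map_add, Finset.sum_add_distrib]
      rw [← hs _ (Finset.union_subset_left h), ← hs' _ (Finset.union_subset_right h)]
    | tmul b r =>
      refine ⟨(ρ.repr r).support, fun s' h => ?_⟩
      have : r = ∑ a ∈ s', ρ.repr r a • ρ a := by
        conv_lhs => rw [← ρ.linearCombination_repr r, Finsupp.linearCombination_apply]
        exact Finsupp.sum_of_support_subset _ h _ fun _ _ => by simp
      conv_lhs => rw [this, TensorProduct.tmul_sum]
      rfl
  have h2 : ∀ F ∈ finCont B (Fin j → G) (B ⊗[K] R),
      ∃ s : Finset κ, ∀ s', s ⊆ s' → ∀ x, F x = ∑ a ∈ s', P a (F x) := by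
    intro F hF
    obtain ⟨n, φ, v, _, rfl⟩ := exists_sum_of_mem_finCont hF
    choose s hs using fun i => h1 (v i)
    refine ⟨Finset.univ.biUnion s, fun s' h x => ?_⟩
    simp only [map_sum, map_smul]
    rw [Finset.sum_comm]
    refine Finset.sum_congr rfl fun i _ => ?_
    rw [← Finset.smul_sum, ← hs i s' ((Finset.subset_biUnion_of_mem s (Finset.mem_univ i)).trans h)]
  choose s hs using fun i => h2 _ (hf i)
  refine ⟨Finset.univ.biUnion s, ?_⟩
  simp only [linCochain_comp]
  funext x i
  rw [Finset.sum_apply, Finset.sum_apply]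
  exact hs i _ (Finset.subset_biUnion_of_mem s (Finset.mem_univ i)) x

/-- If the cohomology over `K` is finite-dimensional, a basis of it is a basis of the cohomology with
coefficients in every `K`-algebra `R`. -/
theorem exists_cohomology_basis (c : G → ι → ι → B) (j : ℕ)
    (hfin : ∃ s : Set (Cochain G K B ι K (j + 1)), s.Finite ∧ (∀ f ∈ s, f ∈ contCocycle c K (j + 1)) ∧
      contCocycle c K (j + 1) ≤ Submodule.span K s ⊔ contCoboundary c K j) :
    ∃ (d : ℕ) (h : Fin d → Cochain G K B ι K (j + 1)), (∀ k, h k ∈ contCocycle c K (j + 1)) ∧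
      ∀ (R : Type u) [CommRing R] [Algebra K R], ∀ f ∈ contCocycle c R (j + 1),
        ∃! s : Fin d → R, f - ∑ k, linCochain (LinearMap.toSpanSingleton K R (s k)) (j + 1) (h k) ∈
          contCoboundary c R j := by
  classical
  obtain ⟨s, hs, hsZ, hZ⟩ := hfin
  -- `H` is the cohomology over `K`, of finite dimension by `hfin`; the cocycles `h` below represent
  -- a basis of it.
  let π := (contCoboundary (K := K) c K j).mkQ
  let H := (contCocycle (K := K) c K (j + 1)).map π
  have hH : H = Submodule.span K (π '' s) := by
    apply le_antisymm
    · rintro _ ⟨f, hf, rfl⟩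
      obtain ⟨a, ha, b, hb, rfl⟩ := Submodule.mem_sup.1 (hZ hf)
      have : π b = 0 := (Submodule.Quotient.mk_eq_zero _).2 hb
      rw [map_add, this, add_zero, ← Submodule.map_span]
      exact Submodule.mem_map_of_mem ha
    · rw [← Submodule.map_span]
      exact Submodule.map_mono (Submodule.span_le.2 hsZ)
  have : FiniteDimensional K H := by
    rw [hH]
    exact FiniteDimensional.span_of_finite K (hs.image _)
  let b := Module.finBasis K H
  choose h hhZ hh using fun k => (b k).2
  have hπ : ∀ f, π f = 0 ↔ f ∈ contCoboundary c K j := fun f => Submodule.Quotient.mk_eq_zero _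
  have hexK : ∀ f ∈ contCocycle c K (j + 1), ∃ α : Fin (Module.finrank K H) → K,
      f - ∑ k, α k • h k ∈ contCoboundary c K j := by
    intro f hf
    refine ⟨b.repr ⟨π f, f, hf, rfl⟩, ?_⟩
    rw [← hπ, map_sub, map_sum, sub_eq_zero]
    have := congrArg Subtype.val (b.sum_repr ⟨π f, f, hf, rfl⟩)
    rw [Submodule.coe_sum] at this
    refine this.symm.trans (Finset.sum_congr rfl fun k _ => ?_)
    rw [map_smul, hh]; rfl
  have huniqK : ∀ α : Fin (Module.finrank K H) → K, ∑ k, α k • h k ∈ contCoboundary c K j →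
      ∀ k, α k = 0 := by
    intro α hα
    rw [← hπ, map_sum] at hα
    refine Fintype.linearIndependent_iff.1 b.linearIndependent α (Subtype.ext ?_)
    rw [Submodule.coe_sum]
    refine Eq.trans (Finset.sum_congr rfl fun k _ => ?_) hα
    rw [map_smul, hh]; rfl
  refine ⟨_, h, hhZ, fun R _ _ f hf => ?_⟩
  let ρ := Module.Basis.ofVectorSpace K R
  refine existsUnique_of_exists_of_unique ?_ ?_
  -- Existence: base changes of `K`-linear maps commute with `G`, so the coordinates of `f` along
  -- `ρ` are cocycles over `K`. Each of them is reduced over `K`, and the results are reassembled.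
  · obtain ⟨t, ht⟩ := exists_finset_expansion ρ hf.1
    choose α hα using fun a => hexK (linCochain (ρ.coord a) (j + 1) f)
      (mapCochain_mem_contCocycle c (commutesWithCoeffAct_baseChange G _) hf)
    refine ⟨fun k => ∑ a ∈ t, α a k • ρ a, ?_⟩
    have h1 : ∀ k, linCochain (LinearMap.toSpanSingleton K R (∑ a ∈ t, α a k • ρ a)) (j + 1) (h k) =
        ∑ a ∈ t, linCochain (LinearMap.toSpanSingleton K R (ρ a)) (j + 1) (α a k • h k) := by
      intro k
      have : LinearMap.toSpanSingleton K R (∑ a ∈ t, α a k • ρ a) =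
          ∑ a ∈ t, α a k • LinearMap.toSpanSingleton K R (ρ a) := by
        ext; simp
      rw [this, linCochain_sum]
      exact Finset.sum_congr rfl fun a _ => by rw [linCochain_smul, map_smul]
    have h2 : f - ∑ k, linCochain (LinearMap.toSpanSingleton K R (∑ a ∈ t, α a k • ρ a)) (j + 1)
        (h k) = ∑ a ∈ t, linCochain (LinearMap.toSpanSingleton K R (ρ a)) (j + 1)
          (linCochain (ρ.coord a) (j + 1) f - ∑ k, α a k • h k) := by
      conv_lhs => rw [ht]
      simp only [h1]
      rw [Finset.sum_comm, ← Finset.sum_sub_distrib]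
      exact Finset.sum_congr rfl fun a _ => by rw [map_sub, map_sum]
    rw [h2]
    exact Submodule.sum_mem _ fun a _ => mapCochain_mem_contCoboundary c
      (commutesWithCoeffAct_baseChange G _) (hα a)
  -- Uniqueness: a coordinate functional of `ρ` turns a relation over `R` into one over `K`.
  · intro s₁ s₂ hs₁ hs₂
    have h1 := sub_mem hs₂ hs₁
    rw [sub_sub_sub_cancel_left, ← Finset.sum_sub_distrib] at h1
    funext k
    apply ρ.repr.injective
    ext a
    rw [← sub_eq_zero]
    have h2 := mapCochain_mem_contCoboundary c (commutesWithCoeffAct_baseChange G (ρ.coord a)) h1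
    refine huniqK (fun k => ρ.repr (s₁ k) a - ρ.repr (s₂ k) a) ?_ k
    convert h2 using 1
    rw [map_sum]
    refine Finset.sum_congr rfl fun k _ => ?_
    have h3 : ∀ r : R, linCochain (ρ.coord a) (j + 1)
        (linCochain (LinearMap.toSpanSingleton K R r) (j + 1) (h k)) = ρ.repr r a • h k := by
      intro r
      rw [linCochain_comp]
      have : ρ.coord a ∘ₗ LinearMap.toSpanSingleton K R r = ρ.repr r a • LinearMap.id := by
        ext; simp
      rw [this, linCochain_smul, linCochain_id]
    rw [map_sub, h3, h3, sub_smul]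

end Cochains
end UnipCoh

namespace UnipCoh

/-! ### Cohomology of the graded pieces -/

section Coboundary
variable {G M : Type u} [Group G] [CommGroup M] [MulDistribMulAction G M]

theorem coboundary_zero_apply (b : (Fin 0 → G) → M) (g : Fin 1 → G) :
    coboundary 0 b g = g 0 • b Fin.elim0 * (b Fin.elim0)⁻¹ := by
  have h : ∀ x : Fin 0 → G, b x = b Fin.elim0 := fun x => congrArg b (Subsingleton.elim _ _)
  simp [coboundary, h]

theorem coboundary_one_apply (f : G → M) (g : Fin 2 → G) :
    coboundary 1 (fun x => f (x 0)) g = g 0 • f (g 1) * (f (g 0 * g 1))⁻¹ * f (g 0) := by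
  simp [coboundary, Fin.prod_univ_two, Fin.contractNth, mul_assoc]

theorem coboundary_two_apply (f : (Fin 2 → G) → M) (g : Fin 3 → G) :
    coboundary 2 f g = g 0 • f ![g 1, g 2] * (f ![g 0 * g 1, g 2])⁻¹ * f ![g 0, g 1 * g 2] *
      (f ![g 0, g 1])⁻¹ := by
  have h0 : (fun i : Fin 2 => g i.succ) = ![g 1, g 2] := by
    funext i; fin_cases i <;> rfl
  have h1 : Fin.contractNth (0 : Fin 3) (· * ·) g = ![g 0 * g 1, g 2] := by
    funext i; fin_cases i <;> simp [Fin.contractNth]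
  have h2 : Fin.contractNth (1 : Fin 3) (· * ·) g = ![g 0, g 1 * g 2] := by
    funext i; fin_cases i <;> simp [Fin.contractNth]
  have h3 : Fin.contractNth (2 : Fin 3) (· * ·) g = ![g 0, g 1] := by
    funext i; fin_cases i <;> simp [Fin.contractNth]
  simp [coboundary, Fin.prod_univ_three, h0, h1, h2, h3, mul_assoc]

end Coboundary

section GradedCohomology
variable {G K B A : Type u} [Group G] [TopologicalSpace G] [CompactSpace G]
  [Field K] [Field B] [TopologicalSpace B] [IsTopologicalRing B] [T2Space B]
  [Algebra K B] [MulSemiringAction G B] [SMulCommClass G K B] [CommRing A] [HopfAlgebra B A]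
  [MulSemiringAction G A] [EquivariantHopf G B A] {n : ℕ} {ι : Type} [Fintype ι]
  {y : ι → (level B A (n + 1)).toSubalgebra} {c : G → ι → ι → B}
  {R R' : Type u} [CommRing R] [Algebra K R] [CommRing R'] [Algebra K R']

theorem coord_coboundary (hy : IsLinearCoords (level_le_succ n) y) (hc : IsActionMatrix K y c)
    (j : ℕ) (f : (Fin j → G) → Graded B A n (B ⊗[K] R)) (g : Fin (j + 1) → G) :
    coord y (coboundary j f g) = dCochain c R j (fun x => coord y (f x)) g := by
  rw [coboundary, coord_mul hy, coord_smul hc, coord_prod hy]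
  simp only [coord_zpow hy]
  rfl

theorem continuous_iff_mem_contCochain (hy : IsLinearCoords (level_le_succ n) y) {j : ℕ}
    {f : (Fin j → G) → Graded B A n (B ⊗[K] R)} :
    Continuous f ↔ (fun x => coord y (f x)) ∈ contCochain G B ι R j :=
  continuous_graded_iff hy

theorem coord_mem_contCocycle (hy : IsLinearCoords (level_le_succ n) y)
    (hc : IsActionMatrix K y c) {j : ℕ} (z : NCocycle G (Graded B A n (B ⊗[K] R)) j) :
    (fun x => coord y (z.toFun x)) ∈ contCocycle c R j := by
  refine ⟨(continuous_iff_mem_contCochain hy).1 z.continuous_toFun, ?_⟩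
  refine LinearMap.mem_ker.2 (funext fun g => ?_)
  rw [← coord_coboundary hy hc, z.coboundary_eq_one, coord_one hy]; rfl

/-- The cocycle with given coordinates. -/
noncomputable def cocycleOfCoord (hy : IsLinearCoords (level_le_succ n) y)
    (hc : IsActionMatrix K y c) {j : ℕ} {f : Cochain G K B ι R j} (hf : f ∈ contCocycle c R j) :
    NCocycle G (Graded B A n (B ⊗[K] R)) j where
  toFun x := ofCoord hy (f x)
  continuous_toFun := by
    rw [continuous_iff_mem_contCochain hy]
    simpa using hf.1
  coboundary_eq_one g := by
    apply coord_injective hy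
    rw [coord_coboundary hy hc, coord_one hy]
    simp only [coord_ofCoord]
    exact congrFun (LinearMap.mem_ker.1 hf.2) g

theorem isCoboundary_iff (hy : IsLinearCoords (level_le_succ n) y) (hc : IsActionMatrix K y c)
    {j : ℕ} {w : (Fin (j + 1) → G) → Graded B A n (B ⊗[K] R)} :
    IsCoboundary (j + 1) w ↔ (fun x => coord y (w x)) ∈ contCoboundary c R j := by
  constructor
  · rintro ⟨b, hb, rfl⟩
    exact ⟨fun x => coord y (b x), (continuous_iff_mem_contCochain hy).1 hb,
      funext fun g => (coord_coboundary hy hc j b g).symm⟩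
  · rintro ⟨b, hb, hbw⟩
    refine ⟨fun x => ofCoord hy (b x), ?_, funext fun g => ?_⟩
    · rw [continuous_iff_mem_contCochain hy]
      simpa using hb
    · apply coord_injective hy
      rw [coord_coboundary hy hc]
      simp only [coord_ofCoord]
      exact (congrFun hbw g).symm

/-- Coboundaries form a subgroup, so the relation by which cocycles are identified is already an
equivalence relation. -/
theorem HN_mk_eq_iff (hy : IsLinearCoords (level_le_succ n) y) (hc : IsActionMatrix K y c)
    {j : ℕ} {z z' : NCocycle G (Graded B A n (B ⊗[K] R)) (j + 1)} :
    HN.mk z = HN.mk z' ↔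
      (fun x => coord y (z'.toFun x)) - (fun x => coord y (z.toFun x)) ∈ contCoboundary c R j := by
  have hrel : ∀ z z' : NCocycle G (Graded B A n (B ⊗[K] R)) (j + 1),
      (∃ w, IsCoboundary (j + 1) w ∧ z'.toFun = z.toFun * w) ↔
      (fun x => coord y (z'.toFun x)) - (fun x => coord y (z.toFun x)) ∈ contCoboundary c R j := by
    intro z z'
    constructor
    · rintro ⟨w, hw, h⟩
      convert (isCoboundary_iff hy hc).1 hw using 1
      funext x
      rw [h]
      change coord y (z.toFun x * w x) - coord y (z.toFun x) = _
      rw [coord_mul hy, add_sub_cancel_left]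
    · intro h
      refine ⟨z.toFun⁻¹ * z'.toFun, ?_, by rw [mul_inv_cancel_left]⟩
      rw [isCoboundary_iff hy hc]
      convert h using 1
      funext x
      change coord y ((z.toFun x)⁻¹ * z'.toFun x) = _
      rw [coord_mul hy, coord_inv hy, neg_add_eq_sub]; rfl
  constructor
  · intro h
    have h' := Quot.eqvGen_exact h
    clear h
    induction h' with
    | rel z z' h => exact (hrel z z').1 h
    | refl z => rw [sub_self]; exact zero_mem _
    | symm z z' _ ih => rw [← neg_sub]; exact neg_mem ih
    | trans z z' z'' _ _ ih ih' => rw [← sub_add_sub_cancel _ (fun x => coord y (z'.toFun x))]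
                                   exact add_mem ih' ih
  · exact fun h => Quot.sound ((hrel z z').2 h)

theorem isAdditiveCharacter_of_isLinearCoords (hy : IsLinearCoords (level_le_succ n) y) (i : ι) :
    IsAdditiveCharacter n (y i) := fun S _ _ v w => hy.mul_apply S v.1 w.1 v.2 w.2 i

/-- A spanning family over `F` multiplied by a `K`-basis of `F` spans over `K`; the products are
cocycles because `G` fixes `F`. -/
theorem exists_finite_span_of_finiteDimensionalCohomology
    [FiniteDimensional K (FixedPoints.intermediateField (F := K) (E := B) G)]
    (hy : IsLinearCoords (level_le_succ n) y) (hc : IsActionMatrix K y c) (j : ℕ)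
    (hfin : FiniteDimensionalCohomology G K B A (j + 1) n) :
    ∃ s : Set (Cochain G K B ι K (j + 1)), s.Finite ∧ (∀ f ∈ s, f ∈ contCocycle c K (j + 1)) ∧
      contCocycle c K (j + 1) ≤ Submodule.span K s ⊔ contCoboundary c K j := by
  obtain ⟨d, z, hz⟩ := hfin
  let F := FixedPoints.intermediateField (F := K) (E := B) G
  let β := Module.finBasis K F
  have hF : ∀ (r : F) (g : G), g • (r : B) = r := fun r g => r.2 g
  let T : F → B ⊗[K] K →ₗ[B] B ⊗[K] K := fun r => (r : B) • LinearMap.id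
  have hT : ∀ r, CommutesWithCoeffAct G (T r) := fun r => commutesWithCoeffAct_smul G (hF r)
  let f : Fin d → Cochain G K B ι K (j + 1) := fun k x => coord y ((z k).toFun x)
  let p : Fin d × Fin (Module.finrank K F) → Cochain G K B ι K (j + 1) := fun a =>
    mapCochain (T (β a.2)) (j + 1) (f a.1)
  refine ⟨Set.range p, Set.finite_range p, ?_, ?_⟩
  · rintro _ ⟨a, rfl⟩
    exact mapCochain_mem_contCocycle c (hT _) (coord_mem_contCocycle hy hc _)
  · intro x hx
    obtain ⟨r, t, w, ht, hw, hxw⟩ := hz (cocycleOfCoord hy hc hx)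
    have h1 : x = ∑ k, mapCochain (T (r k)) (j + 1) (f k) + fun g => coord y (w g) := by
      funext g
      have h2 := congrArg (coord y) (congrFun hxw g)
      change coord y (ofCoord hy (x g)) = coord y ((∏ k, t k) g * w g) at h2
      rw [coord_ofCoord, coord_mul hy, Finset.prod_apply, coord_prod hy] at h2
      rw [h2, Pi.add_apply, Finset.sum_apply]
      congr 1
      refine Finset.sum_congr rfl fun k _ => funext fun i => ?_
      exact ht k g (y i) (isAdditiveCharacter_of_isLinearCoords hy i)
    rw [h1]
    refine Submodule.add_mem_sup (Submodule.sum_mem _ fun k _ => ?_)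
      ((isCoboundary_iff hy hc).1 hw)
    have h3 : mapCochain (T (r k)) (j + 1) (f k) = ∑ l, β.repr (r k) l • p (k, l) := by
      have h4 : ((r k : F) : B) = ∑ l, β.repr (r k) l • ((β l : F) : B) := by
        conv_lhs => rw [← β.sum_repr (r k)]
        rw [AddSubmonoidClass.coe_finsetSum]; rfl
      funext g i
      rw [Finset.sum_apply, Finset.sum_apply]
      change ((r k : F) : B) • f k g i = ∑ l, β.repr (r k) l • (((β l : F) : B) • f k g i)
      rw [h4, Finset.sum_smul]
      exact Finset.sum_congr rfl fun l _ => smul_assoc _ _ _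
    rw [h3]
    exact Submodule.sum_mem _ fun l _ => Submodule.smul_mem _ _ (Submodule.subset_span ⟨_, rfl⟩)

theorem eq_zero_of_coord_baseChange {κ : Type*} (ρ : Module.Basis κ K R) {t : B ⊗[K] R}
    (h : ∀ a, (ρ.coord a).baseChange B t = 0) : t = 0 := by
  classical
  apply (Algebra.TensorProduct.basis B ρ).repr.injective
  rw [map_zero]
  ext a
  rw [Finsupp.coe_zero, Pi.zero_apply]
  have h1 : ∀ t : B ⊗[K] R, TensorProduct.rid K B ((ρ.coord a).baseChange B t) =
      (Algebra.TensorProduct.basis B ρ).repr t a := by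
    intro t
    induction t with
    | zero => simp
    | add x y hx hy => simp only [map_add, Finsupp.coe_add, Pi.add_apply, hx, hy]
    | tmul b r => simp [Algebra.TensorProduct.basis_repr_tmul, Algebra.smul_def, mul_comm]
  rw [← h1, h, map_zero]

/-- If `H⁰` is trivial over `K`, it is trivial over every `R`. -/
theorem graded_eq_one_of_fixed (hy : IsLinearCoords (level_le_succ n) y)
    (hc : IsActionMatrix K y c)
    (hH0 : ∀ v : Graded B A n (B ⊗[K] K), (∀ g : G, g • v = v) → v = 1)
    {v : Graded B A n (B ⊗[K] R)} (hv : ∀ g : G, g • v = v) : v = 1 := by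
  let ρ := Module.Basis.ofVectorSpace K R
  apply coord_injective hy
  rw [coord_one hy]
  funext i
  refine eq_zero_of_coord_baseChange ρ fun a => ?_
  -- Each coordinate of a fixed point along the basis `ρ` of `R` is a fixed point over `K`.
  have h1 : ofCoord hy (fun i => (ρ.coord a).baseChange B (coord y v i)) = 1 := by
    refine hH0 _ fun g => ?_
    apply coord_injective hy
    rw [coord_smul hc, coord_ofCoord,
      coordAct_comp c (commutesWithCoeffAct_baseChange G (ρ.coord a)), ← coord_smul hc, hv]
  have h2 := congrArg (coord y) h1
  rw [coord_ofCoord, coord_one hy] at h2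
  exact congrFun h2 i

theorem coord_gradedMap (φ : R →ₐ[K] R') (v : Graded B A n (B ⊗[K] R)) :
    coord y (gradedMap n φ v) = fun i => φ.toLinearMap.baseChange B (coord y v i) := by
  funext i
  change Algebra.TensorProduct.map (AlgHom.id B B) φ (v.1.ofConv (y i)) = _
  change _ = φ.toLinearMap.baseChange B (v.1.ofConv (y i))
  generalize v.1.ofConv (y i) = t
  induction t with
  | zero => simp
  | add x y hx hy => simp only [map_add, hx, hy]
  | tmul b r => simp

theorem linCochain_toSpanSingleton (φ : R →ₐ[K] R') {j : ℕ} (r : R) (f : Cochain G K B ι K j) :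
    linCochain φ.toLinearMap j (linCochain (LinearMap.toSpanSingleton K R r) j f) =
      linCochain (LinearMap.toSpanSingleton K R' (φ r)) j f := by
  rw [linCochain_comp]
  congr 1
  congr 1
  ext
  simp

theorem HN_mk_eq_one_iff (hy : IsLinearCoords (level_le_succ n) y) (hc : IsActionMatrix K y c)
    {j : ℕ} (z : NCocycle G (Graded B A n (B ⊗[K] R)) (j + 1)) :
    HN.mk z = HN.mk (NCocycle.one (j + 1)) ↔
      (fun x => coord y (z.toFun x)) ∈ contCoboundary c R j := by
  rw [HN_mk_eq_iff hy hc]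
  have h3 : (fun x => coord y ((NCocycle.one (G := G) (M := Graded B A n (B ⊗[K] R))
      (j + 1)).toFun x)) = 0 := funext fun x => coord_one hy
  rw [h3, zero_sub, neg_mem_iff]

theorem hGradedMap_mk_eq_one_iff (hy : IsLinearCoords (level_le_succ n) y)
    (hc : IsActionMatrix K y c) {j : ℕ} (z : NCocycle G (Graded B A n (B ⊗[K] R)) (j + 1))
    (φ : R →ₐ[K] R') :
    hGradedMap G n (j + 1) φ (HN.mk z) = HN.mk (NCocycle.one (j + 1)) ↔
      linCochain φ.toLinearMap (j + 1) (fun x => coord y (z.toFun x)) ∈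
        contCoboundary c R' j := by
  let z' : NCocycle G (Graded B A n (B ⊗[K] R')) (j + 1) :=
    NCocycle.map (G := G) (M := Graded B A n (B ⊗[K] R)) (N := Graded B A n (B ⊗[K] R'))
      (gradedMap n φ) (continuous_gradedMap n φ) (gradedMap_smul n φ) z
  have h1 : hGradedMap G n (j + 1) φ (HN.mk z) = HN.mk z' := rfl
  have h4 : (fun x => coord y (z'.toFun x)) =
      linCochain φ.toLinearMap (j + 1) (fun x => coord y (z.toFun x)) :=
    funext fun x => coord_gradedMap φ _
  rw [h1, HN_mk_eq_one_iff hy hc, h4]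

/-- The vanishing of a class in the cohomology of a graded piece is a closed condition. -/
theorem exists_ideal_of_class
    (hy : IsLinearCoords (level_le_succ n) y) (hc : IsActionMatrix K y c) (j : ℕ)
    (hfin : ∃ s : Set (Cochain G K B ι K (j + 1)), s.Finite ∧
      (∀ f ∈ s, f ∈ contCocycle c K (j + 1)) ∧
      contCocycle c K (j + 1) ≤ Submodule.span K s ⊔ contCoboundary c K j)
    (x : HN G (Graded B A n (B ⊗[K] R)) (j + 1)) :
    ∃ I : Ideal R, ∀ (R' : Type u) [CommRing R'] [Algebra K R'] (φ : R →ₐ[K] R'),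
      hGradedMap G n (j + 1) φ x = HN.mk (NCocycle.one (j + 1)) ↔ ∀ a ∈ I, φ a = 0 := by
  obtain ⟨d, h, hh, hb⟩ := exists_cohomology_basis c j hfin
  induction x using Quot.ind with | _ z => ?_
  obtain ⟨s, hs, _⟩ := hb R _ (coord_mem_contCocycle hy hc z)
  -- Here `s` is the coordinate vector of the class in the basis over `K`. Its image under `φ` is
  -- the coordinate vector after base change, so by uniqueness the class dies over `R'` exactly when
  -- `φ` kills all `s k`.
  refine ⟨Ideal.span (Set.range s), fun R' _ _ φ => ?_⟩
  set f : Cochain G K B ι R' (j + 1) :=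
    linCochain φ.toLinearMap (j + 1) (fun x => coord y (z.toFun x)) with hf
  have hfZ : f ∈ contCocycle c R' (j + 1) := mapCochain_mem_contCocycle c
    (commutesWithCoeffAct_baseChange G _) (coord_mem_contCocycle hy hc z)
  have h1 : f - ∑ k, linCochain (LinearMap.toSpanSingleton K R' (φ (s k))) (j + 1) (h k) ∈
      contCoboundary c R' j := by
    have := mapCochain_mem_contCoboundary c (commutesWithCoeffAct_baseChange G φ.toLinearMap) hs
    rw [map_sub, map_sum] at this
    simpa only [linCochain_toSpanSingleton] using this
  have h2 : hGradedMap G n (j + 1) φ (Quot.mk _ z) = HN.mk (NCocycle.one (j + 1)) ↔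
      f ∈ contCoboundary c R' j := by
    exact hGradedMap_mk_eq_one_iff hy hc z φ
  have hzero : ∀ k, linCochain (LinearMap.toSpanSingleton K R' ((0 : Fin d → R') k)) (j + 1) (h k) =
      0 := by
    intro k
    have : LinearMap.toSpanSingleton K R' ((0 : Fin d → R') k) = (0 : K) • 0 := by ext; simp
    rw [this, linCochain_smul, zero_smul]
  rw [h2]
  constructor
  · intro h3
    have h4 : (fun k => φ (s k)) = 0 := by
      refine (hb R' f hfZ).unique h1 ?_
      simp only [hzero, Finset.sum_const_zero, sub_zero]
      exact h3
    have h5 : Ideal.span (Set.range s) ≤ RingHom.ker φ.toRingHom := by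
      rw [Ideal.span_le]
      rintro _ ⟨k, rfl⟩
      exact congrFun h4 k
    exact fun a ha => h5 ha
  · intro h3
    have h4 : ∀ k, φ (s k) = (0 : Fin d → R') k := fun k =>
      h3 _ (Ideal.subset_span ⟨k, rfl⟩)
    simp only [h4, hzero, Finset.sum_const_zero, sub_zero] at h1
    exact h1

end GradedCohomology
end UnipCoh

namespace UnipCoh

/-! ### Representability of the first cohomology of the graded pieces -/

section GradedH1
variable {G K B A : Type u} [Group G] [TopologicalSpace G] [CompactSpace G]
  [Field K] [Field B] [TopologicalSpace B] [IsTopologicalRing B] [T2Space B]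
  [Algebra K B] [MulSemiringAction G B] [SMulCommClass G K B] [CommRing A] [HopfAlgebra B A]
  [MulSemiringAction G A] [EquivariantHopf G B A] {n : ℕ} {ι : Type} [Fintype ι]
  {y : ι → (level B A (n + 1)).toSubalgebra} {c : G → ι → ι → B}
  {R R' : Type u} [CommRing R] [Algebra K R] [CommRing R'] [Algebra K R']

/-- The coordinates of a cocycle with values in a graded piece. -/
noncomputable def coordCocycle (y : ι → (level B A (n + 1)).toSubalgebra)
    (z : Cocycle G (Graded B A n (B ⊗[K] R))) : Cochain G K B ι R 1 :=
  fun x => coord y (z.toFun (x 0))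

theorem coordCocycle_mem (hy : IsLinearCoords (level_le_succ n) y) (hc : IsActionMatrix K y c)
    (z : Cocycle G (Graded B A n (B ⊗[K] R))) : coordCocycle y z ∈ contCocycle c R 1 := by
  constructor
  · exact (continuous_iff_mem_contCochain hy).1 (z.continuous_toFun.comp (continuous_apply 0))
  · refine LinearMap.mem_ker.2 (funext fun g => ?_)
    refine (coord_coboundary hy hc 1 (fun x => z.toFun (x 0)) g).symm.trans ?_
    rw [coboundary_one_apply, z.map_mul, mul_inv_rev, mul_inv_cancel_left, inv_mul_cancel,
      coord_one hy]
    rfl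

/-- The cocycle with given coordinates. -/
noncomputable def cocycleOne (hy : IsLinearCoords (level_le_succ n) y)
    (hc : IsActionMatrix K y c) {f : Cochain G K B ι R 1} (hf : f ∈ contCocycle c R 1) :
    Cocycle G (Graded B A n (B ⊗[K] R)) where
  toFun g := ofCoord hy (f fun _ => g)
  continuous_toFun := (cocycleOfCoord hy hc hf).continuous_toFun.comp
    (continuous_pi fun _ => continuous_id)
  map_mul g h := by
    have h1 := (cocycleOfCoord hy hc hf).coboundary_eq_one ![g, h]
    have h2 : (cocycleOfCoord hy hc hf).toFun = fun x => ofCoord hy (f fun _ => x 0) := by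
      funext x
      refine congrArg (fun t => ofCoord hy (f t)) (funext fun i => ?_)
      rw [Subsingleton.elim i 0]
    rw [h2, coboundary_one_apply (fun g => ofCoord hy (f fun _ => g))] at h1
    simp only [Matrix.cons_val_zero, Matrix.cons_val_one] at h1
    rw [mul_right_comm, mul_inv_eq_one, mul_comm] at h1
    exact h1.symm

theorem coordCocycle_cocycleOne (hy : IsLinearCoords (level_le_succ n) y)
    (hc : IsActionMatrix K y c) {f : Cochain G K B ι R 1} (hf : f ∈ contCocycle c R 1) :
    coordCocycle y (cocycleOne hy hc hf) = f := by
  funext x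
  refine (coord_ofCoord hy _).trans (congrArg f (funext fun i => ?_))
  rw [Subsingleton.elim i 0]

/-- In coordinates `u z(g) g(u⁻¹)` is `z(g) - (g u - u)`. So the non-abelian relation, specialized
to a commutative group, is congruence modulo coboundaries of `0`-cochains. -/
theorem H1_mk_eq_iff_coord (hy : IsLinearCoords (level_le_succ n) y) (hc : IsActionMatrix K y c)
    (z z' : Cocycle G (Graded B A n (B ⊗[K] R))) :
    H1.mk z = H1.mk z' ↔ coordCocycle y z - coordCocycle y z' ∈ contCoboundary c R 0 := by
  have h0 : H1.mk z = H1.mk z' ↔ ∃ u, ∀ g, z'.toFun g = u * z.toFun g * g • u⁻¹ := Quotient.eq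
  rw [h0]
  have key : ∀ (u : Graded B A n (B ⊗[K] R)) (g : Fin 1 → G),
      dCochain c R 0 (fun _ => coord y u) g =
        coord y (g 0 • u) - coord y u := by
    intro u g
    refine (coord_coboundary hy hc 0 (fun _ => u) g).symm.trans ?_
    rw [coboundary_zero_apply, coord_mul hy, coord_inv hy, sub_eq_add_neg]
  have key' : ∀ (u : Graded B A n (B ⊗[K] R)) (g : G),
      coord y (u * z.toFun g * g • u⁻¹) =
        coord y (z.toFun g) - (coord y (g • u) - coord y u) := by
    intro u g
    rw [coord_mul hy, coord_mul hy, smul_inv', coord_inv hy]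
    abel
  constructor
  · rintro ⟨u, hu⟩
    refine ⟨fun _ => coord y u, fun i => const_mem_finCont _, funext fun g => ?_⟩
    rw [key]
    change _ = coord y (z.toFun (g 0)) - coord y (z'.toFun (g 0))
    rw [hu, key']
    abel
  · rintro ⟨b, -, hb⟩
    have hb0 : b = fun _ => coord y (ofCoord hy (b Fin.elim0)) := by
      funext x
      rw [coord_ofCoord]
      exact congrArg b (Subsingleton.elim _ _)
    refine ⟨ofCoord hy (b Fin.elim0), fun g => ?_⟩
    apply coord_injective hy
    rw [key']
    have h1 := congrFun hb fun _ => g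
    rw [hb0, key] at h1
    rw [h1]
    change _ = coord y (z.toFun g) - (coord y (z.toFun g) - coord y (z'.toFun g))
    abel

theorem linCochain_mem_contCocycle (l : R →ₗ[K] R') {j : ℕ} {f : Cochain G K B ι R j}
    (hf : f ∈ contCocycle c R j) : linCochain l j f ∈ contCocycle c R' j :=
  mapCochain_mem_contCocycle c (commutesWithCoeffAct_baseChange G l) hf

/-- `H¹` of a graded piece is represented by an affine space. -/
theorem exists_corepresentableBy_h1Graded (hy : IsLinearCoords (level_le_succ n) y)
    (hc : IsActionMatrix K y c)
    (hfin : ∃ s : Set (Cochain G K B ι K (0 + 1)), s.Finite ∧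
      (∀ f ∈ s, f ∈ contCocycle c K (0 + 1)) ∧
      contCocycle c K (0 + 1) ≤ Submodule.span K s ⊔ contCoboundary c K 0) :
    ∃ d : ℕ, Nonempty ((h1Graded G K B A n).CorepresentableBy
        (CommAlgCat.of K (MvPolynomial (Fin d) K))) := by
  obtain ⟨d, h, hh, hb⟩ := exists_cohomology_basis c 0 hfin
  -- The cocycle with coordinates `s` in the basis `h`. Existence and uniqueness in `hb` become
  -- surjectivity and injectivity of the map `T` to classes.
  let F : ∀ (R : Type u) [CommRing R] [Algebra K R], (Fin d → R) → Cochain G K B ι R 1 :=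
    fun R _ _ s => ∑ k, linCochain (LinearMap.toSpanSingleton K R (s k)) 1 (h k)
  have hF : ∀ (R : Type u) [CommRing R] [Algebra K R] (s : Fin d → R),
      F R s ∈ contCocycle c R 1 := fun R _ _ s =>
    Submodule.sum_mem _ fun k _ => linCochain_mem_contCocycle _ (hh k)
  let T : ∀ (R : Type u) [CommRing R] [Algebra K R], (Fin d → R) →
      H1 G (Graded B A n (B ⊗[K] R)) := fun R _ _ s => H1.mk (cocycleOne hy hc (hF R s))
  have hT : ∀ (R : Type u) [CommRing R] [Algebra K R], Function.Bijective (T R) := by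
    intro R _ _
    constructor
    · intro s s' hs
      have h1 := (H1_mk_eq_iff_coord hy hc _ _).1 hs
      rw [coordCocycle_cocycleOne, coordCocycle_cocycleOne] at h1
      refine (hb R _ (hF R s)).unique ?_ h1
      change F R s - F R s ∈ _
      rw [sub_self]; exact zero_mem _
    · intro x
      induction x using Quotient.ind with | _ z => ?_
      obtain ⟨s, hs, -⟩ := hb R _ (coordCocycle_mem hy hc z)
      refine ⟨s, Eq.symm ?_⟩
      refine (H1_mk_eq_iff_coord hy hc _ _).2 ?_
      rw [coordCocycle_cocycleOne]
      exact hs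
  have hnat : ∀ {R R' : CommAlgCat.{u} K} (f : R ⟶ R') (s : Fin d → R),
      (h1Graded G K B A n).map f (T R s) = T R' fun k => f.hom (s k) := by
    intro R R' f s
    refine congrArg H1.mk (Cocycle.ext (funext fun g => ?_))
    apply coord_injective hy
    refine (coord_gradedMap f.hom _).trans ?_
    refine (congrFun (congrArg (linCochain f.hom.toLinearMap 1)
      (coordCocycle_cocycleOne hy hc (hF R s))) fun _ => g).trans ?_
    refine Eq.trans ?_ (coord_ofCoord hy _).symm
    refine congrFun ?_ _
    change linCochain f.hom.toLinearMap 1 (∑ k, _) = ∑ k, _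
    rw [map_sum]
    exact Finset.sum_congr rfl fun k _ => linCochain_toSpanSingleton f.hom (s k) (h k)
  refine ⟨d, ⟨{
    homEquiv := fun {R} =>
      { toFun := fun φ => T R fun k => φ.hom (MvPolynomial.X k)
        invFun := fun x => CommAlgCat.ofHom
          (MvPolynomial.aeval ((Equiv.ofBijective _ (hT R)).symm x))
        left_inv := fun φ => by
          ext : 1
          apply MvPolynomial.algHom_ext
          intro k
          rw [CommAlgCat.hom_ofHom, MvPolynomial.aeval_X]
          exact congrFun ((Equiv.ofBijective _ (hT R)).symm_apply_apply _) k
        right_inv := fun x => by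
          simp only [CommAlgCat.hom_ofHom, MvPolynomial.aeval_X]
          exact (Equiv.ofBijective _ (hT R)).apply_symm_apply x }
    homEquiv_comp := fun g f => (hnat g _).symm }⟩⟩

end GradedH1
end UnipCoh

namespace UnipCoh

/-! ### The connecting map -/

section Defect
variable {G E : Type*} [Group G] [Group E] [MulDistribMulAction G E]

/-- The deviation of a map `l : G → E` from being a cocycle. -/
def defect (l : G → E) (g h : G) : E := l (g * h) * (g • l h)⁻¹ * (l g)⁻¹

theorem apply_mul_eq_defect (l : G → E) (g h : G) :
    l (g * h) = defect l g h * (l g * g • l h) := by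
  simp [defect]

/-- Associativity: `l(g h k)` is computed in two ways, and the central defects are collected in
front. -/
theorem defect_cocycle {l : G → E} (hl : ∀ (a g h : G) (u : E), Commute (a • defect l g h) u)
    (g h k : G) :
    g • defect l h k * (defect l (g * h) k)⁻¹ * defect l g (h * k) * (defect l g h)⁻¹ = 1 := by
  have hl1 : ∀ (g h : G) (u : E), Commute (defect l g h) u := fun g h u => by
    simpa using hl 1 g h u
  have h1 : l (g * h * k) = defect l (g * h) k * defect l g h * (l g * g • l h * (g * h) • l k) := by
    rw [apply_mul_eq_defect l (g * h) k, apply_mul_eq_defect l g h]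
    simp only [mul_assoc]
  have h2 : l (g * h * k) = defect l g (h * k) * g • defect l h k *
      (l g * g • l h * (g * h) • l k) := by
    rw [mul_assoc g h k, apply_mul_eq_defect l g (h * k), apply_mul_eq_defect l h k, smul_mul',
      smul_mul', ← mul_assoc (l g), ← (hl g h k (l g)).eq]
    simp only [mul_assoc, mul_smul]
  have h3 := mul_right_cancel (h1.symm.trans h2)
  rw [← (hl1 g (h * k) _).eq, ← mul_assoc, ← h3, (hl1 (g * h) k _).eq, mul_inv_cancel_right,
    mul_inv_cancel]

/-- Conjugation by `u` conjugates the defect, which is central and so does not change; a central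
factor `b` contributes separately, by the inverse of its coboundary. -/
theorem defect_twist {l : G → E} {b : G → E} {u : E}
    (hb : ∀ (a g : G) (w : E), Commute (a • b g) w)
    (hl : ∀ (g h : G) (w : E), Commute (defect l g h) w) (g h : G) :
    defect (fun g => b g * (u * l g * g • u⁻¹)) g h =
      defect l g h * (g • b h * (b (g * h))⁻¹ * b g)⁻¹ := by
  have hb1 : ∀ (g : G) (w : E), Commute (b g) w := fun g w => by simpa using hb 1 g w
  have h1 : defect (fun g => u * l g * g • u⁻¹) g h = defect l g h := by
    have : defect (fun g => u * l g * g • u⁻¹) g h = u * defect l g h * u⁻¹ := by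
      simp [defect, mul_assoc, mul_smul]
    rw [this, ← (hl g h u).eq, mul_inv_cancel_right]
  have h2 : ∀ m : G → E, defect (fun g => b g * m g) g h =
      b (g * h) * (g • b h)⁻¹ * (b g)⁻¹ * defect m g h := by
    intro m
    have e1 : (g • (b h * m h))⁻¹ = (g • b h)⁻¹ * (g • m h)⁻¹ := by
      rw [smul_mul', (hb g h _).eq, mul_inv_rev]
    have e2 : (b g * m g)⁻¹ = (b g)⁻¹ * (m g)⁻¹ := by
      rw [(hb1 g _).eq, mul_inv_rev]
    simp only [defect, e1, e2, mul_assoc]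
    rw [← mul_assoc (m (g * h)), ← (hb g h (m (g * h))).inv_left.eq]
    simp only [mul_assoc]
    rw [← mul_assoc (g • m h)⁻¹, ← (hb1 g (g • m h)⁻¹).inv_left.eq]
    simp only [mul_assoc]
    rw [← mul_assoc (m (g * h)), ← (hb1 g (m (g * h))).inv_left.eq]
    simp only [mul_assoc]
  rw [h2, h1, (hl g h _).eq]
  congr 1
  rw [mul_inv_rev, mul_inv_rev, inv_inv, ← mul_assoc, (hb1 g _).inv_left.eq, mul_assoc, mul_assoc,
    (hb1 g _).inv_left.eq]

end Defect

end UnipCoh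

namespace UnipCoh

/-! ### Algebraic sections of `U_{n+1} → U_n`. -/

section Retraction
variable {B A : Type u} [Field B] [CommRing A] [HopfAlgebra B A] {n : ℕ}

/-- `U_{n+1} → U_n` has a section as a morphism of schemes. -/
def IsRetraction (s : (level B A (n + 1)).toSubalgebra →ₐ[B] (level B A n).toSubalgebra) : Prop :=
  s.comp (Subalgebra.inclusion (level_le_succ n)) = AlgHom.id B _

/-- The identity is the tautological point of `U_n` with values in its own coordinate ring; it
extends along the tower. -/
theorem exists_isRetraction [CharZero B] (hunip : IsProUnipotent B A)
    (hfg : Algebra.FiniteType B (level B A (n + 1)).toSubalgebra) :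
    ∃ s : (level B A (n + 1)).toSubalgebra →ₐ[B] (level B A n).toSubalgebra, IsRetraction s := by
  obtain ⟨w, hw⟩ := (tower_of_finiteType hunip (level_le_succ n) hfg).exists_extend hunip
    (S := (level B A n).toSubalgebra) (.toConv (AlgHom.id B _))
  exact ⟨w.ofConv, congrArg WithConv.ofConv hw⟩

/-- Lifting of points along a section. -/
noncomputable def liftPoint {S : Type u} [CommRing S] [Algebra B S]
    (s : (level B A (n + 1)).toSubalgebra →ₐ[B] (level B A n).toSubalgebra)
    (u : WithConv ((level B A n).toSubalgebra →ₐ[B] S)) :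
    WithConv ((level B A (n + 1)).toSubalgebra →ₐ[B] S) := .toConv (u.ofConv.comp s)

theorem restrictHom_liftPoint {S : Type u} [CommRing S] [Algebra B S]
    {s : (level B A (n + 1)).toSubalgebra →ₐ[B] (level B A n).toSubalgebra} (hs : IsRetraction s)
    (u : WithConv ((level B A n).toSubalgebra →ₐ[B] S)) :
    restrictHom S (level_le_succ n) (liftPoint s u) = u := by
  apply WithConv.ext
  change (u.ofConv.comp s).comp (Subalgebra.inclusion (level_le_succ n)) = u.ofConv
  rw [AlgHom.comp_assoc, hs, AlgHom.comp_id]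

theorem commute_graded {S : Type u} [CommRing S] [Algebra B S] (v : Graded B A n S)
    (u : WithConv ((level B A (n + 1)).toSubalgebra →ₐ[B] S)) : Commute v.1 u :=
  ((level_succ_isCentralOver (B := B) (A := A) n).2 S u v.1 v.2).symm

end Retraction

/-! ### The connecting map of the central extension. -/

section Connecting
variable {G K B A R R' : Type u} [Group G] [TopologicalSpace G] [IsTopologicalGroup G]
  [CompactSpace G] [Field K] [Field B] [TopologicalSpace B] [IsTopologicalRing B] [T2Space B]
  [Algebra K B] [MulSemiringAction G B] [ContinuousSMul G B] [SMulCommClass G K B]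
  [CommRing A] [HopfAlgebra B A] [MulSemiringAction G A] [EquivariantHopf G B A]
  [CommRing R] [Algebra K R] [CommRing R'] [Algebra K R'] {n : ℕ}

/-- Lifting along an algebraic section is precomposition with an algebra map, which preserves
continuity because continuity is tested function by function. -/
theorem exists_isLift
    {s : (level B A (n + 1)).toSubalgebra →ₐ[B] (level B A n).toSubalgebra} (hs : IsRetraction s)
    (c : Cocycle G (Points K B (level B A n).toSubalgebra R)) : ∃ l, IsLift c l := by
  refine ⟨fun g => liftPoint s (c.toFun g), ?_, fun g => restrictHom_liftPoint hs _⟩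
  have h := c.continuous_toFun
  rw [continuous_points_iff] at h ⊢
  exact fun a => h (s a)

/-- The defect of a lift of a cocycle. -/
noncomputable def gradedDefect {c : Cocycle G (Points K B (level B A n).toSubalgebra R)}
    {l : G → Points K B (level B A (n + 1)).toSubalgebra R} (hl : IsLift c l) (g h : G) :
    Graded B A n (B ⊗[K] R) :=
  ⟨defect l g h, by
    change restrictHom (B ⊗[K] R) (level_le_succ n) (l (g * h) * (g • l h)⁻¹ * (l g)⁻¹) = 1
    rw [map_mul, map_mul, map_inv, map_inv, restrictHom_smul, hl.2, hl.2, hl.2, c.map_mul]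
    group⟩

/-- The 2-cocycle defined by a lift of a cocycle. -/
noncomputable def liftCocycle (hA : ContinuousOrbits G B (level B A (n + 1)).toSubalgebra)
    {c : Cocycle G (Points K B (level B A n).toSubalgebra R)}
    {l : G → Points K B (level B A (n + 1)).toSubalgebra R} (hl : IsLift c l) :
    NCocycle G (Graded B A n (B ⊗[K] R)) 2 where
  toFun x := gradedDefect hl (x 0) (x 1)
  continuous_toFun := by
    refine continuous_induced_rng.2 ?_
    refine continuous_points_mul (continuous_points_mul (hl.1.comp (by fun_prop))
      (continuous_points_inv (continuous_points_smul hA (by fun_prop)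
        (hl.1.comp (by fun_prop))))) (continuous_points_inv (hl.1.comp (by fun_prop)))
  coboundary_eq_one x := by
    rw [coboundary_two_apply]
    refine Subtype.ext ?_
    exact defect_cocycle (fun a g h u => commute_graded (a • gradedDefect hl g h) u)
      (x 0) (x 1) (x 2)

/-- Independence of the lift and of the representative of the class, treated together; the case `c =
c'` is independence of the lift. -/
theorem HN_mk_liftCocycle_eq
    {s : (level B A (n + 1)).toSubalgebra →ₐ[B] (level B A n).toSubalgebra} (hs : IsRetraction s)
    (hA : ContinuousOrbits G B (level B A (n + 1)).toSubalgebra)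
    {c c' : Cocycle G (Points K B (level B A n).toSubalgebra R)}
    {l l' : G → Points K B (level B A (n + 1)).toSubalgebra R} (hl : IsLift c l)
    (hl' : IsLift c' l') (hcc : H1.mk c = H1.mk c') :
    HN.mk (liftCocycle hA hl) = HN.mk (liftCocycle hA hl') := by
  obtain ⟨u, hu⟩ : ∃ u, ∀ g, c'.toFun g = u * c.toFun g * g • u⁻¹ := Quotient.exact hcc
  set w := liftPoint s u
  have hw : restrictHom (B ⊗[K] R) (level_le_succ n) w = u := restrictHom_liftPoint hs u
  -- Both `l'` and the twist of `l` by the lift `w` of `u` lie over `c'`, so they differ by a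
  -- central cochain `b`.
  let b : G → Graded B A n (B ⊗[K] R) := fun g => ⟨l' g * (w * l g * g • w⁻¹)⁻¹, by
    change restrictHom (B ⊗[K] R) (level_le_succ n) (l' g * (w * l g * g • w⁻¹)⁻¹) = 1
    rw [map_mul, map_inv, map_mul, map_mul, restrictHom_smul, map_inv, hw, hl.2, hl'.2, hu,
      mul_inv_cancel]⟩
  have hb : Continuous b := continuous_induced_rng.2
    (continuous_points_mul hl'.1 (continuous_points_inv (continuous_points_mul
      (continuous_points_mul continuous_const hl.1)
      (continuous_points_smul hA continuous_id continuous_const))))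
  have hb' : Continuous fun x : Fin 1 → G => (b (x 0))⁻¹ := continuous_induced_rng.2
    (continuous_points_inv ((continuous_induced_rng.1 hb).comp (continuous_apply 0)))
  have hl'' : l' = fun g => (b g).1 * (w * l g * g • w⁻¹) := funext fun g =>
    (inv_mul_cancel_right (l' g) _).symm
  have key : ∀ g h, gradedDefect hl' g h =
      gradedDefect hl g h * (g • b h * (b (g * h))⁻¹ * b g)⁻¹ := by
    intro g h
    refine Subtype.ext ?_
    change defect l' g h = _
    rw [hl'']
    exact defect_twist (fun a g w => commute_graded (a • b g) w)
      (fun g h w => commute_graded (gradedDefect hl g h) w) g h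
  -- By its sign convention the defect is multiplied by the inverse of the coboundary of `b`, so the
  -- bounding cochain is `b⁻¹`.
  refine Quot.sound ⟨coboundary 1 fun x => (b (x 0))⁻¹, ⟨_, hb', rfl⟩, funext fun x => ?_⟩
  refine (key _ _).trans (congrArg _ ?_)
  rw [coboundary_one_apply (fun g => (b g)⁻¹), smul_inv', mul_inv, mul_inv]

/-- The connecting map on the points of a `K`-algebra. -/
noncomputable def connectingApp
    {s : (level B A (n + 1)).toSubalgebra →ₐ[B] (level B A n).toSubalgebra} (hs : IsRetraction s)
    (hA : ContinuousOrbits G B (level B A (n + 1)).toSubalgebra) (R : Type u) [CommRing R]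
    [Algebra K R] (x : H1 G (Points K B (level B A n).toSubalgebra R)) :
    HN G (Graded B A n (B ⊗[K] R)) 2 :=
  Quotient.lift (fun c => HN.mk (liftCocycle hA (exists_isLift hs c).choose_spec))
    (fun _ _ h => HN_mk_liftCocycle_eq hs hA _ _ (Quotient.sound h)) x

theorem connectingApp_mk
    {s : (level B A (n + 1)).toSubalgebra →ₐ[B] (level B A n).toSubalgebra} (hs : IsRetraction s)
    (hA : ContinuousOrbits G B (level B A (n + 1)).toSubalgebra)
    {c : Cocycle G (Points K B (level B A n).toSubalgebra R)}
    {l : G → Points K B (level B A (n + 1)).toSubalgebra R} (hl : IsLift c l) :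
    connectingApp hs hA R (H1.mk c) = HN.mk (liftCocycle hA hl) :=
  HN_mk_liftCocycle_eq hs hA _ _ rfl

theorem connectingApp_map
    {s : (level B A (n + 1)).toSubalgebra →ₐ[B] (level B A n).toSubalgebra} (hs : IsRetraction s)
    (hA : ContinuousOrbits G B (level B A (n + 1)).toSubalgebra) (φ : R →ₐ[K] R')
    (x : H1 G (Points K B (level B A n).toSubalgebra R)) :
    connectingApp hs hA R' (H1.map (pointsMap φ) (continuous_pointsMap φ) (pointsMap_smul φ) x) =
      hGradedMap G n 2 φ (connectingApp hs hA R x) := by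
  induction x using Quotient.ind with | _ c => ?_
  obtain ⟨l, hl⟩ := exists_isLift hs c
  let c' : Cocycle G (Points K B (level B A n).toSubalgebra R') :=
    Cocycle.map (pointsMap φ) (continuous_pointsMap φ) (pointsMap_smul φ) c
  have hl' : IsLift c' fun g => pointsMap φ (l g) :=
    ⟨(continuous_pointsMap φ).comp hl.1, fun g => congrArg (pointsMap φ) (hl.2 g)⟩
  have h1 : connectingApp hs hA R' (H1.mk c') = HN.mk (liftCocycle hA hl') :=
    connectingApp_mk hs hA hl'
  have h2 : connectingApp hs hA R (H1.mk c) = HN.mk (liftCocycle hA hl) :=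
    connectingApp_mk hs hA hl
  have h3 : hGradedMap G n 2 φ (HN.mk (liftCocycle hA hl)) = HN.mk (liftCocycle hA hl') := by
    refine congrArg HN.mk (NCocycle.ext (funext fun x => Subtype.ext ?_))
    change pointsMap φ (defect l (x 0) (x 1)) = defect (fun g => pointsMap φ (l g)) (x 0) (x 1)
    simp only [defect, map_mul, map_inv, pointsMap_smul]
  exact h1.trans (h3.symm.trans (congrArg (hGradedMap G n 2 φ) h2.symm))

/-- The connecting map. -/
noncomputable def connectingMap
    {s : (level B A (n + 1)).toSubalgebra →ₐ[B] (level B A n).toSubalgebra} (hs : IsRetraction s)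
    (hA : ContinuousOrbits G B (level B A (n + 1)).toSubalgebra) :
    h1Functor G K B (level B A n).toSubalgebra ⟶ hGraded G K B A 2 n where
  app R := ↾(connectingApp hs hA R)
  naturality R R' f := by
    ext x
    exact connectingApp_map hs hA f.hom x

theorem isConnectingMap_connectingMap
    {s : (level B A (n + 1)).toSubalgebra →ₐ[B] (level B A n).toSubalgebra} (hs : IsRetraction s)
    (hA : ContinuousOrbits G B (level B A (n + 1)).toSubalgebra) :
    IsConnectingMap n (connectingMap (K := K) hs hA) := fun _ c =>
  ⟨exists_isLift hs c, fun _ hl => ⟨liftCocycle hA hl, fun _ => rfl, connectingApp_mk hs hA hl⟩⟩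

end Connecting

end UnipCoh

namespace UnipCoh

/-! ### The action of the cohomology of the graded pieces -/

theorem mul_mul_inv_mul_of_commute {E : Type*} [Group E] {p q r l l' : E} (hp : ∀ u, Commute p u)
    (hq : ∀ u, Commute q u) : p * (q * p⁻¹ * r * (l * l')) = r * l * (q * l') := by
  rw [mul_assoc q, mul_assoc q, ← mul_assoc p q, (hp q).eq, mul_assoc q, ← mul_assoc p,
    mul_inv_cancel_left, (hq _).eq, (hq _).eq]
  simp only [mul_assoc]

section Translation
variable {G K B A R R' : Type u} [Group G] [TopologicalSpace G] [IsTopologicalGroup G]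
  [CompactSpace G] [Field K] [Field B] [TopologicalSpace B] [IsTopologicalRing B] [T2Space B]
  [Algebra K B] [MulSemiringAction G B] [ContinuousSMul G B] [SMulCommClass G K B]
  [CommRing A] [HopfAlgebra B A] [MulSemiringAction G A] [EquivariantHopf G B A]
  [CommRing R] [Algebra K R] [CommRing R'] [Algebra K R'] {n : ℕ}

variable (R) in
/-- The map `H¹(G, U_{n+1}(B ⊗_K R)) → H¹(G, U_n(B ⊗_K R))`. -/
noncomputable abbrev stepApp :
    H1 G (Points K B (level B A (n + 1)).toSubalgebra R) →
      H1 G (Points K B (level B A n).toSubalgebra R) :=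
  H1.map (restrictHom (B ⊗[K] R) (level_le_succ n)) (continuous_restrictHom _) (restrictHom_smul n)

/-- The restriction of a cocycle. -/
noncomputable abbrev stepCocycle (c : Cocycle G (Points K B (level B A (n + 1)).toSubalgebra R)) :
    Cocycle G (Points K B (level B A n).toSubalgebra R) :=
  Cocycle.map (restrictHom (B ⊗[K] R) (level_le_succ n)) (continuous_restrictHom _)
    (restrictHom_smul n) c

/-- Exactness at `H¹(G, U_n)`: a class lifts if and only if the defect of a lift can be removed by a
central cochain. -/
theorem connectingApp_eq_one_iff {ι : Type} [Fintype ι]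
    {y : ι → (level B A (n + 1)).toSubalgebra} {a : G → ι → ι → B}
    (hy : IsLinearCoords (level_le_succ n) y) (ha : IsActionMatrix K y a)
    {s : (level B A (n + 1)).toSubalgebra →ₐ[B] (level B A n).toSubalgebra} (hs : IsRetraction s)
    (hA : ContinuousOrbits G B (level B A (n + 1)).toSubalgebra)
    (x : H1 G (Points K B (level B A n).toSubalgebra R)) :
    connectingApp hs hA R x = HN.mk (NCocycle.one 2) ↔ ∃ x', stepApp R x' = x := by
  constructor
  · induction x using Quotient.ind with | _ c => ?_
    intro hx
    obtain ⟨l, hl⟩ := exists_isLift hs c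
    have h1 : HN.mk (liftCocycle hA hl) = HN.mk (NCocycle.one 2) :=
      (connectingApp_mk hs hA hl).symm.trans hx
    rw [HN_mk_eq_one_iff hy ha, ← isCoboundary_iff hy ha] at h1
    obtain ⟨b, hb, hlb⟩ := h1
    let b' : G → Graded B A n (B ⊗[K] R) := fun g => b fun _ => g
    have hbb : b = fun x => b' (x 0) := funext fun x =>
      congrArg b (funext fun i => by rw [Subsingleton.elim i 0])
    have hb' : Continuous fun g => (b' g).1 :=
      (continuous_induced_rng.1 hb).comp (continuous_pi fun _ => continuous_id)
    have key : ∀ g h, gradedDefect hl g h = g • b' h * (b' (g * h))⁻¹ * b' g := by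
      intro g h
      have := congrFun hlb ![g, h]
      rw [hbb, coboundary_one_apply] at this
      exact this
    -- The defect of `l` is the coboundary of `b'`, so `b' l` has trivial defect and still lies over
    -- `c`.
    let c' : Cocycle G (Points K B (level B A (n + 1)).toSubalgebra R) :=
      { toFun := fun g => (b' g).1 * l g
        continuous_toFun := continuous_points_mul hb' hl.1
        map_mul := fun g h => by
          rw [apply_mul_eq_defect l g h]
          have h2 : defect l g h = (g • b' h).1 * (b' (g * h)).1⁻¹ * (b' g).1 :=
            congrArg Subtype.val (key g h)
          rw [h2, smul_mul']
          exact mul_mul_inv_mul_of_commute (commute_graded _) (commute_graded (g • b' h)) }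
    refine ⟨H1.mk c', congrArg H1.mk (Cocycle.ext (funext fun g => ?_))⟩
    change restrictHom (B ⊗[K] R) (level_le_succ n) ((b' g).1 * l g) = c.toFun g
    rw [map_mul, hl.2, show restrictHom (B ⊗[K] R) (level_le_succ n) (b' g).1 = 1 from (b' g).2,
      one_mul]
  · rintro ⟨x', rfl⟩
    induction x' using Quotient.ind with | _ c => ?_
    -- A cocycle is a lift of its own image, with trivial defect.
    have hl : IsLift (stepCocycle c) c.toFun := ⟨c.continuous_toFun, fun g => rfl⟩
    refine (connectingApp_mk hs hA hl).trans (congrArg HN.mk (NCocycle.ext (funext fun x => ?_)))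
    refine Subtype.ext ?_
    change defect c.toFun (x 0) (x 1) = 1
    rw [defect, c.map_mul]
    group

/-- Translation of a cocycle by a cocycle with values in the centre. -/
noncomputable def translate (v : Cocycle G (Graded B A n (B ⊗[K] R)))
    (c : Cocycle G (Points K B (level B A (n + 1)).toSubalgebra R)) :
    Cocycle G (Points K B (level B A (n + 1)).toSubalgebra R) where
  toFun g := (v.toFun g).1 * c.toFun g
  continuous_toFun :=
    continuous_points_mul (continuous_induced_rng.1 v.continuous_toFun) c.continuous_toFun
  map_mul g h := by
    have h1 : (v.toFun (g * h)).1 = (v.toFun g).1 * (g • v.toFun h).1 :=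
      congrArg Subtype.val (v.map_mul g h)
    rw [h1, c.map_mul, smul_mul', mul_assoc, mul_assoc, ← mul_assoc _ (c.toFun g),
      (commute_graded (g • v.toFun h) (c.toFun g)).eq, mul_assoc]
    rfl

theorem H1_mk_translate_eq {v v' : Cocycle G (Graded B A n (B ⊗[K] R))}
    {c c' : Cocycle G (Points K B (level B A (n + 1)).toSubalgebra R)}
    (hv : H1.mk v = H1.mk v') (hc : H1.mk c = H1.mk c') :
    H1.mk (translate v c) = H1.mk (translate v' c') := by
  obtain ⟨u, hu⟩ : ∃ u, ∀ g, v'.toFun g = u * v.toFun g * g • u⁻¹ := Quotient.exact hv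
  obtain ⟨w, hw⟩ : ∃ w, ∀ g, c'.toFun g = w * c.toFun g * g • w⁻¹ := Quotient.exact hc
  refine Quotient.sound ⟨u.1 * w, fun g => ?_⟩
  have h1 : (v'.toFun g).1 = u.1 * (v.toFun g).1 * (g • u⁻¹).1 := congrArg Subtype.val (hu g)
  change (v'.toFun g).1 * c'.toFun g =
    u.1 * w * ((v.toFun g).1 * c.toFun g) * g • (u.1 * w)⁻¹
  have h2 : g • (u.1 * w)⁻¹ = g • w⁻¹ * (g • u⁻¹).1 := by
    rw [mul_inv_rev, smul_mul']; rfl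
  rw [h1, hw, h2]
  rw [mul_assoc _ (g • u⁻¹).1, (commute_graded (g • u⁻¹) _).eq]
  simp only [mul_assoc]
  rw [← mul_assoc (v.toFun g).1 w, (commute_graded (v.toFun g) w).eq]
  simp only [mul_assoc]

/-- The translation action of the cohomology of a graded piece. -/
noncomputable def h1Translate (x : H1 G (Graded B A n (B ⊗[K] R)))
    (y : H1 G (Points K B (level B A (n + 1)).toSubalgebra R)) :
    H1 G (Points K B (level B A (n + 1)).toSubalgebra R) :=
  Quotient.map₂ translate (fun _ _ hv _ _ hc =>
    Quotient.exact (H1_mk_translate_eq (Quotient.sound hv) (Quotient.sound hc))) x y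

theorem stepApp_h1Translate (x : H1 G (Graded B A n (B ⊗[K] R)))
    (y : H1 G (Points K B (level B A (n + 1)).toSubalgebra R)) :
    stepApp R (h1Translate x y) = stepApp R y := by
  induction x using Quotient.ind with | _ v => ?_
  induction y using Quotient.ind with | _ c => ?_
  refine congrArg H1.mk (Cocycle.ext (funext fun g => ?_))
  change restrictHom (B ⊗[K] R) (level_le_succ n) ((v.toFun g).1 * c.toFun g) = _
  rw [map_mul, show restrictHom (B ⊗[K] R) (level_le_succ n) (v.toFun g).1 = 1 from
    (v.toFun g).2, one_mul]
  rfl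

/-- The cocycle `g ↦ w c(g) g(w⁻¹)`. -/
noncomputable def twistCocycle (hA : ContinuousOrbits G B A) (w : Points K B A R)
    (c : Cocycle G (Points K B A R)) : Cocycle G (Points K B A R) where
  toFun g := w * c.toFun g * g • w⁻¹
  continuous_toFun := continuous_points_mul (continuous_points_mul continuous_const
    c.continuous_toFun) (continuous_points_smul hA continuous_id continuous_const)
  map_mul g h := by
    simp only [c.map_mul, smul_mul', mul_smul, smul_inv']
    group

theorem H1_mk_twistCocycle (hA : ContinuousOrbits G B A) (w : Points K B A R)
    (c : Cocycle G (Points K B A R)) : H1.mk c = H1.mk (twistCocycle hA w c) :=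
  Quotient.sound ⟨w, fun _ => rfl⟩

/-- The classes of a fibre of `H¹(G, U_{n+1}) → H¹(G, U_n)` are translates of each other. -/
theorem exists_h1Translate_eq
    {s : (level B A (n + 1)).toSubalgebra →ₐ[B] (level B A n).toSubalgebra} (hs : IsRetraction s)
    (hA : ContinuousOrbits G B (level B A (n + 1)).toSubalgebra)
    {y y' : H1 G (Points K B (level B A (n + 1)).toSubalgebra R)} (h : stepApp R y = stepApp R y') :
    ∃ x, h1Translate x y = y' := by
  induction y using Quotient.ind with | _ c => ?_
  induction y' using Quotient.ind with | _ c' => ?_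
  obtain ⟨u, hu⟩ : ∃ u, ∀ g, (stepCocycle c').toFun g =
    u * (stepCocycle c).toFun g * g • u⁻¹ := Quotient.exact h
  set w := liftPoint s u
  have hw : restrictHom (B ⊗[K] R) (level_le_succ n) w = u := restrictHom_liftPoint hs u
  -- After replacing `c` by the cohomologous `m`, the images in `U_n` agree, so `c' m⁻¹` takes
  -- values in the central kernel and is a cocycle there.
  let m := twistCocycle hA w c
  have hm : ∀ g, restrictHom (B ⊗[K] R) (level_le_succ n) (m.toFun g) =
      restrictHom (B ⊗[K] R) (level_le_succ n) (c'.toFun g) := fun g => by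
    refine Eq.trans ?_ (hu g).symm
    change restrictHom (B ⊗[K] R) (level_le_succ n) (w * c.toFun g * g • w⁻¹) = _
    rw [map_mul, map_mul, restrictHom_smul, map_inv, hw]
    rfl
  let z : G → Graded B A n (B ⊗[K] R) := fun g => ⟨c'.toFun g * (m.toFun g)⁻¹, by
    change restrictHom (B ⊗[K] R) (level_le_succ n) (c'.toFun g * (m.toFun g)⁻¹) = 1
    rw [map_mul, map_inv, hm, mul_inv_cancel]⟩
  let v : Cocycle G (Graded B A n (B ⊗[K] R)) :=
    { toFun := z
      continuous_toFun := continuous_induced_rng.2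
        (continuous_points_mul c'.continuous_toFun (continuous_points_inv m.continuous_toFun))
      map_mul := fun g h => by
        refine Subtype.ext ?_
        change c'.toFun (g * h) * (m.toFun (g * h))⁻¹ =
          c'.toFun g * (m.toFun g)⁻¹ * g • (c'.toFun h * (m.toFun h)⁻¹)
        have h1 : g • (c'.toFun h * (m.toFun h)⁻¹) * (m.toFun g)⁻¹ =
            (m.toFun g)⁻¹ * g • (c'.toFun h * (m.toFun h)⁻¹) :=
          commute_graded (g • z h) (m.toFun g)⁻¹
        rw [mul_assoc (c'.toFun g), ← h1, c'.map_mul, m.map_mul, smul_mul', smul_inv', mul_inv_rev]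
        simp only [mul_assoc] }
  refine ⟨H1.mk v, ?_⟩
  refine (H1_mk_translate_eq (v := v) rfl (H1_mk_twistCocycle hA w c)).trans ?_
  refine congrArg H1.mk (Cocycle.ext (funext fun g => ?_))
  exact inv_mul_cancel_right (c'.toFun g) (m.toFun g)

/-- A point fixed by a twisted action is trivial. -/
theorem eq_one_of_twisted_fixed
    (hfix : ∀ (n : ℕ) (v : Graded B A n (B ⊗[K] R)), (∀ g : G, g • v = v) → v = 1) (m : ℕ)
    (c : Cocycle G (Points K B (level B A m).toSubalgebra R))
    {u : Points K B (level B A m).toSubalgebra R}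
    (hu : ∀ g, c.toFun g = u * c.toFun g * g • u⁻¹) : u = 1 := by
  induction m with
  | zero =>
    rw [conv_eq_iff_one]
    rintro ⟨_, b, rfl⟩
    exact (u.ofConv.commutes b).trans (congrArg _ ((counitAlgHom B A).commutes b).symm)
  | succ m ih =>
    -- By induction `u` dies in `U_m`, so it is central. Then `c` cancels from `hu`, and `u` is
    -- fixed by the untwisted action.
    have h1 : restrictHom (B ⊗[K] R) (level_le_succ m) u = 1 := ih (stepCocycle c) fun g => by
      have := congrArg (restrictHom (B ⊗[K] R) (level_le_succ m)) (hu g)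
      rwa [map_mul, map_mul, restrictHom_smul, map_inv] at this
    let v : Graded B A m (B ⊗[K] R) := ⟨u, h1⟩
    have h2 : v = 1 := hfix m v fun g => by
      refine Subtype.ext ?_
      change g • u = u
      have h3 := hu g
      rw [(commute_graded v (c.toFun g)).eq, mul_assoc, eq_comm, mul_eq_left, smul_inv',
        mul_inv_eq_one] at h3
      exact h3.symm
    exact congrArg Subtype.val h2

/-- The translation action is free. -/
theorem h1Translate_injective
    (hfix : ∀ (n : ℕ) (v : Graded B A n (B ⊗[K] R)), (∀ g : G, g • v = v) → v = 1)
    {x x' : H1 G (Graded B A n (B ⊗[K] R))}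
    {y : H1 G (Points K B (level B A (n + 1)).toSubalgebra R)}
    (h : h1Translate x y = h1Translate x' y) : x = x' := by
  induction x using Quotient.ind with | _ v => ?_
  induction x' using Quotient.ind with | _ v' => ?_
  induction y using Quotient.ind with | _ c => ?_
  obtain ⟨u, hu⟩ : ∃ u, ∀ g, (v'.toFun g).1 * c.toFun g =
    u * ((v.toFun g).1 * c.toFun g) * g • u⁻¹ := Quotient.exact h
  -- Both cocycles lie over the same cocycle of `U_n`, so the image of `u` is a twisted invariant,
  -- hence trivial: `u` lies in the kernel and already relates `v` to `v'`.
  have h1 : restrictHom (B ⊗[K] R) (level_le_succ n) u = 1 :=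
    eq_one_of_twisted_fixed hfix n (stepCocycle c) fun g => by
      have := congrArg (restrictHom (B ⊗[K] R) (level_le_succ n)) (hu g)
      rwa [map_mul, map_mul, map_mul, map_mul, restrictHom_smul, map_inv,
        show restrictHom (B ⊗[K] R) (level_le_succ n) (v.toFun g).1 = 1 from (v.toFun g).2,
        show restrictHom (B ⊗[K] R) (level_le_succ n) (v'.toFun g).1 = 1 from (v'.toFun g).2,
        one_mul] at this
  let w : Graded B A n (B ⊗[K] R) := ⟨u, h1⟩
  refine Quotient.sound ⟨w, fun g => Subtype.ext ?_⟩
  change (v'.toFun g).1 = u * (v.toFun g).1 * g • u⁻¹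
  refine mul_right_cancel (b := c.toFun g) ((hu g).trans ?_)
  have h2 : g • u⁻¹ * c.toFun g = c.toFun g * g • u⁻¹ := commute_graded (g • w⁻¹) (c.toFun g)
  rw [mul_assoc _ (g • u⁻¹), h2]
  simp only [mul_assoc]

end Translation

end UnipCoh

namespace UnipCoh

/-! ### The inductive step -/

section Corepresentable
variable {K : Type u} [Field K]

/-- A product of corepresentable functors on commutative algebras is corepresented by the tensor
product. -/
noncomputable def prodCorepresentableBy {F F' : CommAlgCat.{u} K ⥤ Type u} {S S' : CommAlgCat.{u} K}
    (r : F.CorepresentableBy S) (r' : F'.CorepresentableBy S') :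
    (FunctorToTypes.prod F F').CorepresentableBy (CommAlgCat.of K (S ⊗[K] S')) where
  homEquiv {R} :=
    { toFun := fun φ =>
        (r.homEquiv (CommAlgCat.ofHom (φ.hom.comp Algebra.TensorProduct.includeLeft)),
          r'.homEquiv (CommAlgCat.ofHom (φ.hom.comp Algebra.TensorProduct.includeRight)))
      invFun := fun x => CommAlgCat.ofHom (Algebra.TensorProduct.lift (r.homEquiv.symm x.1).hom
        (r'.homEquiv.symm x.2).hom fun _ _ => Commute.all _ _)
      left_inv := fun φ => by
        ext : 1
        apply Algebra.TensorProduct.ext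
        · simp only [Equiv.symm_apply_apply, CommAlgCat.hom_ofHom]
          exact Algebra.TensorProduct.lift_comp_includeLeft _ _ _
        · simp only [Equiv.symm_apply_apply, CommAlgCat.hom_ofHom]
          exact Algebra.TensorProduct.lift_comp_includeRight _ _ _
      right_inv := fun x => by
        refine Prod.ext ?_ ?_
        · simp only [CommAlgCat.hom_ofHom, Algebra.TensorProduct.lift_comp_includeLeft]
          exact r.homEquiv.apply_symm_apply _
        · have h : (Algebra.TensorProduct.lift (r.homEquiv.symm x.1).hom (r'.homEquiv.symm x.2).hom
              fun _ _ => Commute.all _ _).comp Algebra.TensorProduct.includeRight =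
                (r'.homEquiv.symm x.2).hom :=
            Algebra.TensorProduct.lift_comp_includeRight _ _ fun _ _ => Commute.all _ _
          exact (congrArg (fun t => r'.homEquiv (CommAlgCat.ofHom t)) h).trans
            (r'.homEquiv.apply_symm_apply _) }
  homEquiv_comp g f := Prod.ext
    (r.homEquiv_comp g (CommAlgCat.ofHom (f.hom.comp Algebra.TensorProduct.includeLeft)))
    (r'.homEquiv_comp g (CommAlgCat.ofHom (f.hom.comp Algebra.TensorProduct.includeRight)))

end Corepresentable

/-! ### The kernel of the connecting map and the splitting over it. -/

section Step
variable {G K B A : Type u} [Group G] [TopologicalSpace G] [IsTopologicalGroup G]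
  [CompactSpace G] [Field K] [Field B] [TopologicalSpace B] [IsTopologicalRing B] [T2Space B]
  [Algebra K B] [MulSemiringAction G B] [ContinuousSMul G B] [SMulCommClass G K B]
  [CommRing A] [HopfAlgebra B A] [MulSemiringAction G A] [EquivariantHopf G B A] {n : ℕ}

/-- By naturality it suffices to treat `δ` of the universal class over `O`. -/
theorem exists_ideal_of_connecting {ι : Type} [Fintype ι]
    {y : ι → (level B A (n + 1)).toSubalgebra} {a : G → ι → ι → B}
    (hy : IsLinearCoords (level_le_succ n) y) (ha : IsActionMatrix K y a)
    (hfin : ∃ s : Set (Cochain G K B ι K (1 + 1)), s.Finite ∧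
      (∀ f ∈ s, f ∈ contCocycle a K (1 + 1)) ∧
      contCocycle a K (1 + 1) ≤ Submodule.span K s ⊔ contCoboundary a K 1)
    (δ : h1Functor G K B (level B A n).toSubalgebra ⟶ hGraded G K B A 2 n)
    {O : CommAlgCat.{u} K} (ρ : (h1Functor G K B (level B A n).toSubalgebra).CorepresentableBy O) :
    ∃ I : Ideal O, ∀ (R : CommAlgCat.{u} K) (φ : O ⟶ R),
      (δ.app R (ρ.homEquiv φ) : HN G (Graded B A n (B ⊗[K] R)) 2) = HN.mk (NCocycle.one 2) ↔
        ∀ a ∈ I, φ.hom a = 0 := by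
  obtain ⟨I, hI⟩ := exists_ideal_of_class hy ha 1 hfin (δ.app O (ρ.homEquiv (𝟙 O)))
  refine ⟨I, fun R φ => ?_⟩
  rw [← hI R φ.hom]
  have h1 : (h1Functor G K B (level B A n).toSubalgebra).map φ (ρ.homEquiv (𝟙 O)) =
      ρ.homEquiv φ := by
    rw [← ρ.homEquiv_comp, Category.id_comp]
  have h2 := ConcreteCategory.congr_hom (δ.naturality φ) (ρ.homEquiv (𝟙 O))
  have h3 : δ.app R (ρ.homEquiv φ) =
      hGradedMap G n 2 φ.hom (δ.app O (ρ.homEquiv (𝟙 O))) :=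
    (congrArg (δ.app R) h1.symm).trans h2
  exact Eq.congr_left h3

/-- The kernel of the connecting map is corepresented by a quotient. -/
noncomputable def kernelCorepresentableBy
    (δ : h1Functor G K B (level B A n).toSubalgebra ⟶ hGraded G K B A 2 n)
    {O : CommAlgCat.{u} K} (ρ : (h1Functor G K B (level B A n).toSubalgebra).CorepresentableBy O)
    (I : Ideal O) (hI : ∀ (R : CommAlgCat.{u} K) (φ : O ⟶ R),
      (δ.app R (ρ.homEquiv φ) : HN G (Graded B A n (B ⊗[K] R)) 2) = HN.mk (NCocycle.one 2) ↔
        ∀ a ∈ I, φ.hom a = 0) :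
    (connectingKernel δ).CorepresentableBy (CommAlgCat.of K (O ⧸ I)) where
  homEquiv {R} :=
    { toFun := fun φ => ⟨ρ.homEquiv (CommAlgCat.ofHom (φ.hom.comp (Ideal.Quotient.mkₐ K I))),
        (hI R _).2 fun a h => by
          change φ.hom (Ideal.Quotient.mk I a) = 0
          rw [Ideal.Quotient.eq_zero_iff_mem.2 h, map_zero]⟩
      invFun := fun x => CommAlgCat.ofHom (Ideal.Quotient.liftₐ I (ρ.homEquiv.symm x.1).hom
        ((hI R _).1 (by rw [Equiv.apply_symm_apply]; exact x.2)))
      left_inv := fun φ => by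
        ext : 1
        apply Ideal.Quotient.algHom_ext
        simp only [Equiv.symm_apply_apply, CommAlgCat.hom_ofHom]
        exact Ideal.Quotient.liftₐ_comp _ _ _
      right_inv := fun x => by
        refine Subtype.ext ?_
        simp only [CommAlgCat.hom_ofHom, Ideal.Quotient.liftₐ_comp]
        exact ρ.homEquiv.apply_symm_apply _ }
  homEquiv_comp g f := Subtype.ext (ρ.homEquiv_comp g
    (CommAlgCat.ofHom (f.hom.comp (Ideal.Quotient.mkₐ K I))))

/-- If the kernel of the connecting map is corepresentable, it lifts to `H¹(G, U_{n+1})`. -/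
theorem exists_section
    (δ : h1Functor G K B (level B A n).toSubalgebra ⟶ hGraded G K B A 2 n)
    (hδ : ∀ (R : CommAlgCat.{u} K) (x : H1 G (Points K B (level B A n).toSubalgebra R)),
      (δ.app R x : HN G (Graded B A n (B ⊗[K] R)) 2) = HN.mk (NCocycle.one 2) ↔
        ∃ x', stepApp R x' = x)
    {Q : CommAlgCat.{u} K} (ρ : (connectingKernel δ).CorepresentableBy Q) :
    ∃ σ : connectingKernel δ ⟶ h1Functor G K B (level B A (n + 1)).toSubalgebra,
      ∀ (R : CommAlgCat.{u} K) y, stepApp R (σ.app R y) = y.1 := by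
  -- The universal class of the kernel lifts to a class `x` over `Q`; pulling `x` back along
  -- classifying maps is natural by Yoneda.
  obtain ⟨x, hx⟩ := (hδ Q _).1 (ρ.homEquiv (𝟙 Q)).2
  refine ⟨{
    app := fun R => ↾fun y =>
      (h1Functor G K B (level B A (n + 1)).toSubalgebra).map (ρ.homEquiv.symm y) x
    naturality := fun R R' f => ?_ }, fun R y => ?_⟩
  · ext y
    have h1 : ρ.homEquiv.symm ((connectingKernel δ).map f y) = ρ.homEquiv.symm y ≫ f := by
      rw [Equiv.symm_apply_eq, ρ.homEquiv_comp, Equiv.apply_symm_apply]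
    change (h1Functor G K B (level B A (n + 1)).toSubalgebra).map
      (ρ.homEquiv.symm ((connectingKernel δ).map f y)) x = _
    rw [h1, Functor.map_comp]
    rfl
  · have h1 := ConcreteCategory.congr_hom
      ((h1Step G K B A n).naturality (ρ.homEquiv.symm y)) x
    refine h1.trans ?_
    have h2 : (connectingKernel δ).map (ρ.homEquiv.symm y) (ρ.homEquiv (𝟙 Q)) = y := by
      rw [← ρ.homEquiv_comp, Category.id_comp, Equiv.apply_symm_apply]
    refine Eq.trans ?_ (congrArg Subtype.val h2)
    exact congrArg ((h1Functor G K B (level B A n).toSubalgebra).map (ρ.homEquiv.symm y)) hx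

theorem h1Translate_map {R R' : CommAlgCat.{u} K} (f : R ⟶ R')
    (x : H1 G (Graded B A n (B ⊗[K] R)))
    (y : H1 G (Points K B (level B A (n + 1)).toSubalgebra R)) :
    ((h1Functor G K B (level B A (n + 1)).toSubalgebra).map f (h1Translate x y) :
      H1 G (Points K B (level B A (n + 1)).toSubalgebra R')) =
      h1Translate ((h1Graded G K B A n).map f x)
        ((h1Functor G K B (level B A (n + 1)).toSubalgebra).map f y) := by
  obtain ⟨v, rfl⟩ : ∃ v, H1.mk v = x := Quotient.exists_rep x
  obtain ⟨c, rfl⟩ : ∃ c, H1.mk c = y := Quotient.exists_rep y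
  exact congrArg H1.mk (Cocycle.ext (funext fun g =>
    map_mul (pointsMap f.hom) (v.toFun g).1 (c.toFun g)))

/-- Over the image of `H¹(G, U_{n+1})` each fibre is a torsor under the cohomology of the graded
piece, and `f` chooses a base point in it. -/
theorem bijective_h1Translate {R : Type u} [CommRing R] [Algebra K R]
    {s : (level B A (n + 1)).toSubalgebra →ₐ[B] (level B A n).toSubalgebra} (hs : IsRetraction s)
    (hA : ContinuousOrbits G B (level B A (n + 1)).toSubalgebra)
    (hfix : ∀ (n : ℕ) (v : Graded B A n (B ⊗[K] R)), (∀ g : G, g • v = v) → v = 1)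
    {P : H1 G (Points K B (level B A n).toSubalgebra R) → Prop}
    (hP : ∀ x, P x ↔ ∃ x', stepApp R x' = x)
    (f : {x // P x} → H1 G (Points K B (level B A (n + 1)).toSubalgebra R))
    (hf : ∀ y, stepApp R (f y) = y.1) :
    Function.Bijective fun p : H1 G (Graded B A n (B ⊗[K] R)) × {x // P x} =>
      h1Translate p.1 (f p.2) := by
  constructor
  · rintro ⟨x, y⟩ ⟨x', y'⟩ (h : h1Translate x (f y) = h1Translate x' (f y'))
    have h1 := congrArg (stepApp R) h
    rw [stepApp_h1Translate, stepApp_h1Translate, hf, hf] at h1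
    obtain rfl : y = y' := Subtype.ext h1
    rw [h1Translate_injective hfix h]
  · intro z
    obtain ⟨x, hx⟩ := exists_h1Translate_eq hs hA (hf ⟨stepApp R z, (hP _).2 ⟨z, rfl⟩⟩)
    exact ⟨(x, _), hx⟩

/-- The decomposition of `H¹(G, U_{n+1})` defined by a lift of the kernel of the connecting map. -/
noncomputable def translationIso
    {s : (level B A (n + 1)).toSubalgebra →ₐ[B] (level B A n).toSubalgebra} (hs : IsRetraction s)
    (hA : ContinuousOrbits G B (level B A (n + 1)).toSubalgebra)
    (hfix : ∀ (R : CommAlgCat.{u} K) (n : ℕ) (v : Graded B A n (B ⊗[K] R)),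
      (∀ g : G, g • v = v) → v = 1)
    (δ : h1Functor G K B (level B A n).toSubalgebra ⟶ hGraded G K B A 2 n)
    (hδ : ∀ (R : CommAlgCat.{u} K) (x : H1 G (Points K B (level B A n).toSubalgebra R)),
      (δ.app R x : HN G (Graded B A n (B ⊗[K] R)) 2) = HN.mk (NCocycle.one 2) ↔
        ∃ x', stepApp R x' = x)
    (σ : connectingKernel δ ⟶ h1Functor G K B (level B A (n + 1)).toSubalgebra)
    (hσ : ∀ (R : CommAlgCat.{u} K) y, stepApp R (σ.app R y) = y.1) :
    FunctorToTypes.prod (h1Graded G K B A n) (connectingKernel δ) ≅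
      h1Functor G K B (level B A (n + 1)).toSubalgebra :=
  NatIso.ofComponents (fun R => Equiv.toIso (Equiv.ofBijective
    (fun p : H1 G (Graded B A n (B ⊗[K] R)) × (connectingKernel δ).obj R =>
      (h1Translate p.1 (σ.app R p.2) : H1 G (Points K B (level B A (n + 1)).toSubalgebra R)))
      (bijective_h1Translate hs hA (hfix R) (hδ R) (fun y => σ.app R y) (hσ R))))
    (fun {R R'} f => by
    ext p
    have h1 := ConcreteCategory.congr_hom (σ.naturality f) p.2
    refine (congrArg (h1Translate _) h1).trans ?_
    exact (h1Translate_map f p.1 (σ.app R p.2)).symm)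

end Step

end UnipCoh

namespace UnipCoh

/-! ### Passage to the limit -/

section Glue
variable {B A S : Type u} [Field B] [CommRing A] [HopfAlgebra B A] [CommRing S] [Algebra B S]

theorem points_ext_of_level (hunip : IsProUnipotent B A) {u v : WithConv (A →ₐ[B] S)}
    (h : ∀ n, restrictTopHom S (level B A n) u = restrictTopHom S (level B A n) v) : u = v := by
  apply WithConv.ext
  ext a
  obtain ⟨n, hn⟩ := exists_mem_level hunip a
  exact DFunLike.congr_fun (congrArg WithConv.ofConv (h n)) ⟨a, hn⟩

/-- The levels are an increasing chain with union `A`, so compatible algebra maps on them define one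
on `A`. -/
theorem exists_glue (hunip : IsProUnipotent B A)
    (u : ∀ n, WithConv ((level B A n).toSubalgebra →ₐ[B] S))
    (hu : ∀ n, restrictHom S (level_le_succ n) (u (n + 1)) = u n) :
    ∃ w : WithConv (A →ₐ[B] S), ∀ n, restrictTopHom S (level B A n) w = u n := by
  have hmono : Monotone fun n => (level B A n).toSubalgebra := monotone_nat_of_le_succ level_le_succ
  have hcompat : ∀ (i j : ℕ) (h : (level B A i).toSubalgebra ≤ (level B A j).toSubalgebra)
      (_ : i ≤ j), (u i).ofConv = (u j).ofConv.comp (Subalgebra.inclusion h) := by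
    intro i j h hij
    induction j, hij using Nat.le_induction with
    | base => rfl
    | succ j hij ih =>
      rw [ih (hmono hij), ← hu j]
      rfl
  have htop : (⊤ : Subalgebra B A) ≤ ⨆ n, (level B A n).toSubalgebra :=
    fun a _ => by
      obtain ⟨n, hn⟩ := exists_mem_level hunip a
      exact le_iSup (fun n => (level B A n).toSubalgebra) n hn
  let f := Subalgebra.iSupLift (fun n => (level B A n).toSubalgebra) hmono.directed_le
    (fun n => (u n).ofConv) (fun i j h => by
      rcases le_total i j with hij | hij
      · exact hcompat i j h hij
      · have h' := hmono hij
        rw [hcompat j i h' hij]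
        rfl) ⊤ htop
  refine ⟨.toConv (f.comp Subalgebra.topEquiv.symm.toAlgHom), fun n => WithConv.ext ?_⟩
  ext a
  change f ⟨a.1, Algebra.mem_top⟩ = (u n).ofConv a
  simp only [f]
  exact Subalgebra.iSupLift_of_mem (i := n) _ _ a.2

end Glue

/-! ### Comparison of `H¹(G, U)` with the limit of the `H¹(G, U_n)`. -/

section Limit
variable {G K B A R : Type u} [Group G] [TopologicalSpace G] [IsTopologicalGroup G]
  [CompactSpace G] [Field K] [Field B] [TopologicalSpace B] [IsTopologicalRing B] [T2Space B]
  [Algebra K B] [MulSemiringAction G B] [ContinuousSMul G B] [SMulCommClass G K B]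
  [CommRing A] [HopfAlgebra B A] [MulSemiringAction G A] [EquivariantHopf G B A]
  [CommRing R] [Algebra K R]

variable (R) in
/-- The map `H¹(G, U(B ⊗_K R)) → H¹(G, U_n(B ⊗_K R))`. -/
noncomputable abbrev restrictApp (n : ℕ) :
    H1 G (Points K B A R) → H1 G (Points K B (level B A n).toSubalgebra R) :=
  H1.map (restrictTopHom (B ⊗[K] R) (level B A n)) (continuous_restrictTopHom _)
    (restrictTopHom_smul n)

theorem stepApp_restrictApp (n : ℕ) (x : H1 G (Points K B A R)) :
    stepApp R (restrictApp R (n + 1) x) = restrictApp R n x := by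
  obtain ⟨c, rfl⟩ : ∃ c, H1.mk c = x := Quotient.exists_rep x
  rfl

/-- On each `U_n` some element relates the two cocycles. Such an element is unique, since two of
them differ by a twisted invariant, so the elements are compatible and glue to a point of `U`. -/
theorem eq_of_restrictApp_eq (hunip : IsProUnipotent B A)
    (hfix : ∀ (n : ℕ) (v : Graded B A n (B ⊗[K] R)), (∀ g : G, g • v = v) → v = 1)
    {x x' : H1 G (Points K B A R)} (h : ∀ n, restrictApp R n x = restrictApp R n x') : x = x' := by
  obtain ⟨c, rfl⟩ : ∃ c, H1.mk c = x := Quotient.exists_rep x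
  obtain ⟨c', rfl⟩ : ∃ c, H1.mk c = x' := Quotient.exists_rep x'
  have h1 : ∀ n, ∃ u : Points K B (level B A n).toSubalgebra R, ∀ g,
      restrictTopHom (B ⊗[K] R) (level B A n) (c'.toFun g) =
        u * restrictTopHom (B ⊗[K] R) (level B A n) (c.toFun g) * g • u⁻¹ :=
    fun n => Quotient.exact (h n)
  choose u hu using h1
  have hcompat : ∀ n, restrictHom (B ⊗[K] R) (level_le_succ n) (u (n + 1)) = u n := by
    intro n
    set w := restrictHom (B ⊗[K] R) (level_le_succ n) (u (n + 1)) with hw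
    have h2 : ∀ g, restrictTopHom (B ⊗[K] R) (level B A n) (c'.toFun g) =
        w * restrictTopHom (B ⊗[K] R) (level B A n) (c.toFun g) * g • w⁻¹ := fun g => by
      have := congrArg (restrictHom (B ⊗[K] R) (level_le_succ n)) (hu (n + 1) g)
      rwa [map_mul, map_mul, restrictHom_smul, map_inv] at this
    let d : Cocycle G (Points K B (level B A n).toSubalgebra R) :=
      Cocycle.map (restrictTopHom (B ⊗[K] R) (level B A n)) (continuous_restrictTopHom _)
        (restrictTopHom_smul n) c
    -- Both `u n` and the image `w` of `u (n + 1)` carry the restriction of `c` to that of `c'`, so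
    -- the quotient is fixed by the action twisted by `c`.
    have h3 : (u n)⁻¹ * w = 1 := by
      refine eq_one_of_twisted_fixed hfix n d fun g => ?_
      change restrictTopHom (B ⊗[K] R) (level B A n) (c.toFun g) = (u n)⁻¹ * w *
        restrictTopHom (B ⊗[K] R) (level B A n) (c.toFun g) * g • ((u n)⁻¹ * w)⁻¹
      have h4 := (hu n g).symm.trans (h2 g)
      rw [mul_inv_rev, inv_inv, smul_mul', mul_assoc (u n)⁻¹ w, mul_assoc (u n)⁻¹,
        ← mul_assoc _ _ (g • u n), ← h4, smul_inv',
        inv_mul_cancel_right, inv_mul_cancel_left]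
    exact (inv_mul_eq_one.1 h3).symm
  obtain ⟨w, hw⟩ := exists_glue hunip u hcompat
  refine Quotient.sound ⟨w, fun g => points_ext_of_level hunip fun n => ?_⟩
  rw [map_mul, map_mul, restrictTopHom_smul, map_inv, hw, hu]

/-- Any representative of `x` lies over `c` up to a coboundary; twisting it by a lift of the
bounding element makes it lie over `c` exactly. -/
theorem exists_stepCocycle_eq {n : ℕ}
    {s : (level B A (n + 1)).toSubalgebra →ₐ[B] (level B A n).toSubalgebra} (hs : IsRetraction s)
    (hA : ContinuousOrbits G B (level B A (n + 1)).toSubalgebra)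
    (c : Cocycle G (Points K B (level B A n).toSubalgebra R))
    (x : H1 G (Points K B (level B A (n + 1)).toSubalgebra R)) (hx : stepApp R x = H1.mk c) :
    ∃ c', H1.mk c' = x ∧ stepCocycle c' = c := by
  obtain ⟨d, rfl⟩ : ∃ c, H1.mk c = x := Quotient.exists_rep x
  obtain ⟨u, hu⟩ : ∃ u, ∀ g, c.toFun g =
    u * (stepCocycle d).toFun g * g • u⁻¹ := Quotient.exact hx
  refine ⟨twistCocycle hA (liftPoint s u) d, (H1_mk_twistCocycle hA _ d).symm,
    Cocycle.ext (funext fun g => ?_)⟩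
  rw [hu]
  change restrictHom (B ⊗[K] R) (level_le_succ n)
    (liftPoint s u * d.toFun g * g • (liftPoint s u)⁻¹) = _
  rw [map_mul, map_mul, restrictHom_smul, map_inv, restrictHom_liftPoint hs]
  rfl

theorem exists_restrictApp_eq (hunip : IsProUnipotent B A)
    (hret : ∀ n, ∃ s : (level B A (n + 1)).toSubalgebra →ₐ[B] (level B A n).toSubalgebra,
      IsRetraction s) (hA : ContinuousOrbits G B A)
    (x : ∀ n, H1 G (Points K B (level B A n).toSubalgebra R))
    (hx : ∀ n, stepApp R (x (n + 1)) = x n) : ∃ z, ∀ n, restrictApp R n z = x n := by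
  have hstep : ∀ n (c : {c // H1.mk c = x n}),
      ∃ c' : {c // H1.mk c = x (n + 1)}, stepCocycle c'.1 = c.1 := fun n c => by
    obtain ⟨s, hs⟩ := hret n
    obtain ⟨c', h1, h2⟩ := exists_stepCocycle_eq hs (hA.level (n + 1)) c.1 (x (n + 1))
      ((hx n).trans c.2.symm)
    exact ⟨⟨c', h1⟩, h2⟩
  choose next hnext using hstep
  obtain ⟨c₀, hc₀⟩ : ∃ c, H1.mk c = x 0 := Quotient.exists_rep (x 0)
  -- Each chosen cocycle restricts to the preceding one on the nose, so the values glue for each `g`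
  -- separately.
  let c : ∀ n, {c // H1.mk c = x n} := fun n => Nat.rec ⟨c₀, hc₀⟩ next n
  have hc : ∀ n g, restrictHom (B ⊗[K] R) (level_le_succ n) ((c (n + 1)).1.toFun g) =
      (c n).1.toFun g := fun n g => congrFun (congrArg Cocycle.toFun (hnext n (c n))) g
  choose w hw using fun g => exists_glue hunip (fun n => (c n).1.toFun g) fun n => hc n g
  let z : Cocycle G (Points K B A R) :=
    { toFun := w
      -- Continuity is tested on one function at a time, and each function comes from some `U_n`.
      continuous_toFun := by
        rw [continuous_points_iff]
        intro a
        obtain ⟨n, hn⟩ := exists_mem_level hunip a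
        have h1 := continuous_points_iff.1 (c n).1.continuous_toFun ⟨a, hn⟩
        simp only [← hw] at h1
        exact h1
      map_mul := fun g h => points_ext_of_level hunip fun n => by
        rw [map_mul, restrictTopHom_smul, hw, hw, hw, (c n).1.map_mul] }
  exact ⟨H1.mk z, fun n => (congrArg H1.mk (Cocycle.ext (funext fun g => hw g n))).trans (c n).2⟩

end Limit

end UnipCoh

namespace UnipCoh

/-! ### Representability -/

section Representability
variable {G K B A : Type u} [Group G] [TopologicalSpace G] [IsTopologicalGroup G]
  [CompactSpace G] [Field K] [Field B] [TopologicalSpace B] [IsTopologicalRing B] [T2Space B]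
  [Algebra K B] [MulSemiringAction G B] [ContinuousSMul G B] [SMulCommClass G K B]
  [CommRing A] [HopfAlgebra B A] [MulSemiringAction G A] [EquivariantHopf G B A]

-- The kernel is central, hence commutative, hence a vector group. The matrices are chosen for each
-- `g` separately, and no continuity in `g` is required of them.
variable (G K) in
theorem exists_coords [CharZero B] (hunip : IsProUnipotent B A) (n : ℕ)
    (hfg : Algebra.FiniteType B (level B A (n + 1)).toSubalgebra) :
    ∃ (ι : Type) (_ : Fintype ι) (y : ι → (level B A (n + 1)).toSubalgebra) (a : G → ι → ι → B),
      IsLinearCoords (level_le_succ n) y ∧ IsActionMatrix K y a := by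
  obtain ⟨ι, hι, y, hy⟩ := (tower_of_finiteType hunip (level_le_succ n) hfg).exists_isLinearCoords
    hunip fun S _ _ v w _ hw => (level_succ_isCentralOver (B := B) (A := A) n).2 S v w hw
  have := Fintype.ofFinite ι
  choose a ha using exists_matrix (G := G) K hy
  exact ⟨ι, this, y, a, hy, ha⟩

/-- The connecting map exists and is exact. -/
theorem exists_connecting [CharZero B] (hA : ContinuousOrbits G B A) (hunip : IsProUnipotent B A)
    (hfg : ∀ n, Algebra.FiniteType B (level B A n).toSubalgebra) (n : ℕ) :
    ∃ δ : h1Functor G K B (level B A n).toSubalgebra ⟶ hGraded G K B A 2 n,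
      IsConnectingMap n δ ∧
      ∀ (R : CommAlgCat.{u} K) (x : H1 G (Points K B (level B A n).toSubalgebra R)),
        (δ.app R x : HN G (Graded B A n (B ⊗[K] R)) 2) = HN.mk (NCocycle.one 2) ↔
          ∃ x', stepApp R x' = x := by
  obtain ⟨ι, _, y, a, hy, ha⟩ := exists_coords G K hunip n (hfg (n + 1))
  obtain ⟨s, hs⟩ := exists_isRetraction hunip (hfg (n + 1))
  exact ⟨connectingMap hs (hA.level (n + 1)), isConnectingMap_connectingMap hs _,
    fun R x => connectingApp_eq_one_iff hy ha hs _ x⟩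

/-- The group `U_0` is trivial, so its cohomology is a single point. -/
theorem exists_corepresentableBy_level_zero :
    Nonempty ((h1Functor G K B (level B A 0).toSubalgebra).CorepresentableBy
      (CommAlgCat.of K K)) := by
  have h1 : ∀ (R : CommAlgCat.{u} K) (u : Points K B (level B A 0).toSubalgebra R), u = 1 := by
    intro R u
    rw [conv_eq_iff_one]
    rintro ⟨_, b, rfl⟩
    exact (u.ofConv.commutes b).trans (congrArg _ ((counitAlgHom B A).commutes b).symm)
  let c₀ : ∀ R : CommAlgCat.{u} K, Cocycle G (Points K B (level B A 0).toSubalgebra R) :=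
    fun R => ⟨1, continuous_const, fun _ _ => (h1 R _).trans (h1 R _).symm⟩
  have h2 : ∀ (R : CommAlgCat.{u} K) (x : H1 G (Points K B (level B A 0).toSubalgebra R)),
      x = H1.mk (c₀ R) := by
    intro R x
    obtain ⟨c, rfl⟩ : ∃ c, H1.mk c = x := Quotient.exists_rep x
    exact congrArg H1.mk (Cocycle.ext (funext fun g => h1 R _))
  exact ⟨{
    homEquiv := fun {R} =>
      { toFun := fun _ => H1.mk (c₀ R)
        invFun := fun _ => CommAlgCat.ofHom (Algebra.ofId K R)
        left_inv := fun φ => by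
          ext : 1
          exact Subsingleton.elim (α := K →ₐ[K] R) _ _
        right_inv := fun x => (h2 R x).symm }
    homEquiv_comp := fun {R R'} g f => (h2 R' _).symm }⟩

/-- The decomposition of `H¹(G, U_{n+1})`, given that of `H¹(G, U_n)`. -/
theorem exists_translationIso [CharZero B]
    (hA : ContinuousOrbits G B A) (hunip : IsProUnipotent B A)
    (hfg : ∀ n, Algebra.FiniteType B (level B A n).toSubalgebra)
    (hfix : ∀ (R : CommAlgCat.{u} K) (n : ℕ) (v : Graded B A n (B ⊗[K] R)),
      (∀ g : G, g • v = v) → v = 1) {n : ℕ}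
    {δ : h1Functor G K B (level B A n).toSubalgebra ⟶ hGraded G K B A 2 n}
    (hδ : ∀ (R : CommAlgCat.{u} K) (x : H1 G (Points K B (level B A n).toSubalgebra R)),
      (δ.app R x : HN G (Graded B A n (B ⊗[K] R)) 2) = HN.mk (NCocycle.one 2) ↔
        ∃ x', stepApp R x' = x)
    {Q : CommAlgCat.{u} K} (ρ : (connectingKernel δ).CorepresentableBy Q) :
    ∃ e : FunctorToTypes.prod (h1Graded G K B A n) (connectingKernel δ) ≅
        h1Functor G K B (level B A (n + 1)).toSubalgebra,
      (∀ (R : CommAlgCat.{u} K) (x : (h1Graded G K B A n).obj R)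
        (y : (connectingKernel δ).obj R),
        (h1Step G K B A n).app R (e.hom.app R (x, y)) = y.1) ∧
      (∀ (R : CommAlgCat.{u} K) (v w w' : Cocycle G (Graded B A n (B ⊗[K] R)))
        (c c' : Cocycle G (Points K B (level B A (n + 1)).toSubalgebra R))
        (y : (connectingKernel δ).obj R),
        (∀ g, w'.toFun g = v.toFun g * w.toFun g) →
        (∀ g, c'.toFun g = (v.toFun g).1 * c.toFun g) →
        e.hom.app R (H1.mk w, y) = H1.mk c →
        e.hom.app R (H1.mk w', y) = H1.mk c') := by
  obtain ⟨s, hs⟩ := exists_isRetraction hunip (hfg (n + 1))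
  obtain ⟨σ, hσ⟩ := exists_section δ hδ ρ
  refine ⟨translationIso hs (hA.level (n + 1)) hfix δ hδ σ hσ, fun R x y => ?_,
    fun R v w w' c c' y hw hc h => ?_⟩
  · exact (stepApp_h1Translate (x : H1 G (Graded B A n (B ⊗[K] R))) (σ.app R y)).trans (hσ R y)
  · obtain ⟨d, hd⟩ : ∃ d, H1.mk d = σ.app R y := Quotient.exists_rep _
    have h1 : ∀ w : Cocycle G (Graded B A n (B ⊗[K] R)),
        h1Translate (H1.mk w) (σ.app R y) = H1.mk (translate w d) := fun w => by rw [← hd]; rfl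
    have h2 : H1.mk (translate w d) = H1.mk c := (h1 w).symm.trans h
    have h3 : translate w' d = translate v (translate w d) := Cocycle.ext (funext fun g => by
      change (w'.toFun g).1 * d.toFun g = (v.toFun g).1 * ((w.toFun g).1 * d.toFun g)
      rw [hw, ← mul_assoc]
      rfl)
    have h4 : c' = translate v c := Cocycle.ext (funext hc)
    refine (h1 w').trans ?_
    rw [h3, h4]
    exact H1_mk_translate_eq rfl h2

theorem exists_corepresentableBy_step [CharZero B]
    [FiniteDimensional K (FixedPoints.intermediateField (F := K) (E := B) G)]
    (hunip : IsProUnipotent B A)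
    (hfg : ∀ n, Algebra.FiniteType B (level B A n).toSubalgebra) (n : ℕ)
    (hfin : FiniteDimensionalCohomology G K B A 1 n) :
    ∃ d : ℕ, Nonempty ((h1Graded G K B A n).CorepresentableBy
        (CommAlgCat.of K (MvPolynomial (Fin d) K))) := by
  obtain ⟨ι, _, y, a, hy, ha⟩ := exists_coords G K hunip n (hfg (n + 1))
  exact exists_corepresentableBy_h1Graded hy ha
    (exists_finite_span_of_finiteDimensionalCohomology hy ha 0 hfin)

theorem exists_ideal_of_connectingMap [CharZero B]
    [FiniteDimensional K (FixedPoints.intermediateField (F := K) (E := B) G)]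
    (hunip : IsProUnipotent B A)
    (hfg : ∀ n, Algebra.FiniteType B (level B A n).toSubalgebra) (n : ℕ)
    (hfin : FiniteDimensionalCohomology G K B A 2 n)
    (δ : h1Functor G K B (level B A n).toSubalgebra ⟶ hGraded G K B A 2 n)
    {O : CommAlgCat.{u} K} (ρ : (h1Functor G K B (level B A n).toSubalgebra).CorepresentableBy O) :
    ∃ I : Ideal O, ∀ (R : CommAlgCat.{u} K) (φ : O ⟶ R),
      (δ.app R (ρ.homEquiv φ) : HN G (Graded B A n (B ⊗[K] R)) 2) = HN.mk (NCocycle.one 2) ↔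
        ∀ a ∈ I, φ.hom a = 0 := by
  obtain ⟨ι, _, y, a, hy, ha⟩ := exists_coords G K hunip n (hfg (n + 1))
  exact exists_ideal_of_connecting hy ha
    (exists_finite_span_of_finiteDimensionalCohomology hy ha 1 hfin) δ ρ

theorem graded_eq_one_of_forall_smul_eq [CharZero B] (hunip : IsProUnipotent B A)
    (hfg : ∀ n, Algebra.FiniteType B (level B A n).toSubalgebra)
    (hH0 : ∀ (n : ℕ) (v : Graded B A n (B ⊗[K] K)), (∀ g : G, g • v = v) → v = 1)
    (R : CommAlgCat.{u} K) (n : ℕ) (v : Graded B A n (B ⊗[K] R)) (hv : ∀ g : G, g • v = v) :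
    v = 1 := by
  obtain ⟨ι, _, y, a, hy, ha⟩ := exists_coords G K hunip n (hfg (n + 1))
  exact graded_eq_one_of_fixed hy ha (hH0 n) hv

/-- Inductively the next algebra is `K[X_1, …, X_d] ⊗ (O / I)`: the affine space `H¹(G, V_n)` times
the closed kernel of the connecting map in `Spec O`. It is again of finite type. -/
theorem exists_corepresentableBy_level [CharZero B]
    [FiniteDimensional K (FixedPoints.intermediateField (F := K) (E := B) G)]
    (hA : ContinuousOrbits G B A) (hunip : IsProUnipotent B A)
    (hfg : ∀ n, Algebra.FiniteType B (level B A n).toSubalgebra)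
    (hfin : ∀ j n, FiniteDimensionalCohomology G K B A j n)
    (hH0 : ∀ (n : ℕ) (v : Graded B A n (B ⊗[K] K)), (∀ g : G, g • v = v) → v = 1) (n : ℕ) :
    ∃ O : CommAlgCat.{u} K, Algebra.FiniteType K O ∧
      Nonempty ((h1Functor G K B (level B A n).toSubalgebra).CorepresentableBy O) := by
  induction n with
  | zero => exact ⟨_, inferInstanceAs (Algebra.FiniteType K K), exists_corepresentableBy_level_zero⟩
  | succ n ih =>
    obtain ⟨O, hO, ⟨ρ⟩⟩ := ih
    obtain ⟨δ, -, hδ⟩ := exists_connecting (K := K) hA hunip hfg n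
    obtain ⟨I, hI⟩ := exists_ideal_of_connectingMap hunip hfg n (hfin 2 n) δ ρ
    have ρ' := kernelCorepresentableBy δ ρ I hI
    obtain ⟨e, -⟩ := exists_translationIso hA hunip hfg
      (graded_eq_one_of_forall_smul_eq hunip hfg hH0) hδ ρ'
    obtain ⟨d, ⟨r⟩⟩ := exists_corepresentableBy_step (K := K) hunip hfg n (hfin 1 n)
    refine ⟨_, ?_, ⟨(prodCorepresentableBy r ρ').ofIso e⟩⟩
    have : Algebra.FiniteType K (O ⧸ I) := inferInstance
    exact Algebra.FiniteType.trans (S := MvPolynomial (Fin d) K)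
      (A := MvPolynomial (Fin d) K ⊗[K] (O ⧸ I)) inferInstance inferInstance

end Representability

/-! ### The direct system of representing algebras and its colimit. -/

section Colimit
variable {G K B A : Type u} [Group G] [TopologicalSpace G] [IsTopologicalGroup G]
  [CompactSpace G] [Field K] [Field B] [TopologicalSpace B] [IsTopologicalRing B] [T2Space B]
  [Algebra K B] [MulSemiringAction G B] [ContinuousSMul G B] [SMulCommClass G K B]
  [CommRing A] [HopfAlgebra B A] [MulSemiringAction G A] [EquivariantHopf G B A]

/-- The algebras corepresenting `H¹(G, U_n)` form a direct system. -/
theorem exists_system {O : ℕ → CommAlgCat.{u} K} (hO : ∀ n, Algebra.FiniteType K (O n))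
    (ρ : ∀ n, (h1Functor G K B (level B A n).toSubalgebra).CorepresentableBy (O n)) :
    ∃ (𝓞 : ℕ ⥤ CommAlgCat.{u} K) (_ : ∀ n, Algebra.FiniteType K (𝓞.obj n))
      (ρ' : ∀ n, (h1Functor G K B (level B A n).toSubalgebra).CorepresentableBy (𝓞.obj n)),
      ∀ (n : ℕ) (R : CommAlgCat.{u} K) (φ : 𝓞.obj (n + 1) ⟶ R),
        (h1Step G K B A n).app R ((ρ' (n + 1)).homEquiv φ) =
          (ρ' n).homEquiv (𝓞.map (homOfLE n.le_succ) ≫ φ) := by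
  -- By Yoneda the transition map classifies the image of the universal class.
  let t : ∀ n, O n ⟶ O (n + 1) := fun n =>
    (ρ n).homEquiv.symm ((h1Step G K B A n).app _ ((ρ (n + 1)).homEquiv (𝟙 _)))
  have key : ∀ (n : ℕ) (R : CommAlgCat.{u} K) (φ : O (n + 1) ⟶ R),
      (h1Step G K B A n).app R ((ρ (n + 1)).homEquiv φ) = (ρ n).homEquiv (t n ≫ φ) := by
    intro n R φ
    have h2 : (ρ (n + 1)).homEquiv φ =
        (h1Functor G K B (level B A (n + 1)).toSubalgebra).map φ ((ρ (n + 1)).homEquiv (𝟙 _)) := by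
      rw [← (ρ (n + 1)).homEquiv_comp, Category.id_comp]
    rw [(ρ n).homEquiv_comp, Equiv.apply_symm_apply, h2]
    exact ConcreteCategory.congr_hom ((h1Step G K B A n).naturality φ) _
  exact ⟨Functor.ofSequence t, hO, ρ, fun n R φ => (key n R φ).trans
    (congrArg (fun f => (ρ n).homEquiv (f ≫ φ)) (Functor.ofSequence_map_homOfLE_succ t n).symm)⟩

/-- `H¹(G, U)` is corepresented by the colimit. -/
theorem exists_corepresentableBy_colimit (hA : ContinuousOrbits G B A)
    (hunip : IsProUnipotent B A)
    (hret : ∀ n, ∃ s : (level B A (n + 1)).toSubalgebra →ₐ[B] (level B A n).toSubalgebra,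
      IsRetraction s)
    (hfix : ∀ (R : CommAlgCat.{u} K) (n : ℕ) (v : Graded B A n (B ⊗[K] R)),
      (∀ g : G, g • v = v) → v = 1)
    (𝓞 : ℕ ⥤ CommAlgCat.{u} K)
    (ρ : ∀ n, (h1Functor G K B (level B A n).toSubalgebra).CorepresentableBy (𝓞.obj n))
    (hρ : ∀ (n : ℕ) (R : CommAlgCat.{u} K) (φ : 𝓞.obj (n + 1) ⟶ R),
        (h1Step G K B A n).app R ((ρ (n + 1)).homEquiv φ) =
          (ρ n).homEquiv (𝓞.map (homOfLE n.le_succ) ≫ φ))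
    {X : Cocone 𝓞} (hX : IsColimit X) :
    ∃ ρU : (h1Functor G K B A).CorepresentableBy X.pt,
      ∀ (n : ℕ) (R : CommAlgCat.{u} K) (φ : X.pt ⟶ R),
        (h1Restrict G K B A n).app R (ρU.homEquiv φ) = (ρ n).homEquiv (X.ι.app n ≫ φ) := by
  let p : ∀ (R : CommAlgCat.{u} K) (_ : H1 G (Points K B A R)) (n : ℕ), 𝓞.obj n ⟶ R :=
    fun R x n => (ρ n).homEquiv.symm (restrictApp R n x)
  have hpe : ∀ (R : CommAlgCat.{u} K) (x : H1 G (Points K B A R)) (n : ℕ),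
      (ρ n).homEquiv (p R x n) = restrictApp R n x := fun R x n =>
    (ρ n).homEquiv.apply_symm_apply _
  have hp : ∀ (R : CommAlgCat.{u} K) (x : H1 G (Points K B A R)) (n : ℕ),
      𝓞.map (homOfLE n.le_succ) ≫ p R x (n + 1) = p R x n := by
    intro R x n
    apply (ρ n).homEquiv.injective
    refine (hρ n R _).symm.trans ?_
    refine (congrArg ((h1Step G K B A n).app R) (hpe R x (n + 1))).trans ?_
    exact (stepApp_restrictApp n x).trans (hpe R x n).symm
  let cc : ∀ (R : CommAlgCat.{u} K), H1 G (Points K B A R) → Cocone 𝓞 := fun R x =>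
    { pt := R
      ι := NatTrans.ofSequence (p R x) fun n => (hp R x n).trans (Category.comp_id _).symm }
  let ev : ∀ (R : CommAlgCat.{u} K), H1 G (Points K B A R) → (X.pt ⟶ R) := fun R x =>
    hX.desc (cc R x)
  have hev : ∀ (R : CommAlgCat.{u} K) (x : H1 G (Points K B A R)) (n : ℕ),
      (ρ n).homEquiv (X.ι.app n ≫ ev R x) = restrictApp R n x := by
    intro R x n
    have : X.ι.app n ≫ ev R x = p R x n := hX.fac (cc R x) n
    rw [this, hpe]
  -- A map from the colimit to `R` is a compatible family of classes in the `H¹(G, U_n)`, so this is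
  -- the identification of `H¹(G, U)` with the limit.
  have hbij : ∀ R : CommAlgCat.{u} K, Function.Bijective (ev R) := by
    intro R
    constructor
    · intro x x' h
      refine eq_of_restrictApp_eq hunip (hfix R) fun n => ?_
      rw [← hev, ← hev, h]
    · intro φ
      obtain ⟨z, hz⟩ := exists_restrictApp_eq (R := R) hunip hret hA
        (fun n => (ρ n).homEquiv (X.ι.app n ≫ φ)) fun n => by
          refine (hρ n R _).trans ?_
          rw [← Category.assoc, X.w]
      refine ⟨z, hX.hom_ext fun n => (ρ n).homEquiv.injective ?_⟩
      rw [hev, hz]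
  let E : ∀ R : CommAlgCat.{u} K, (X.pt ⟶ R) ≃ (h1Functor G K B A).obj R := fun R =>
    (Equiv.ofBijective (ev R) (hbij R)).symm
  have hE : ∀ (R : CommAlgCat.{u} K) (x : H1 G (Points K B A R)), E R (ev R x) = x := fun R x =>
    (Equiv.ofBijective (ev R) (hbij R)).symm_apply_apply x
  refine ⟨{ homEquiv := fun {R} => E R
            homEquiv_comp := fun {R R'} g f => ?_ }, fun n R φ => ?_⟩
  · obtain ⟨x, rfl⟩ := (hbij R).2 f
    have h1 : ev R x ≫ g = ev R' ((h1Functor G K B A).map g x) := by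
      refine hX.hom_ext fun n => (ρ n).homEquiv.injective ?_
      refine Eq.trans ?_ (hev R' _ n).symm
      rw [← Category.assoc, (ρ n).homEquiv_comp, hev]
      exact (ConcreteCategory.congr_hom ((h1Restrict G K B A n).naturality g) x).symm
    exact (congrArg (E R') h1).trans ((hE R' _).trans
      (congrArg ((h1Functor G K B A).map g) (hE R x).symm))
  · obtain ⟨x, rfl⟩ := (hbij R).2 φ
    exact (congrArg ((h1Restrict G K B A n).app R) (hE R x)).trans (hev R x n).symm

end Colimit

end UnipCoh

/-! ### The representability theorem. -/

theorem proposition2 {K B G A : Type u}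
    [Group G] [TopologicalSpace G] [IsTopologicalGroup G] [CompactSpace G]
    [Field B] [UniformSpace B] [IsUniformAddGroup B] [IsTopologicalDivisionRing B]
    [CompleteSpace B] [T2Space B] [CharZero B]
    [MulSemiringAction G B] [ContinuousSMul G B]
    [Field K] [Algebra K B] [SMulCommClass G K B]
    [FiniteDimensional K (FixedPoints.intermediateField (F := K) (E := B) G)]
    [CommRing A] [HopfAlgebra B A] [MulSemiringAction G A] [EquivariantHopf G B A]
    (hcont : HasContinuousAction G B A) (hunip : IsProUnipotent B A)
    (hfg : ∀ n, Algebra.FiniteType B (level B A n).toSubalgebra)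
    (hfin : ∀ j n, FiniteDimensionalCohomology G K B A j n)
    (hH0 : ∀ (n : ℕ) (v : Graded B A n (B ⊗[K] K)), (∀ g : G, g • v = v) → v = 1) :
    ∃ (𝓞 : ℕ ⥤ CommAlgCat.{u} K)
      (ρ : ∀ n, (h1Functor G K B (level B A n).toSubalgebra).CorepresentableBy (𝓞.obj n))
      (X : Cocone 𝓞) (_ : IsColimit X) (ρU : (h1Functor G K B A).CorepresentableBy X.pt)
      (δ : ∀ n, h1Functor G K B (level B A n).toSubalgebra ⟶ hGraded G K B A 2 n)
      (e : ∀ n, FunctorToTypes.prod (h1Graded G K B A n) (connectingKernel (δ n)) ≅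
        h1Functor G K B (level B A (n + 1)).toSubalgebra),
      -- each level is an affine variety
      (∀ n, Algebra.FiniteType K (𝓞.obj n)) ∧
      -- the transition maps and the projections are the ones induced by `U → U_{n+1} → U_n`
      (∀ (n : ℕ) (R : CommAlgCat.{u} K) (φ : 𝓞.obj (n + 1) ⟶ R),
        (h1Step G K B A n).app R ((ρ (n + 1)).homEquiv φ) =
          (ρ n).homEquiv (𝓞.map (homOfLE n.le_succ) ≫ φ)) ∧
      (∀ (n : ℕ) (R : CommAlgCat.{u} K) (φ : X.pt ⟶ R),
        (h1Restrict G K B A n).app R (ρU.homEquiv φ) = (ρ n).homEquiv (X.ι.app n ≫ φ)) ∧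
      -- `δ n` is the connecting map, and its kernel is a closed subvariety
      (∀ n, IsConnectingMap n (δ n)) ∧
      (∀ n, ∃ I : Ideal (𝓞.obj n), ∀ (R : CommAlgCat.{u} K) (φ : 𝓞.obj n ⟶ R),
        (∃ y : (connectingKernel (δ n)).obj R, y.1 = (ρ n).homEquiv φ) ↔ ∀ a ∈ I, φ.hom a = 0) ∧
      -- `H¹(G, U^{n+1} / U^{n+2})` is an affine space
      (∀ n, ∃ d : ℕ, Nonempty ((h1Graded G K B A n).CorepresentableBy
        (CommAlgCat.of K (MvPolynomial (Fin d) K)))) ∧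
      -- `e n` is compatible with the projection to `H¹(G, U_n)` and with translation by cocycles
      (∀ (n : ℕ) (R : CommAlgCat.{u} K) (x : (h1Graded G K B A n).obj R)
        (y : (connectingKernel (δ n)).obj R),
        (h1Step G K B A n).app R ((e n).hom.app R (x, y)) = y.1) ∧
      (∀ (n : ℕ) (R : CommAlgCat.{u} K) (v w w' : Cocycle G (Graded B A n (B ⊗[K] R)))
        (c c' : Cocycle G (Points K B (level B A (n + 1)).toSubalgebra R))
        (y : (connectingKernel (δ n)).obj R),
        (∀ g, w'.toFun g = v.toFun g * w.toFun g) →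
        (∀ g, c'.toFun g = (v.toFun g).1 * c.toFun g) →
        (e n).hom.app R (H1.mk w, y) = H1.mk c →
        (e n).hom.app R (H1.mk w', y) = H1.mk c') := by
  have hA := hcont.continuousOrbits
  have hfix := graded_eq_one_of_forall_smul_eq (K := K) hunip hfg hH0
  choose O hO hρ using exists_corepresentableBy_level (K := K) hA hunip hfg hfin hH0
  obtain ⟨𝓞, h𝓞, ρ, hstep⟩ := exists_system hO fun n => (hρ n).some
  obtain ⟨ρU, hρU⟩ := exists_corepresentableBy_colimit hA hunip
    (fun n => exists_isRetraction hunip (hfg (n + 1))) hfix 𝓞 ρ hstep (colimit.isColimit 𝓞)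
  -- The inductive construction of the algebras retains neither connecting maps nor ideals; both are
  -- chosen here, the ideals for the representations `ρ` of the direct system.
  choose δ hδ hexact using exists_connecting (K := K) hA hunip hfg
  choose I hI using fun n => exists_ideal_of_connectingMap hunip hfg n (hfin 2 n) (δ n) (ρ n)
  choose e he₁ he₂ using fun n => exists_translationIso hA hunip hfg hfix (hexact n)
    (kernelCorepresentableBy (δ n) (ρ n) (I n) (hI n))
  refine ⟨𝓞, ρ, colimit.cocone 𝓞, colimit.isColimit 𝓞, ρU, δ, e, h𝓞, hstep, hρU, hδ,
    fun n => ⟨I n, fun R φ => ?_⟩,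
    fun n => exists_corepresentableBy_step hunip hfg n (hfin 1 n), he₁, he₂⟩
  rw [← hI]
  exact ⟨fun ⟨y, hy⟩ => hy ▸ y.2, fun h => ⟨⟨_, h⟩, rfl⟩⟩
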